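/- Let $F=\mathbb{Q}(q,t)$ and let $\Lambda_F$ be the ring of symmetric functions over $F$ in $x=(x_1,x_2,\dots)$, with power sums $p_k$, products $p_\lambda=\prod_i p_{\lambda_i}$, and complete symmetric functions $h_r$. Equip $\Lambda_F$ with the scalar product $$\langle p_\lambda,p_\mu\rangle_{q,t}=\delta_{\lambda\mu}\prod_{i\ge1}m_i(\lambda)!\,i^{m_i(\lambda)}\prod_{i=1}^{\ell(\lambda)}\frac{1-q^{\lambda_i}}{1-t^{\lambda_i}},$$ where $m_i(\lambda)$ is the multiplicity of the part $i$ in $\lambda$ and $\ell(\lambda)$ is the number of parts. Let $P_\lambda(x;q,t)$ be the Macdonald functions, i.e. the functions obtained by Gram–Schmidt orthogonalization of the monomial symmetric functions $m_\lambda$ (equivalently, of the Schur functions) along the lexicographic order on partitions, with $P_\lambda=m_\lambda+(\text{combination of } m_\mu \text{ with } \mu \text{ smaller than } \lambda)$. Put $Q_\lambda=P_\lambda/\langle P_\lambda,P_\lambda\rangle_{q,t}$, and let $Q'_\lambda(x;q,t)$ be the image of $Q_\lambda$ under the $F$-algebra endomorphism of $\Lambda_F$ with $p_k\mapsto\frac{1-q^k}{1-t^k}\,p_k$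 for all $k\ge1$. Theorem. Let $l$ and $r$ be two positive integers and let $\zeta\in\mathbb{C}$ be a primitive $l$-th root of unity. Let $(r^l)$ be the partition with $l$ parts equal to $r$. Then the coefficients of $Q'_{(r^l)}(x;q,t)$ have no pole along $t=\zeta$, and its specialization at $t=\zeta$, a symmetric function over $\mathbb{C}(q)$, is $$Q'_{(r^l)}(x;q,\zeta)=(-1)^{(l-1)r}\,(p_l\circ h_r)(x),$$ where $p_l\circ h_r$ is the plethysm, i.e. $(p_l\circ h_r)(x)=h_r(x_1^l,x_2^l,\dots)$. -/

import Mathlib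

/-! Symmetric functions in the countably many variables `x_0, x_1, x_2, …`, and the
Macdonald functions `P_λ(x; q, t)`, `Q_λ(x; q, t)` and `Q'_λ(x; q, t)`. -/

namespace SymmFun

open MvPowerSeries

/-! ### The ring of symmetric functions -/

section Ring

/-- The ring `Λ_R` of symmetric functions with coefficients in `R`: the formal power series in
`x_0, x_1, …` which are of bounded degree and invariant under all permutations of the variables. -/
noncomputable def Lam (R : Type*) [CommSemiring R] : Subalgebra R (MvPowerSeries ℕ R) where
  carrier := {f | (∀ σ : Equiv.Perm ℕ, rename σ f = f) ∧
    ∃ N : ℕ, ∀ a : ℕ →₀ ℕ, N < a.degree → coeff a f = 0}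
  mul_mem' := by
    rintro f g ⟨hf, N, hN⟩ ⟨hg, M, hM⟩
    refine ⟨fun σ => by rw [map_mul, hf σ, hg σ], N + M, fun a ha => ?_⟩
    classical
    rw [coeff_mul]
    refine Finset.sum_eq_zero fun p hp => ?_
    rw [Finset.HasAntidiagonal.mem_antidiagonal] at hp
    by_cases h : N < p.1.degree
    · rw [hN _ h, zero_mul]
    · rw [hM, mul_zero]
      rw [← hp, map_add] at ha
      omega
  add_mem' := by
    rintro f g ⟨hf, N, hN⟩ ⟨hg, M, hM⟩
    refine ⟨fun σ => by rw [map_add, hf σ, hg σ], N + M, fun a ha => ?_⟩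
    rw [map_add, hN a (by omega), hM a (by omega), add_zero]
  algebraMap_mem' r := by
    refine ⟨fun σ => AlgHom.commutes _ r, 0, fun a ha => ?_⟩
    classical
    rw [MvPowerSeries.algebraMap_apply, Algebra.algebraMap_self, RingHom.id_apply, coeff_C,
      if_neg]
    rintro rfl
    simp at ha

/-- The multiset of the nonzero exponents of the monomial `x^a`. -/
def expType (a : ℕ →₀ ℕ) : Multiset ℕ := a.support.val.map a

theorem expType_mapDomain (σ : Equiv.Perm ℕ) (a : ℕ →₀ ℕ) :
    expType (a.mapDomain σ) = expType a := by
  have h : a.mapDomain σ = a.embDomain σ.toEmbedding :=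
    (Finsupp.embDomain_eq_mapDomain σ.toEmbedding a).symm
  rw [h, expType, expType, Finsupp.support_embDomain, Finset.map_val, Multiset.map_map]
  refine Multiset.map_congr rfl fun x _ => ?_
  exact Finsupp.embDomain_apply_self σ.toEmbedding a x

theorem coeff_rename_perm {R : Type*} [CommSemiring R] (σ : Equiv.Perm ℕ)
    (f : MvPowerSeries ℕ R) (a : ℕ →₀ ℕ) :
    coeff (a.mapDomain σ) (rename σ f) = coeff a f := by
  have := coeff_embDomain_rename σ.toEmbedding f a
  rwa [Finsupp.embDomain_eq_mapDomain] at this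

/-- A power series whose coefficients depend only on the nonzero exponents is invariant. -/
theorem rename_eq_of_expType {R : Type*} [CommSemiring R] {f : MvPowerSeries ℕ R}
    (h : ∀ a b, expType a = expType b → coeff a f = coeff b f) (σ : Equiv.Perm ℕ) :
    rename σ f = f := by
  ext a
  have ha : (a.mapDomain σ.symm).mapDomain σ = a := by
    rw [← Finsupp.mapDomain_comp]
    simp
  rw [← ha, coeff_rename_perm]
  exact h _ _ (expType_mapDomain _ _).symm

theorem expType_sum (a : ℕ →₀ ℕ) : (expType a).sum = a.degree := rfl

/-- Build a symmetric function from a function of the multiset of nonzero exponents. -/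
noncomputable def ofType {R : Type*} [CommSemiring R] (c : Multiset ℕ → R) (N : ℕ)
    (h : ∀ s : Multiset ℕ, N < s.sum → c s = 0) : Lam R :=
  ⟨fun a => c (expType a),
    rename_eq_of_expType fun a b hab => by
      change c (expType a) = c (expType b)
      rw [hab],
    N, fun a ha => h _ (by rwa [expType_sum])⟩

theorem coeff_ofType {R : Type*} [CommSemiring R] (c : Multiset ℕ → R) (N : ℕ)
    (h : ∀ s : Multiset ℕ, N < s.sum → c s = 0) (a : ℕ →₀ ℕ) :
    coeff a (ofType c N h : MvPowerSeries ℕ R) = c (expType a) := rfl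

variable (R : Type*) [CommSemiring R]

open Classical in
/-- The power sum `p_k = ∑ x_i ^ k`, for `k ≥ 1`: a monomial occurs in it, with coefficient `1`,
exactly if its multiset of nonzero exponents is `{k}`. -/
noncomputable def psum (k : ℕ+) : Lam R :=
  ofType (fun s => if s = {(k : ℕ)} then 1 else 0) k fun s hs => if_neg (by
    rintro rfl
    simp at hs)

open Classical in
/-- The complete symmetric function `h_r`, the sum of all monomials of degree `r`. -/
noncomputable def hsymm (r : ℕ) : Lam R :=
  ofType (fun s => if s.sum = r then 1 else 0) r fun _ hs => if_neg (by omega)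

open Classical in
/-- The monomial symmetric function `m_μ`, the sum of all monomials whose nonzero exponents are
the parts of `μ`. -/
noncomputable def msymm {n : ℕ} (μ : n.Partition) : Lam R :=
  ofType (fun s => if s = μ.parts then 1 else 0) n fun s hs => if_neg (by
    rintro rfl
    rw [μ.parts_sum] at hs
    omega)

/-- Change of coefficients `Λ_R → Λ_S` along a ring homomorphism `R → S`. -/
noncomputable def Lam.map {R S : Type*} [CommSemiring R] [CommSemiring S] (φ : R →+* S)
    (f : Lam R) : Lam S :=
  ⟨MvPowerSeries.map φ f, fun σ => by rw [rename_map, f.2.1 σ],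
    f.2.2.imp fun N hN a ha => by rw [coeff_map, hN a ha, map_zero]⟩

theorem coeff_expand {R : Type*} [CommRing R] (k : ℕ) (hk : k ≠ 0) (f : MvPowerSeries ℕ R)
    (a : ℕ →₀ ℕ) :
    (coeff a (expand k hk f) = 0 ∧ ¬ ∃ b, a = k • b) ∨
      ∃ b, a = k • b ∧ coeff a (expand k hk f) = coeff b f := by
  by_cases h : ∀ i, k ∣ a i
  · right
    refine ⟨a.mapRange (· / k) (by simp), ?_, ?_⟩
    · ext i
      simp [Nat.mul_div_cancel' (h i)]
    · rw [← coeff_expand_smul k hk f]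
      congr 1
      congr 1
      ext i
      simp [Nat.mul_div_cancel' (h i)]
  · left
    push Not at h
    obtain ⟨i, hi⟩ := h
    refine ⟨coeff_expand_of_not_dvd k hk f hi, ?_⟩
    rintro ⟨b, rfl⟩
    exact hi (by simp)

/-- The symmetric function `g(x_0 ^ k, x_1 ^ k, …)`, for `k ≥ 1`. -/
noncomputable def powVars {R : Type*} [CommRing R] (k : ℕ+) (g : Lam R) : Lam R :=
  ⟨expand k k.ne_zero (g : MvPowerSeries ℕ R), by
    refine ⟨fun σ => ?_, ?_⟩
    · ext a
      have ha : (a.mapDomain σ.symm).mapDomain σ = a := by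
        rw [← Finsupp.mapDomain_comp]
        simp
      rw [← ha, coeff_rename_perm]
      generalize a.mapDomain σ.symm = b
      rcases coeff_expand k k.ne_zero (g : MvPowerSeries ℕ R) b with ⟨h, hb⟩ | ⟨c, rfl, h⟩
      · rcases coeff_expand k k.ne_zero (g : MvPowerSeries ℕ R) (b.mapDomain σ)
          with ⟨h', -⟩ | ⟨c, hc, -⟩
        · rw [h, h']
        · refine absurd ⟨c.mapDomain σ.symm, ?_⟩ hb
          rw [← Finsupp.mapDomain_smul, ← hc, ← Finsupp.mapDomain_comp]
          simp
      · rw [h, Finsupp.mapDomain_smul, coeff_expand_smul, ← coeff_rename_perm σ, g.2.1 σ]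
    · obtain ⟨N, hN⟩ := g.2.2
      refine ⟨k * N, fun a ha => ?_⟩
      rcases coeff_expand k k.ne_zero (g : MvPowerSeries ℕ R) a with ⟨h, -⟩ | ⟨c, rfl, h⟩
      · exact h
      · rw [h]
        refine hN c ?_
        rw [map_nsmul, smul_eq_mul] at ha
        exact lt_of_mul_lt_mul_left ha (Nat.zero_le _)⟩

end Ring

/-! ### The power sums generate the ring freely -/

section PowerSums

theorem exists_perm_of_expType_eq {a b : ℕ →₀ ℕ} (h : expType a = expType b) :
    ∃ σ : Equiv.Perm ℕ, a.mapDomain σ = b := by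
  classical
  -- on a finite set containing both supports, the values agree as multisets
  have key : ∀ k, k ≠ 0 → (a.support.filter (fun i => a i = k)).card =
      (b.support.filter (fun i => b i = k)).card := by
    intro k _
    have h1 := congrArg (Multiset.count k) h
    rw [expType, expType, Multiset.count_map, Multiset.count_map] at h1
    have e1 : ∀ c : ℕ →₀ ℕ, (c.support.filter (fun i => c i = k)).card =
        Multiset.card (c.support.val.filter fun i => k = c i) := by
      intro c
      rw [Finset.card_def, Finset.filter_val]
      simp only [eq_comm]
    rw [e1, e1, h1]
  let S := a.support ∪ b.support
  have key2 : ∀ k, Nonempty ({i : S // a i = k} ≃ {i : S // b i = k}) := by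
    intro k
    rw [← Fintype.card_eq]
    have hne : ∀ (c : ℕ →₀ ℕ), c.support ⊆ S → ∀ m, m ≠ 0 →
        Fintype.card {i : S // c i = m} = (c.support.filter (fun i => c i = m)).card := by
      intro c hc m hm
      rw [← Fintype.card_coe]
      refine Fintype.card_congr
        ⟨fun i => ⟨i.1.1, by simp [i.2, hm]⟩, fun i => ⟨⟨i.1, hc ?_⟩, ?_⟩, ?_, ?_⟩
      · exact (Finset.mem_filter.1 i.2).1
      · exact (Finset.mem_filter.1 i.2).2
      · intro i; rfl
      · intro i; rfl
    by_cases hk : k = 0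
    · subst hk
      have hz : ∀ (c : ℕ →₀ ℕ), c.support ⊆ S →
          Fintype.card {i : S // c i = 0} = S.card - c.support.card := by
        intro c hc
        have h1 := Fintype.card_subtype_compl (fun i : S => c i ≠ 0)
        have h2 : Fintype.card {i : S // c i ≠ 0} = c.support.card := by
          rw [← Fintype.card_coe]
          refine Fintype.card_congr
            ⟨fun i => ⟨i.1.1, by simp [i.2]⟩, fun i => ⟨⟨i.1, hc i.2⟩, ?_⟩, ?_, ?_⟩
          · exact Finsupp.mem_support_iff.1 i.2
          · intro i; rfl
          · intro i; rfl
        rw [h2, Fintype.card_coe] at h1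
        rw [← h1]
        exact Fintype.card_congr (Equiv.subtypeEquivRight fun i => by simp)
      rw [hz a Finset.subset_union_left, hz b Finset.subset_union_right]
      have := congrArg Multiset.card h
      rw [expType, expType, Multiset.card_map, Multiset.card_map] at this
      rw [Finset.card_def a.support, this, Finset.card_def b.support]
    · rw [hne a Finset.subset_union_left k hk, hne b Finset.subset_union_right k hk, key k hk]
  let e := fun k => (key2 k).some
  let τ : S ≃ S := (Equiv.sigmaFiberEquiv (fun i : S => a i)).symm.trans
    ((Equiv.sigmaCongrRight e).trans (Equiv.sigmaFiberEquiv (fun i : S => b i)))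
  have hτ : ∀ i : S, b (τ i) = a i := fun i => (e (a i) ⟨i, rfl⟩).2
  refine ⟨Equiv.Perm.ofSubtype τ, ?_⟩
  ext j
  obtain ⟨i, rfl⟩ := (Equiv.Perm.ofSubtype τ).surjective j
  rw [Finsupp.mapDomain_apply (Equiv.injective _)]
  by_cases hi : i ∈ S
  · rw [Equiv.Perm.ofSubtype_apply_of_mem τ hi]
    exact (hτ ⟨i, hi⟩).symm
  · rw [Equiv.Perm.ofSubtype_apply_of_not_mem τ hi]
    simp only [S, Finset.mem_union, not_or, Finsupp.mem_support_iff, not_not] at hi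
    rw [hi.1, hi.2]

theorem coeff_eq_of_expType {R : Type*} [CommSemiring R] (f : Lam R) {a b : ℕ →₀ ℕ}
    (h : expType a = expType b) :
    coeff a (f : MvPowerSeries ℕ R) = coeff b (f : MvPowerSeries ℕ R) := by
  obtain ⟨σ, rfl⟩ := exists_perm_of_expType_eq h
  conv_rhs => rw [← f.2.1 σ]
  exact (coeff_rename_perm σ _ a).symm

theorem expType_add_single {a : ℕ →₀ ℕ} {i k : ℕ} (hi : a i = 0) (hk : k ≠ 0) :
    expType (Finsupp.single i k + a) = k ::ₘ expType a := by
  classical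
  have hd : i ∉ a.support := by simpa using hi
  have hs : (Finsupp.single i k + a).support = insert i a.support := by
    ext j
    by_cases hj : j = i
    · subst hj; simp [hk]
    · simp [hj]
  rw [expType, hs, Finset.insert_val_of_notMem hd, Multiset.map_cons]
  congr 1
  · simp [hi]
  · refine Multiset.map_congr rfl fun j hj => ?_
    have : i ≠ j := by rintro rfl; exact hd hj
    simp [this]

theorem expType_eq_singleton {a : ℕ →₀ ℕ} {k : ℕ} (hk : k ≠ 0) :
    expType a = {k} ↔ ∃ i, a = Finsupp.single i k := by
  constructor
  · intro h
    obtain ⟨i, hi, -⟩ := Multiset.map_eq_singleton.1 h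
    refine ⟨i, ?_⟩
    have hs : a.support = {i} := Finset.val_injective hi
    rw [expType, hs] at h
    have h2 : a i = k := by simpa using h
    rw [Finsupp.support_eq_singleton] at hs
    rw [← h2]
    exact hs.2
  · rintro ⟨i, rfl⟩
    have := expType_add_single (a := 0) (i := i) rfl hk
    simpa [expType] using this

theorem coeff_psum_mul_ne_zero (k : ℕ+) (g : MvPowerSeries ℕ ℕ) (a : ℕ →₀ ℕ) :
    coeff a ((psum ℕ k : MvPowerSeries ℕ ℕ) * g) ≠ 0 ↔
      ∃ i b, a = Finsupp.single i (k : ℕ) + b ∧ coeff b g ≠ 0 := by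
  classical
  rw [coeff_mul, Ne, Finset.sum_eq_zero_iff, not_forall]
  constructor
  · rintro ⟨⟨u, b⟩, h⟩
    rw [Classical.not_imp, Finset.HasAntidiagonal.mem_antidiagonal] at h
    obtain ⟨rfl, h⟩ := h
    rw [psum, coeff_ofType] at h
    have hu : expType u = {(k : ℕ)} := by
      by_contra hu
      simp [hu] at h
    obtain ⟨i, rfl⟩ := (expType_eq_singleton k.ne_zero).1 hu
    exact ⟨i, b, rfl, right_ne_zero_of_mul h⟩
  · rintro ⟨i, b, rfl, h⟩
    refine ⟨(Finsupp.single i (k : ℕ), b), ?_⟩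
    rw [Classical.not_imp, Finset.HasAntidiagonal.mem_antidiagonal, psum, coeff_ofType,
      if_pos ((expType_eq_singleton k.ne_zero).2 ⟨i, rfl⟩), one_mul]
    exact ⟨rfl, h⟩

/-- The product of the power sums indexed by a multiset of positive integers. -/
noncomputable def psumProd (R : Type*) [CommSemiring R] (s : Multiset ℕ+) : Lam R :=
  (s.map (psum R)).prod

theorem psumProd_cons (R : Type*) [CommSemiring R] (k : ℕ+) (s : Multiset ℕ+) :
    (psumProd R (k ::ₘ s) : MvPowerSeries ℕ R) =
      (psum R k : MvPowerSeries ℕ R) * (psumProd R s : MvPowerSeries ℕ R) := by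
  rw [psumProd, Multiset.map_cons, Multiset.prod_cons]
  rfl

theorem card_expType (a : ℕ →₀ ℕ) : Multiset.card (expType a) = a.support.card := by
  rw [expType, Multiset.card_map, Finset.card_def]

theorem psumProd_support (s : Multiset ℕ+) : ∀ a : ℕ →₀ ℕ,
    coeff a (psumProd ℕ s : MvPowerSeries ℕ ℕ) ≠ 0 →
      Multiset.card (expType a) ≤ Multiset.card s ∧
      (Multiset.card s ≤ Multiset.card (expType a) → expType a = s.map (fun k : ℕ+ => (k : ℕ))) := by
  classical
  induction s using Multiset.induction_on with
  | empty =>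
    intro a ha
    have h1 : (psumProd ℕ 0 : MvPowerSeries ℕ ℕ) = 1 := by simp [psumProd]
    rw [h1, coeff_one] at ha
    have : a = 0 := by
      by_contra h
      simp [h] at ha
    subst this
    simp [expType]
  | cons k s ih =>
    intro a ha
    rw [psumProd_cons, coeff_psum_mul_ne_zero] at ha
    obtain ⟨i, b, rfl, hb⟩ := ha
    obtain ⟨h1, h2⟩ := ih b hb
    by_cases hi : b i = 0
    · rw [expType_add_single hi k.ne_zero, Multiset.card_cons, Multiset.card_cons,
        Multiset.map_cons]
      refine ⟨by omega, fun h => ?_⟩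
      rw [h2 (by omega)]
    · have hs : (Finsupp.single i (k : ℕ) + b).support ⊆ b.support := by
        intro j hj
        by_cases hji : j = i
        · subst hji; simpa using hi
        · simpa [Finsupp.single_apply, Ne.symm hji] using hj
      have hc := Finset.card_le_card hs
      rw [← card_expType, ← card_expType] at hc
      rw [Multiset.card_cons]
      exact ⟨by omega, fun h => by omega⟩

theorem psumProd_self (s : Multiset ℕ+) : ∀ a : ℕ →₀ ℕ,
    expType a = s.map (fun k : ℕ+ => (k : ℕ)) →
      coeff a (psumProd ℕ s : MvPowerSeries ℕ ℕ) ≠ 0 := by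
  classical
  induction s using Multiset.induction_on with
  | empty =>
    intro a ha
    have h1 : (psumProd ℕ 0 : MvPowerSeries ℕ ℕ) = 1 := by simp [psumProd]
    have : a = 0 := by simpa [expType] using ha
    rw [h1, this]
    simp
  | cons k s ih =>
    intro a ha
    rw [psumProd_cons, coeff_psum_mul_ne_zero]
    rw [Multiset.map_cons] at ha
    have hk : (k : ℕ) ∈ expType a := by rw [ha]; exact Multiset.mem_cons_self _ _
    obtain ⟨i, -, hik⟩ := Multiset.mem_map.1 hk
    have hab : a = Finsupp.single i (k : ℕ) + a.erase i := by
      rw [← hik, Finsupp.single_add_erase]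
    refine ⟨i, a.erase i, hab, ih _ ?_⟩
    rw [hab, expType_add_single (by simp) k.ne_zero] at ha
    exact (Multiset.cons_inj_right _).1 ha

theorem exists_expType (s : Multiset ℕ+) :
    ∃ a : ℕ →₀ ℕ, expType a = s.map (fun k : ℕ+ => (k : ℕ)) := by
  induction s using Multiset.induction_on with
  | empty => exact ⟨0, by simp [expType]⟩
  | cons k s ih =>
    obtain ⟨a, ha⟩ := ih
    obtain ⟨i, hi⟩ := Infinite.exists_notMem_finset a.support
    refine ⟨Finsupp.single i (k : ℕ) + a, ?_⟩
    rw [expType_add_single (by simpa using hi) k.ne_zero, ha, Multiset.map_cons]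

theorem exists_pnat_type (a : ℕ →₀ ℕ) :
    ∃ s : Multiset ℕ+, expType a = s.map (fun k : ℕ+ => (k : ℕ)) := by
  have h : ∀ k ∈ expType a, 0 < k := by
    intro k hk
    obtain ⟨i, hi, rfl⟩ := Multiset.mem_map.1 hk
    exact Nat.pos_of_ne_zero (Finsupp.mem_support_iff.1 hi)
  refine ⟨(expType a).pmap (fun k hk => Nat.toPNat k hk) h, ?_⟩
  rw [Multiset.map_pmap]
  exact ((Multiset.pmap_eq_map (fun k : ℕ => 0 < k) (fun k : ℕ => k) _ h).trans
    (Multiset.map_id' _)).symm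

theorem map_pnat_injective :
    Function.Injective (fun s : Multiset ℕ+ => s.map (fun k : ℕ+ => (k : ℕ))) :=
  Multiset.map_injective PNat.coe_injective

theorem psumProd_cast (R : Type*) [CommSemiring R] (s : Multiset ℕ+) :
    (psumProd R s : MvPowerSeries ℕ R) =
      MvPowerSeries.map (Nat.castRingHom R) (psumProd ℕ s : MvPowerSeries ℕ ℕ) := by
  classical
  induction s using Multiset.induction_on with
  | empty => simp [psumProd]
  | cons k s ih =>
    rw [psumProd_cons, psumProd_cons, map_mul, ← ih]
    congr 1
    ext a
    rw [coeff_map, psum, psum, coeff_ofType, coeff_ofType]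
    split_ifs <;> simp

variable {R : Type*} [Field R]

theorem coeff_psumProd_ne_zero [CharZero R] (s : Multiset ℕ+) (a : ℕ →₀ ℕ) :
    coeff a (psumProd R s : MvPowerSeries ℕ R) ≠ 0 ↔
      coeff a (psumProd ℕ s : MvPowerSeries ℕ ℕ) ≠ 0 := by
  rw [psumProd_cast, coeff_map]
  simp

variable (R) in
/-- The homomorphism from the polynomial ring in indeterminates `X_k`, `k ≥ 1`, which sends `X_k`
to the power sum `p_k`. -/
noncomputable def psumAeval : MvPolynomial ℕ+ R →ₐ[R] Lam R := MvPolynomial.aeval (psum R)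

theorem psumAeval_eq_sum (g : MvPolynomial ℕ+ R) :
    psumAeval R g = ∑ d ∈ g.support, MvPolynomial.coeff d g • psumProd R d.toMultiset := by
  conv_lhs => rw [g.as_sum, map_sum]
  refine Finset.sum_congr rfl fun d _ => ?_
  rw [psumAeval, MvPolynomial.aeval_monomial, Algebra.smul_def, psumProd, Finsupp.toMultiset_map,
    Finsupp.prod_toMultiset, Finsupp.prod_mapDomain_index (by simp) (by intros; rw [pow_add])]

theorem coeff_smul_psumProd (c : R) (s : Multiset ℕ+) (a : ℕ →₀ ℕ) :
    coeff a ((c • psumProd R s : Lam R) : MvPowerSeries ℕ R) =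
      c * coeff a (psumProd R s : MvPowerSeries ℕ R) := rfl

theorem coeff_sum_Lam {ι : Type*} (t : Finset ι) (f : ι → Lam R) (a : ℕ →₀ ℕ) :
    coeff a ((∑ i ∈ t, f i : Lam R) : MvPowerSeries ℕ R) =
      ∑ i ∈ t, coeff a (f i : MvPowerSeries ℕ R) := by
  rw [AddSubmonoidClass.coe_finsetSum, map_sum]

theorem psumAeval_injective [CharZero R] : Function.Injective (psumAeval R) := by
  classical
  rw [injective_iff_map_eq_zero]
  intro g hg
  by_contra hne
  obtain ⟨d, hd, hmax⟩ := Finset.exists_max_image g.support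
    (fun d => Multiset.card d.toMultiset) (MvPolynomial.support_nonempty.2 hne)
  obtain ⟨a, ha⟩ := exists_expType d.toMultiset
  have h0 : coeff a (psumAeval R g : MvPowerSeries ℕ R) = 0 := by rw [hg]; simp
  rw [psumAeval_eq_sum, coeff_sum_Lam, Finset.sum_eq_single_of_mem d hd] at h0
  · rw [coeff_smul_psumProd] at h0
    rcases mul_eq_zero.1 h0 with h | h
    · exact (MvPolynomial.mem_support_iff.1 hd) h
    · exact (coeff_psumProd_ne_zero _ _).2 (psumProd_self _ a ha) h
  · intro e he hed
    rw [coeff_smul_psumProd]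
    by_contra h
    obtain ⟨h1, h2⟩ := psumProd_support _ a ((coeff_psumProd_ne_zero _ _).1 (right_ne_zero_of_mul h))
    have hc : Multiset.card (expType a) = Multiset.card d.toMultiset := by
      rw [ha, Multiset.card_map]
    have h3 := h2 (by rw [hc]; exact hmax e he)
    rw [ha] at h3
    exact hed (by simpa using congrArg Multiset.toFinsupp (map_pnat_injective h3).symm)

theorem psumProd_mem_range (s : Multiset ℕ+) : psumProd R s ∈ (psumAeval R).range := by
  refine Subalgebra.multiset_prod_mem _ fun f hf => ?_
  obtain ⟨k, -, rfl⟩ := Multiset.mem_map.1 hf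
  exact ⟨MvPolynomial.X k, by simp [psumAeval]⟩

theorem finite_types (f : Lam R) (k : ℕ) :
    {s : Multiset ℕ+ | Multiset.card s = k ∧ ∃ a : ℕ →₀ ℕ,
      expType a = s.map (fun k : ℕ+ => (k : ℕ)) ∧
      coeff a (f : MvPowerSeries ℕ R) ≠ 0}.Finite := by
  classical
  obtain ⟨N, hN⟩ := f.2.2
  refine (Set.finite_Iic (k • (Finset.Icc (1 : ℕ+) N.succPNat).val)).subset ?_
  rintro s ⟨hs, a, ha, hf⟩
  rw [Set.mem_Iic, Multiset.le_iff_count]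
  intro x
  by_cases hx : x ∈ s
  · have h1 : (x : ℕ) ≤ N := by
      by_contra hlt
      refine hf (hN a ?_)
      rw [← expType_sum, ha]
      have := Multiset.single_le_sum (fun _ _ => Nat.zero_le _) _
        (Multiset.mem_map_of_mem (fun k : ℕ+ => (k : ℕ)) hx)
      omega
    have h2 : x ∈ Finset.Icc (1 : ℕ+) N.succPNat := by
      rw [Finset.mem_Icc]
      refine ⟨one_le, ?_⟩
      rw [← PNat.coe_le_coe, Nat.succPNat_coe]
      omega
    rw [Multiset.count_nsmul, Multiset.count_eq_one_of_mem (Finset.nodup _) h2, mul_one, ← hs]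
    exact Multiset.count_le_card _ _
  · rw [Multiset.count_eq_zero_of_notMem hx]
    exact Nat.zero_le _

theorem mem_range_of_length [CharZero R] (k : ℕ) : ∀ f : Lam R,
    (∀ a, coeff a (f : MvPowerSeries ℕ R) ≠ 0 → Multiset.card (expType a) < k) →
      f ∈ (psumAeval R).range := by
  classical
  induction k with
  | zero =>
    intro f hf
    have : f = 0 := by
      ext a
      by_contra h
      exact absurd (hf a h) (Nat.not_lt_zero _)
    rw [this]
    exact Subalgebra.zero_mem _
  | succ k ih =>
    intro f hf
    choose r hr using exists_expType
    let T := (finite_types f k).toFinset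
    let g : Lam R := ∑ s ∈ T, (coeff (r s) (f : MvPowerSeries ℕ R) /
      coeff (r s) (psumProd R s : MvPowerSeries ℕ R)) • psumProd R s
    have hg : g ∈ (psumAeval R).range :=
      Subalgebra.sum_mem _ fun s _ => Subalgebra.smul_mem _ (psumProd_mem_range s) _
    have hT : ∀ s ∈ T, Multiset.card s = k := fun s hs =>
      ((Set.Finite.mem_toFinset _).1 hs).1
    suffices h : f - g ∈ (psumAeval R).range by
      have := Subalgebra.add_mem _ h hg
      rwa [sub_add_cancel] at this
    refine ih _ fun a ha => ?_
    by_contra hlt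
    refine ha ?_
    have hsub : coeff a ((f - g : Lam R) : MvPowerSeries ℕ R) =
        coeff a (f : MvPowerSeries ℕ R) - coeff a (g : MvPowerSeries ℕ R) := by
      rw [AddSubgroupClass.coe_sub, map_sub]
    obtain ⟨s0, hs0⟩ := exists_pnat_type a
    -- products of `k` power sums other than `s0` do not contain `x^a`
    have hz : ∀ s ∈ T, s ≠ s0 → coeff a (psumProd R s : MvPowerSeries ℕ R) = 0 := by
      intro s hs hne
      by_contra h
      obtain ⟨h1, h2⟩ := psumProd_support _ a ((coeff_psumProd_ne_zero _ _).1 h)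
      have := h2 (by rw [hT s hs]; omega)
      rw [hs0] at this
      exact hne (map_pnat_injective this).symm
    have hga : coeff a (g : MvPowerSeries ℕ R) = if s0 ∈ T then
        coeff a (f : MvPowerSeries ℕ R) else 0 := by
      rw [coeff_sum_Lam]
      split_ifs with h
      · rw [Finset.sum_eq_single_of_mem s0 h]
        · rw [coeff_smul_psumProd, coeff_eq_of_expType f ((hr s0).trans hs0.symm),
            coeff_eq_of_expType (psumProd R s0) ((hr s0).trans hs0.symm), div_mul_cancel₀]
          exact (coeff_psumProd_ne_zero _ _).2 (psumProd_self _ a hs0)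
        · intro s hs hne
          rw [coeff_smul_psumProd, hz s hs hne, mul_zero]
      · refine Finset.sum_eq_zero fun s hs => ?_
        rw [coeff_smul_psumProd, hz s hs (by rintro rfl; exact h hs), mul_zero]
    rw [hsub, hga]
    split_ifs with h
    · exact sub_self _
    · rw [sub_zero]
      by_contra hfa
      have h1 := hf a hfa
      refine h ((Set.Finite.mem_toFinset _).2 ⟨?_, a, hs0, hfa⟩)
      rw [hs0, Multiset.card_map] at h1 hlt
      omega

theorem psumAeval_surjective [CharZero R] : Function.Surjective (psumAeval R) := by
  intro f
  obtain ⟨N, hN⟩ := f.2.2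
  refine mem_range_of_length (N + 1) f fun a ha => ?_
  by_contra h
  refine ha (hN a ?_)
  have : Multiset.card (expType a) ≤ (expType a).sum := by
    obtain ⟨s, hs⟩ := exists_pnat_type a
    rw [hs, Multiset.card_map]
    have := Multiset.card_nsmul_le_sum (s := s.map (fun k : ℕ+ => (k : ℕ))) (a := 1)
      (by
        intro x hx
        obtain ⟨k, -, rfl⟩ := Multiset.mem_map.1 hx
        exact k.pos)
    simpa using this
  rw [expType_sum] at this
  omega

variable (R) in
/-- Over a field of characteristic zero, `Λ_R` is the polynomial ring in the power sums. -/
noncomputable def psumEquiv [CharZero R] : MvPolynomial ℕ+ R ≃ₐ[R] Lam R :=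
  AlgEquiv.ofBijective (psumAeval R) ⟨psumAeval_injective, psumAeval_surjective⟩

theorem psumEquiv_X [CharZero R] (k : ℕ+) : psumEquiv R (MvPolynomial.X k) = psum R k := by
  simp [psumEquiv, psumAeval]

variable (R) in
/-- The basis of `Λ_R` by the products `∏ p_k ^ (d k)`. A partition `λ` is encoded by its
multiplicities `d k = m_k(λ)`, so that this product is `p_λ`. -/
noncomputable def psumBasis [CharZero R] : Module.Basis (ℕ+ →₀ ℕ) R (Lam R) :=
  (MvPolynomial.basisMonomials ℕ+ R).map (psumEquiv R).toLinearEquiv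

theorem psumBasis_apply [CharZero R] (d : ℕ+ →₀ ℕ) : psumBasis R d = d.prod fun k m => psum R k ^ m := by
  rw [psumBasis, Module.Basis.map_apply, MvPolynomial.coe_basisMonomials]
  simp [psumEquiv, psumAeval, MvPolynomial.aeval_monomial]

end PowerSums

/-! ### Plethysm -/

/-- The plethysm `f ∘ g` of symmetric functions with rational coefficients: `f ↦ f ∘ g` is the
algebra homomorphism with `p_k ∘ g = g(x_0 ^ k, x_1 ^ k, …)`. -/
noncomputable def plethysm (f g : Lam ℚ) : Lam ℚ :=
  MvPolynomial.aeval (fun k : ℕ+ => powVars k g) ((psumEquiv ℚ).symm f)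

theorem plethysm_psum (k : ℕ+) (g : Lam ℚ) : plethysm (psum ℚ k) g = powVars k g := by
  rw [plethysm, ← psumEquiv_X, AlgEquiv.symm_apply_apply, MvPolynomial.aeval_X]

/-! ### Macdonald functions -/

section Macdonald

/-- The field `ℚ(q, t)` of rational functions in two indeterminates. -/
abbrev Fqt : Type := FractionRing (MvPolynomial (Fin 2) ℚ)

instance : CharZero Fqt :=
  charZero_of_injective_algebraMap (IsFractionRing.injective (MvPolynomial (Fin 2) ℚ) Fqt)

/-- The indeterminate `q`. -/
noncomputable def q : Fqt := algebraMap (MvPolynomial (Fin 2) ℚ) Fqt (MvPolynomial.X 0)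

/-- The indeterminate `t`. -/
noncomputable def t : Fqt := algebraMap (MvPolynomial (Fin 2) ℚ) Fqt (MvPolynomial.X 1)

/-- `z_λ(q, t) = ∏ m_k! k ^ m_k ((1 - q ^ k) / (1 - t ^ k)) ^ m_k`, where `m_k = d k` is the
multiplicity of the part `k` in the partition `λ`. -/
noncomputable def zqt (d : ℕ+ →₀ ℕ) : Fqt :=
  d.prod fun k m => (m.factorial : Fqt) * ((k : ℕ) : Fqt) ^ m *
    ((1 - q ^ (k : ℕ)) / (1 - t ^ (k : ℕ))) ^ m

/-- The scalar product `⟨ , ⟩_{q,t}` on `Λ` over `ℚ(q, t)`, the bilinear form with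
`⟨p_λ, p_μ⟩ = δ_{λμ} z_λ(q, t)`. -/
noncomputable def innerQT : Lam Fqt →ₗ[Fqt] Lam Fqt →ₗ[Fqt] Fqt :=
  (psumBasis Fqt).constr Fqt fun d => zqt d • (psumBasis Fqt).coord d

open Classical in
theorem innerQT_psumBasis (d e : ℕ+ →₀ ℕ) :
    innerQT (psumBasis Fqt d) (psumBasis Fqt e) = if d = e then zqt d else 0 := by
  rw [innerQT, Module.Basis.constr_basis, LinearMap.smul_apply, Module.Basis.coord_apply,
    Module.Basis.repr_self, Finsupp.single_apply, smul_eq_mul]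
  by_cases h : d = e
  · simp [h]
  · simp [h, Ne.symm h]

/-- The lexicographic order on the partitions of `n`, written in weakly decreasing order. This is
a total order, and it refines the dominance order. -/
def LexLT {n : ℕ} (ν μ : n.Partition) : Prop :=
  ν.parts.sort (· ≥ ·) < μ.parts.sort (· ≥ ·)

open Classical in
/-- The Macdonald function `P_μ(x; q, t)`, obtained from the monomial symmetric functions by
Gram-Schmidt orthogonalization with respect to `⟨ , ⟩_{q,t}`, along the lexicographic order.
Thus `P_μ - m_μ` is a combination of the `m_ν` with `ν` smaller than `μ`, and the
`P_μ` are pairwise orthogonal. -/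
noncomputable def macdonaldP {n : ℕ} (μ : n.Partition) : Lam Fqt :=
  msymm Fqt μ - ∑ ν : {ν : n.Partition // LexLT ν μ},
    (innerQT (msymm Fqt μ) (macdonaldP ν.1) / innerQT (macdonaldP ν.1) (macdonaldP ν.1)) •
      macdonaldP ν.1
termination_by (Finset.univ.filter fun ν : n.Partition => LexLT ν μ).card
decreasing_by
  all_goals
    refine Finset.card_lt_card (Finset.ssubset_iff_subset_ne.2 ⟨?_, ?_⟩)
    · intro κ hκ
      rw [Finset.mem_filter] at hκ ⊢
      exact ⟨Finset.mem_univ _, lt_trans hκ.2 ν.2⟩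
    · intro h
      have h1 : ν.1 ∈ Finset.univ.filter fun κ : n.Partition => LexLT κ μ :=
        Finset.mem_filter.2 ⟨Finset.mem_univ _, ν.2⟩
      rw [← h, Finset.mem_filter] at h1
      exact lt_irrefl _ h1.2

/-- `Q_μ = P_μ / ⟨P_μ, P_μ⟩_{q,t}`. -/
noncomputable def macdonaldQ {n : ℕ} (μ : n.Partition) : Lam Fqt :=
  (innerQT (macdonaldP μ) (macdonaldP μ))⁻¹ • macdonaldP μ

/-- The algebra endomorphism `f(x) ↦ f(((1 - q) / (1 - t)) x)` of `Λ`, which maps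
`p_k` to `((1 - q ^ k) / (1 - t ^ k)) p_k`. -/
noncomputable def prime : Lam Fqt →ₐ[Fqt] Lam Fqt :=
  (MvPolynomial.aeval fun k : ℕ+ =>
    ((1 - q ^ (k : ℕ)) / (1 - t ^ (k : ℕ))) • psum Fqt k).comp (psumEquiv Fqt).symm.toAlgHom

theorem prime_psum (k : ℕ+) :
    prime (psum Fqt k) = ((1 - q ^ (k : ℕ)) / (1 - t ^ (k : ℕ))) • psum Fqt k := by
  have h : (psumEquiv Fqt).symm (psum Fqt k) = MvPolynomial.X k := by
    rw [← psumEquiv_X, AlgEquiv.symm_apply_apply]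
  change MvPolynomial.aeval _ ((psumEquiv Fqt).symm (psum Fqt k)) = _
  rw [h, MvPolynomial.aeval_X]

/-- `Q'_μ(x; q, t) = Q_μ(((1 - q) / (1 - t)) x; q, t)`. -/
noncomputable def macdonaldQ' {n : ℕ} (μ : n.Partition) : Lam Fqt := prime (macdonaldQ μ)

end Macdonald

/-! ### Specialization of `t` -/

section Specialization

/-- The substitution `t = ζ` in a polynomial in `q` and `t`, with values in `ℂ(q)`. -/
noncomputable def evalT (ζ : ℂ) : MvPolynomial (Fin 2) ℚ →ₐ[ℚ] RatFunc ℂ :=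
  MvPolynomial.aeval ![RatFunc.X, RatFunc.C ζ]

/-- The rational function `a(q, t)` has no pole along `t = ζ`, and its specialization
`a(q, ζ)` is `b`: one can write `a = u / v` with polynomials `u`, `v` such that
`v(q, ζ) ≠ 0`, and `b = u(q, ζ) / v(q, ζ)`. -/
def IsValueAt (ζ : ℂ) (a : Fqt) (b : RatFunc ℂ) : Prop :=
  ∃ u v : MvPolynomial (Fin 2) ℚ, evalT ζ v ≠ 0 ∧
    a = algebraMap (MvPolynomial (Fin 2) ℚ) Fqt u / algebraMap (MvPolynomial (Fin 2) ℚ) Fqt v ∧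
    b = evalT ζ u / evalT ζ v

/-- The value at `t = ζ` is unique. -/
theorem IsValueAt.unique {ζ : ℂ} {a : Fqt} {b b' : RatFunc ℂ} (h : IsValueAt ζ a b)
    (h' : IsValueAt ζ a b') : b = b' := by
  obtain ⟨u, v, hv, rfl, rfl⟩ := h
  obtain ⟨u', v', hv', ha, rfl⟩ := h'
  have inj := IsFractionRing.injective (MvPolynomial (Fin 2) ℚ) Fqt
  have n0 : algebraMap (MvPolynomial (Fin 2) ℚ) Fqt v ≠ 0 := by
    intro h
    rw [inj (h.trans (map_zero _).symm), map_zero] at hv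
    exact hv rfl
  have n0' : algebraMap (MvPolynomial (Fin 2) ℚ) Fqt v' ≠ 0 := by
    intro h
    rw [inj (h.trans (map_zero _).symm), map_zero] at hv'
    exact hv' rfl
  rw [div_eq_div_iff n0 n0', ← map_mul, ← map_mul] at ha
  have := congrArg (evalT ζ) (inj ha)
  rw [map_mul, map_mul] at this
  rwa [div_eq_div_iff hv hv']

/-- The symmetric function `f(x; q, t)` has a specialization at `t = ζ` (none of its coefficients
has a pole there), and this specialization `f(x; q, ζ)` is `g`. -/
def IsSpecializationAt (ζ : ℂ) (f : Lam Fqt) (g : Lam (RatFunc ℂ)) : Prop :=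
  ∀ a : ℕ →₀ ℕ, IsValueAt ζ (coeff a (f : MvPowerSeries ℕ Fqt))
    (coeff a (g : MvPowerSeries ℕ (RatFunc ℂ)))

/-- The rectangular partition `(r^l)`, with `l` parts equal to `r`. -/
def rect (r l : ℕ+) : ((l : ℕ) * (r : ℕ)).Partition where
  parts := Multiset.replicate l r
  parts_pos := fun h => by
    rw [Multiset.eq_of_mem_replicate h]
    exact r.pos
  parts_sum := by simp

end Specialization

end SymmFun

/-!
The coefficient of `x ^ a` in `Q'_κ` is `⟨Q_κ, ∏ h_{a_i}⟩`, because the substitution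
`p_k ↦ (1 - q ^ k) / (1 - t ^ k) p_k` turns `⟨ , ⟩_{q,t}` into the scalar product for which
monomials are dual to products of complete symmetric functions (`lcoeff_primeP`,
`coeff_macdonaldQ'`). So the theorem is about the linear functional `⟨Q_κ, ·⟩` for `κ = (r^l)`: at
`t = ζ` it is, up to the sign `(-1) ^ ((l - 1) r)`, the evaluation at the `l` points
`1, ζ, …, ζ ^ (l - 1)`. That evaluation maps `∏ h_{a_i}` to `1` if `l` divides all `a_i`, and to `0`
otherwise (`evalRoots_hProd`), which is also the coefficient of `x ^ a` in
`h_r(x_1 ^ l, x_2 ^ l, …)` for `a` of degree `l r`.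

The two functionals are compared by means of the Macdonald operator
`E f = ∑_m h_m[(1 - t⁻¹) X] · [z ^ m] f[X + (q - 1) z]`. It is self-adjoint (`form_opE`), and
triangular in the monomial symmetric functions for the lexicographic order, with eigenvalues
`1 + (1 - t⁻¹) ∑ t ^ (-i) (q ^ μ_i - 1)` (`opCoeff_triangular`). The triangularity is read off from
the leading monomials of the restriction of `E` to finitely many variables, where `E` becomes the
classical sum of `q`-dilations by a partial fraction expansion (`pairProd_mul_res_opE`). Therefore
the `P_μ` are eigenfunctions of `E` (`opE_macP`), and `⟨Q_κ, ·⟩` is a left eigenvector. A left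
eigenvector satisfies a triangular recursion on its values at the `m_μ`, in which one divides by the
differences of the eigenvalues (`eigenfunctional_recursion`).

At `t = ζ` the evaluation at the powers of `ζ` is a left eigenvector too, with eigenvalue `1`, which
is also the eigenvalue of `(r^l)` there (`evalRoots_opE`, `eig_rect`). On the `m_μ` with more than
`l` parts both functionals vanish (`pairQ_mono_eq_zero`, `evalRoots_mono_eq_zero`). For the other
`μ ≠ (r^l)` the eigenvalue at `t = ζ` differs from `1` (`eig_ne_one`), so that the recursion
produces no pole at `t = ζ`. At `m_{(r^l)}` the values are `1` and
`(∏ ζ ^ i) ^ r = (-1) ^ ((l - 1) r)`, whence the sign.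
-/

namespace SymmFun

open MvPolynomial

/-! ### Complete symmetric functions from power sums -/

section Newton

theorem one_sub_mul_mk_pow {A : Type*} [CommRing A] (x : A) :
    (1 - PowerSeries.C x * PowerSeries.X) * PowerSeries.mk (fun m => x ^ m) = 1 := by
  ext m
  cases m with
  | zero => simp [sub_mul, mul_assoc]
  | succ m => simp [sub_mul, mul_assoc, PowerSeries.coeff_succ_X_mul, PowerSeries.coeff_one,
      pow_succ']

variable {A : Type*} [CommRing A] [Algebra ℚ A]

/-- The sequence `h_0 = 1, h_1, h_2, …` determined by Newton's identities
`m h_m = ∑_{k=1}^m p_k h_{m-k}` from the sequence of power sums, where `y j` stands for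
`p_{j+1}`. -/
noncomputable def hn (y : ℕ → A) : ℕ → A
  | 0 => 1
  | m + 1 => ((m + 1 : ℚ)⁻¹) • ∑ j : Fin (m + 1), y j * hn y (m - j)
decreasing_by omega

theorem hn_zero (y : ℕ → A) : hn y 0 = 1 := by rw [hn]

theorem hn_succ (y : ℕ → A) (m : ℕ) :
    hn y (m + 1) = ((m + 1 : ℚ)⁻¹) • ∑ j ∈ Finset.range (m + 1), y j * hn y (m - j) := by
  rw [hn, Finset.sum_range]

theorem add_one_mul_hn_succ (y : ℕ → A) (m : ℕ) :
    ((m : A) + 1) * hn y (m + 1) = ∑ j ∈ Finset.range (m + 1), y j * hn y (m - j) := by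
  have h : ((m : A) + 1) = algebraMap ℚ A (m + 1) := by simp
  rw [hn_succ, h, ← Algebra.smul_def, smul_inv_smul₀]
  positivity

theorem add_one_mul_cancel {a b : A} (m : ℕ) (h : ((m : A) + 1) * a = ((m : A) + 1) * b) :
    a = b := by
  have e : ((m : A) + 1) = algebraMap ℚ A (m + 1) := by simp
  rw [e, ← Algebra.smul_def, ← Algebra.smul_def] at h
  have hm : (m + 1 : ℚ) ≠ 0 := by positivity
  have := congrArg (fun x => (m + 1 : ℚ)⁻¹ • x) h
  simpa [inv_smul_smul₀ hm] using this

theorem map_hn {B : Type*} [CommRing B] [Algebra ℚ B] (φ : A →+* B) (y : ℕ → A) (m : ℕ) :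
    φ (hn y m) = hn (fun j => φ (y j)) m := by
  induction m using Nat.strong_induction_on with
  | _ m ih =>
    cases m with
    | zero => rw [hn_zero, hn_zero, map_one]
    | succ m =>
      rw [hn_succ, hn_succ, map_rat_smul φ, map_sum]
      congr 1
      refine Finset.sum_congr rfl fun j _ => ?_
      rw [map_mul, ih _ (by omega)]

theorem hn_unique {y b : ℕ → A} (h0 : b 0 = 1)
    (h : ∀ m : ℕ, ((m : A) + 1) * b (m + 1) = ∑ j ∈ Finset.range (m + 1), y j * b (m - j)) :
    b = hn y := by
  funext m
  induction m using Nat.strong_induction_on with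
  | _ m ih =>
    cases m with
    | zero => rw [h0, hn_zero]
    | succ m =>
      refine add_one_mul_cancel m ?_
      rw [h, add_one_mul_hn_succ]
      refine Finset.sum_congr rfl fun j _ => ?_
      rw [ih _ (by omega)]

theorem hn_pow (x : A) : hn (fun j => x ^ (j + 1)) = fun m => x ^ m := by
  refine (hn_unique (by simp) fun m => ?_).symm
  rw [Finset.sum_congr rfl (g := fun _ => x ^ (m + 1))]
  · simp
  · intro j hj
    rw [← pow_add]
    congr 1
    have := Finset.mem_range.1 hj
    omega

theorem hn_geom_mul (x : A) (y : ℕ → A) (m : ℕ) :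
    hn (fun j => x ^ (j + 1) * y j) m = x ^ m * hn y m := by
  refine (congrFun (hn_unique (b := fun m => x ^ m * hn y m) (by simp [hn_zero])
    fun m => ?_) m).symm
  rw [mul_left_comm, add_one_mul_hn_succ, Finset.mul_sum]
  refine Finset.sum_congr rfl fun j hj => ?_
  have := Finset.mem_range.1 hj
  obtain ⟨i, rfl⟩ : ∃ i, m = j + i := ⟨m - j, by omega⟩
  rw [show j + i - j = i by omega]
  ring

open PowerSeries in
theorem derivative_mk_hn (y : ℕ → A) :
    d⁄dX A (PowerSeries.mk (hn y)) = PowerSeries.mk y * PowerSeries.mk (hn y) := by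
  ext m
  rw [coeff_derivative, PowerSeries.coeff_mul, coeff_mk, mul_comm, add_one_mul_hn_succ,
    Finset.Nat.sum_antidiagonal_eq_sum_range_succ_mk]
  simp

open PowerSeries in
/-- A solution of the linear differential equation `Z' = Y Z` is determined by its constant
coefficient. -/
theorem eq_zero_of_derivative_eq {Y Z : PowerSeries A} (h : d⁄dX A Z = Y * Z)
    (h0 : PowerSeries.coeff 0 Z = 0) : Z = 0 := by
  ext m
  induction m using Nat.strong_induction_on with
  | _ m ih =>
    cases m with
    | zero => simpa using h0
    | succ m =>
      refine add_one_mul_cancel m ?_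
      have := congrArg (PowerSeries.coeff m) h
      rw [coeff_derivative, PowerSeries.coeff_mul] at this
      rw [mul_comm, this, map_zero, mul_zero]
      refine Finset.sum_eq_zero fun p hp => ?_
      have hp := Finset.HasAntidiagonal.mem_antidiagonal.1 hp
      rw [ih p.2 (by omega), map_zero, mul_zero]

open PowerSeries in
/-- The generating function of the `h_m` is the solution with constant coefficient `1` of the
differential equation which expresses Newton's identities. -/
theorem mk_hn_eq {Y : ℕ → A} {Z : PowerSeries A} (h : d⁄dX A Z = PowerSeries.mk Y * Z)
    (h0 : PowerSeries.coeff 0 Z = 1) : Z = PowerSeries.mk (hn Y) := by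
  rw [← sub_eq_zero]
  refine eq_zero_of_derivative_eq (Y := PowerSeries.mk Y) ?_ ?_
  · rw [map_sub, h, derivative_mk_hn, mul_sub]
  · rw [map_sub, h0, coeff_mk, hn_zero, sub_self]

open PowerSeries in
theorem mk_hn_add (y y' : ℕ → A) :
    PowerSeries.mk (hn (fun j => y j + y' j)) =
      PowerSeries.mk (hn y) * PowerSeries.mk (hn y') := by
  refine (mk_hn_eq ?_ ?_).symm
  · rw [Derivation.leibniz, derivative_mk_hn, derivative_mk_hn]
    have : PowerSeries.mk (fun j => y j + y' j) = PowerSeries.mk y + PowerSeries.mk y' := by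
      ext; simp
    rw [this, smul_eq_mul, smul_eq_mul]
    ring
  · simp [PowerSeries.coeff_mul, hn_zero]

theorem mk_hn_zero : PowerSeries.mk (hn (fun _ => (0 : A))) = 1 := by
  refine (mk_hn_eq ?_ ?_).symm
  · have : PowerSeries.mk (fun _ => (0 : A)) = 0 := by ext; simp
    rw [this]
    simp
  · simp

theorem mk_hn_sum {ι : Type*} (T : Finset ι) (y : ι → ℕ → A) :
    PowerSeries.mk (hn (fun j => ∑ i ∈ T, y i j)) = ∏ i ∈ T, PowerSeries.mk (hn (y i)) := by
  classical
  induction T using Finset.induction_on with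
  | empty => simpa using mk_hn_zero
  | insert i T hi ih =>
    rw [Finset.prod_insert hi, ← ih, ← mk_hn_add]
    simp only [Finset.sum_insert hi]

/-- The generating function `∏ (1 - s x_i u) / (1 - x_i u)`, with denominators cleared. -/
theorem mk_hn_mul_prod {ι : Type*} (T : Finset ι) (x : ι → A) (s : A) :
    PowerSeries.mk (hn (fun j => (1 - s ^ (j + 1)) * ∑ i ∈ T, x i ^ (j + 1))) *
        ∏ i ∈ T, (1 - PowerSeries.C (x i) * PowerSeries.X) =
      ∏ i ∈ T, (1 - PowerSeries.C (s * x i) * PowerSeries.X) := by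
  have h1 : (fun j => (1 - s ^ (j + 1)) * ∑ i ∈ T, x i ^ (j + 1)) =
      fun j => ∑ i ∈ T, (x i ^ (j + 1) + -(s * x i) ^ (j + 1)) := by
    funext j
    rw [Finset.mul_sum]
    refine Finset.sum_congr rfl fun i _ => ?_
    rw [mul_pow]
    ring
  rw [h1, mk_hn_sum T fun i j => x i ^ (j + 1) + -(s * x i) ^ (j + 1), ← Finset.prod_mul_distrib]
  refine Finset.prod_congr rfl fun i _ => ?_
  have h2 := mk_hn_add (fun j => (s * x i) ^ (j + 1)) (fun j => -(s * x i) ^ (j + 1))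
  simp only [add_neg_cancel] at h2
  rw [mk_hn_zero, hn_pow] at h2
  have h3 := one_sub_mul_mk_pow (s * x i)
  have h4 := one_sub_mul_mk_pow (x i)
  rw [mk_hn_add, hn_pow]
  linear_combination PowerSeries.mk (hn fun j => -(s * x i) ^ (j + 1)) * h4 -
    (1 - PowerSeries.C (s * x i) * PowerSeries.X) * h2 -
    PowerSeries.mk (hn fun j => -(s * x i) ^ (j + 1)) * h3

open PowerSeries in
/-- If a derivation kills all power sums except `p_k`, then it maps `h_m` to
`(D p_k / k) h_{m-k}`. -/
theorem derivation_hn {R : Type*} [CommSemiring R] [Algebra R A] (D : Derivation R A A)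
    (y : ℕ → A) (i : ℕ) (b : A) (hD : ∀ j, D (y j) = if j = i then b else 0) (m : ℕ) :
    ((i : A) + 1) * D (hn y m) = if i < m then b * hn y (m - (i + 1)) else 0 := by
  set H := PowerSeries.mk (hn y) with hH
  set Z : PowerSeries A := PowerSeries.mk (fun m => ((i : A) + 1) * D (hn y m)) with hZ
  have hb : PowerSeries.mk (fun j => D (y j)) = PowerSeries.C b * PowerSeries.X ^ i := by
    ext j
    simp [hD, PowerSeries.coeff_X_pow]
  have h1 : d⁄dX A Z = ((i : PowerSeries A) + 1) * (PowerSeries.C b * PowerSeries.X ^ i * H) +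
      PowerSeries.mk y * Z := by
    rw [← hb]
    have hc : ((i : PowerSeries A) + 1) = PowerSeries.C ((i : A) + 1) := by simp
    ext m
    rw [coeff_derivative, hc, map_add, PowerSeries.coeff_C_mul, PowerSeries.coeff_mul,
      PowerSeries.coeff_mul, hZ, coeff_mk]
    have h2 := congrArg D (add_one_mul_hn_succ y m)
    rw [Derivation.leibniz, map_add, Derivation.map_natCast, Derivation.map_one_eq_zero, zero_add,
      smul_zero, add_zero, map_sum, smul_eq_mul] at h2
    rw [mul_assoc, mul_comm (D _), h2, Finset.mul_sum, Finset.mul_sum,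
      Finset.Nat.sum_antidiagonal_eq_sum_range_succ_mk,
      Finset.Nat.sum_antidiagonal_eq_sum_range_succ_mk, ← Finset.sum_add_distrib]
    refine Finset.sum_congr rfl fun j _ => ?_
    simp only [coeff_mk, hH, Derivation.leibniz, smul_eq_mul]
    ring
  have h3 : Z = PowerSeries.C b * PowerSeries.X ^ (i + 1) * H := by
    rw [← sub_eq_zero]
    refine eq_zero_of_derivative_eq (Y := PowerSeries.mk y) ?_ ?_
    · rw [map_sub, h1, Derivation.leibniz, derivative_mk_hn, Derivation.leibniz,
        Derivation.leibniz_pow, derivative_C, derivative_X]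
      simp only [smul_eq_mul, nsmul_eq_mul, Nat.cast_add, Nat.cast_one, mul_one, mul_zero,
        add_zero, Nat.add_sub_cancel]
      ring
    · simp [hZ, hn_zero, mul_assoc, pow_succ']
  have h4 := congrArg (PowerSeries.coeff m) h3
  rw [hZ, coeff_mk, mul_assoc, PowerSeries.coeff_C_mul, PowerSeries.coeff_X_pow_mul', hH] at h4
  rw [h4]
  by_cases h : i < m
  · rw [if_pos h, if_pos (by omega), coeff_mk]
  · rw [if_neg h, if_neg (by omega), mul_zero]

end Newton

/-! ### The Macdonald operator in the power sums -/

section Operator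

variable {K : Type*} [CommRing K]

/-- The symmetric functions `h_m[(1 - s) X]` as polynomials in the power sums, obtained from `h_m`
by `p_k ↦ (1 - s ^ k) p_k`. -/
noncomputable def hDiff [Algebra ℚ K] (s : K) : ℕ → MvPolynomial ℕ+ K :=
  hn fun j => C (1 - s ^ (j + 1)) * X j.succPNat

/-- The substitution `f[X] ↦ f[X + (q - 1) z]`, that is `p_k ↦ p_k + (q ^ k - 1) z ^ k`. -/
noncomputable def shift (q : K) : MvPolynomial ℕ+ K →ₐ[K] Polynomial (MvPolynomial ℕ+ K) :=
  aeval fun k : ℕ+ => Polynomial.C (X k) +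
    Polynomial.C (C (q ^ (k : ℕ) - 1)) * Polynomial.X ^ (k : ℕ)

/-- The Macdonald operator `f ↦ ∑_m h_m[(1 - s) X] · [z ^ m] f[X + (q - 1) z]`, written in the power
sums. Its parameter `s` stands for `t⁻¹`. -/
noncomputable def opE [Algebra ℚ K] (q s : K) : MvPolynomial ℕ+ K →ₗ[K] MvPolynomial ℕ+ K :=
  Polynomial.lsum (fun m => LinearMap.mulLeft K (hDiff s m)) ∘ₗ (shift q).toLinearMap

theorem shift_X (q : K) (k : ℕ+) : shift q (X k) = Polynomial.C (X k) +
    Polynomial.C (C (q ^ (k : ℕ) - 1)) * Polynomial.X ^ (k : ℕ) := by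
  rw [shift, aeval_X]

theorem opE_eq_sum [Algebra ℚ K] (q s : K) (f : MvPolynomial ℕ+ K) {M : ℕ}
    (hM : (shift q f).natDegree < M) :
    opE q s f = ∑ m ∈ Finset.range M, hDiff s m * (shift q f).coeff m := by
  rw [opE, LinearMap.comp_apply, Polynomial.lsum_apply]
  exact Polynomial.sum_over_range' _ (fun _ => by simp) _ hM

theorem map_hDiff [Algebra ℚ K] {L : Type*} [CommRing L] [Algebra ℚ L] (φ : K →+* L) (s : K)
    (m : ℕ) : map φ (hDiff s m) = hDiff (φ s) m := by
  rw [hDiff, map_hn, hDiff]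
  simp

theorem map_shift {L : Type*} [CommRing L] (φ : K →+* L) (q : K)
    (f : MvPolynomial ℕ+ K) : (shift q f).map (map φ) = shift (φ q) (map φ f) := by
  induction f using MvPolynomial.induction_on with
  | C a => simp [shift]
  | add f g hf hg => simp [hf, hg]
  | mul_X f k hf => simp [hf, shift_X]

theorem map_opE [Algebra ℚ K] {L : Type*} [CommRing L] [Algebra ℚ L] (φ : K →+* L) (q s : K)
    (f : MvPolynomial ℕ+ K) : map φ (opE q s f) = opE (φ q) (φ s) (map φ f) := by
  rw [opE_eq_sum q s f (Nat.lt_succ_self _), opE_eq_sum (φ q) (φ s) (map φ f)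
    (M := (shift q f).natDegree + 1), map_sum]
  · refine Finset.sum_congr rfl fun m _ => ?_
    rw [map_mul, map_hDiff, ← map_shift, Polynomial.coeff_map]
  · rw [← map_shift]
    exact Nat.lt_succ_of_le Polynomial.natDegree_map_le

/-- The substitution `f(x) ↦ f(c x)`, that is `p_k ↦ c ^ k p_k`. -/
noncomputable def scale (c : K) : MvPolynomial ℕ+ K →ₐ[K] MvPolynomial ℕ+ K :=
  aeval fun k : ℕ+ => C (c ^ (k : ℕ)) * X k

theorem scale_X (c : K) (k : ℕ+) : scale c (X k) = C (c ^ (k : ℕ)) * X k := by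
  rw [scale, aeval_X]

theorem scale_hDiff [Algebra ℚ K] (c s : K) (m : ℕ) :
    scale c (hDiff s m) = C (c ^ m) * hDiff s m := by
  have h := map_hn (scale c).toRingHom (fun j => C (1 - s ^ (j + 1)) * X j.succPNat) m
  have h2 := hn_geom_mul (C c) (fun j => C (1 - s ^ (j + 1)) * X j.succPNat (R := K)) m
  rw [hDiff, C_pow, ← h2]
  refine h.trans ?_
  congr 1
  funext j
  change scale c _ = _
  rw [map_mul, scale_X, ← algebraMap_eq, AlgHom.commutes, algebraMap_eq]
  simp
  ring

theorem coeff_shift_scale (c q : K) (f : MvPolynomial ℕ+ K) (m : ℕ) :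
    (shift q (scale c f)).coeff m = C (c ^ m) * scale c ((shift q f).coeff m) := by
  let ψ : Polynomial (MvPolynomial ℕ+ K) →+* Polynomial (MvPolynomial ℕ+ K) :=
    (Polynomial.compRingHom (Polynomial.C (C c) * Polynomial.X)).comp
      (Polynomial.mapRingHom (scale c).toRingHom)
  have hC : ∀ a : K, (scale c).toRingHom (C a) = C a := fun a => by
    rw [← algebraMap_eq]
    exact AlgHom.commutes _ _
  have hshC : ∀ a : K, shift q (C a) = Polynomial.C (C a) := fun a => by
    rw [← algebraMap_eq, AlgHom.commutes]
    rfl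
  have hψC : ∀ a : MvPolynomial ℕ+ K, ψ (Polynomial.C a) = Polynomial.C (scale c a) := by
    intro a
    simp [ψ]
  have hψX : ψ Polynomial.X = Polynomial.C (C c) * Polynomial.X := by
    simp [ψ]
  have key : (shift q).toRingHom.comp (scale c).toRingHom = ψ.comp (shift q).toRingHom := by
    refine ringHom_ext (fun a => ?_) fun k => ?_
    · change shift q ((scale c).toRingHom (C a)) = ψ (shift q (C a))
      rw [hC, hshC, hψC]
      exact congrArg _ (hC a).symm
    · change shift q (scale c (X k)) = ψ (shift q (X k))
      rw [scale_X, map_mul, hshC, shift_X, map_add ψ, map_mul ψ, map_pow ψ, hψX, hψC, hψC, scale_X,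
        show scale c (C (q ^ (k : ℕ) - 1)) = _ from hC _, mul_pow, ← Polynomial.C_pow, ← C_pow,
        Polynomial.C_mul]
      ring
  have h := RingHom.congr_fun key f
  change shift q (scale c f) =
    ((shift q f).map (scale c).toRingHom).comp (Polynomial.C (C c) * Polynomial.X) at h
  rw [h, Polynomial.comp_C_mul_X_coeff, Polynomial.coeff_map, mul_comm, C_pow]
  rfl

theorem scale_opE [Algebra ℚ K] (c q s : K) (f : MvPolynomial ℕ+ K) :
    scale c (opE q s f) = opE q s (scale c f) := by
  set M := max (shift q f).natDegree (shift q (scale c f)).natDegree + 1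
  rw [opE_eq_sum q s f (M := M) (by omega), opE_eq_sum q s (scale c f) (M := M) (by omega), map_sum]
  refine Finset.sum_congr rfl fun m _ => ?_
  rw [map_mul, scale_hDiff, coeff_shift_scale]
  ring

theorem coeff_shift_pderiv (q : K) (k : ℕ+) (f : MvPolynomial ℕ+ K) (m : ℕ) :
    (shift q (pderiv k f)).coeff m = pderiv k ((shift q f).coeff m) := by
  classical
  induction f using MvPolynomial.induction_on generalizing m with
  | C a => simp [shift, ← algebraMap_eq, Polynomial.coeff_C, apply_ite]
  | add f g hf hg => simp [hf, hg]
  | mul_X f j hf =>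
    rw [Derivation.leibniz, map_add, smul_eq_mul, smul_eq_mul, map_mul, map_mul, map_mul, shift_X,
      mul_add, Polynomial.coeff_add, Polynomial.coeff_add, Polynomial.coeff_mul_C,
      mul_left_comm (shift q f), Polynomial.coeff_C_mul, Polynomial.coeff_mul_X_pow', pderiv_X,
      map_add, Derivation.leibniz, Derivation.leibniz, pderiv_C, pderiv_X, add_mul,
      Polynomial.coeff_add, Polynomial.coeff_C_mul, hf, mul_assoc, Polynomial.coeff_C_mul,
      Polynomial.coeff_X_pow_mul']
    have h : (shift q f *
        shift q (Pi.single (M := fun _ : ℕ+ => MvPolynomial ℕ+ K) k 1 j)).coeff m =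
        (shift q f).coeff m * Pi.single (M := fun _ : ℕ+ => MvPolynomial ℕ+ K) k 1 j := by
      by_cases hkj : k = j
      · subst hkj; simp
      · simp [hkj]
    simp only [smul_eq_mul]
    rw [h]
    split_ifs with hjm
    · rw [hf]; ring
    · simp

end Operator

/-! ### Adjointness for the scalar product -/

section Adjoint

theorem one_sub_t_pow_ne_zero (k : ℕ+) : (1 - t ^ (k : ℕ) : Fqt) ≠ 0 := by
  intro h
  have h1 : algebraMap (MvPolynomial (Fin 2) ℚ) Fqt (1 - X 1 ^ (k : ℕ)) =
      algebraMap (MvPolynomial (Fin 2) ℚ) Fqt 0 := by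
    rw [map_zero, ← h, map_sub, map_one, map_pow]
    rfl
  have h2 := congrArg (eval fun _ => (0 : ℚ)) (IsFractionRing.injective _ _ h1)
  simp at h2

theorem t_ne_zero : t ≠ 0 := by
  intro h
  have h2 := congrArg (eval fun _ => (1 : ℚ))
    (IsFractionRing.injective _ _ (h.trans (map_zero _).symm))
  simp at h2

/-- The scalar product `⟨ , ⟩_{q,t}`, for symmetric functions written in the power sums. -/
noncomputable def form : MvPolynomial ℕ+ Fqt →ₗ[Fqt] MvPolynomial ℕ+ Fqt →ₗ[Fqt] Fqt :=
  innerQT.compl₁₂ (psumEquiv Fqt).toLinearMap (psumEquiv Fqt).toLinearMap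

theorem form_apply (f g : MvPolynomial ℕ+ Fqt) :
    form f g = innerQT (psumEquiv Fqt f) (psumEquiv Fqt g) := rfl

open Classical in
theorem form_monomial (d e : ℕ+ →₀ ℕ) (a b : Fqt) :
    form (monomial d a) (monomial e b) = if d = e then a * b * zqt d else 0 := by
  have h : ∀ (d : ℕ+ →₀ ℕ) (a : Fqt), psumEquiv Fqt (monomial d a) = a • psumBasis Fqt d := by
    intro d a
    rw [psumBasis, Module.Basis.map_apply, coe_basisMonomials]
    change _ = a • psumEquiv Fqt (monomial d 1)
    rw [← map_smul, smul_monomial, smul_eq_mul, mul_one]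
  rw [form_apply, h, h, map_smul, map_smul, LinearMap.smul_apply, innerQT_psumBasis, smul_eq_mul,
    smul_eq_mul]
  split_ifs
  · ring
  · simp

theorem form_comm (f g : MvPolynomial ℕ+ Fqt) : form f g = form g f := by
  classical
  induction f using MvPolynomial.induction_on' with
  | add f f' hf hf' => rw [map_add, map_add, LinearMap.add_apply, hf, hf']
  | monomial d a =>
    induction g using MvPolynomial.induction_on' with
    | add g g' hg hg' => rw [map_add, map_add, LinearMap.add_apply, hg, hg']
    | monomial e b =>
      rw [form_monomial, form_monomial]
      by_cases h : d = e
      · subst h; simp [mul_comm a]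
      · rw [if_neg h, if_neg (Ne.symm h)]

theorem zqt_add_single (d : ℕ+ →₀ ℕ) (k : ℕ+) :
    zqt (d + Finsupp.single k 1) = zqt d * ((d k + 1 : ℕ) * ((k : ℕ) : Fqt) *
      ((1 - q ^ (k : ℕ)) / (1 - t ^ (k : ℕ)))) := by
  classical
  have h1 : ∀ e : ℕ+ →₀ ℕ, ∀ S : Finset ℕ+, e.support ⊆ S →
      zqt e = ∏ k ∈ S, ((e k).factorial : Fqt) * ((k : ℕ) : Fqt) ^ e k *
        ((1 - q ^ (k : ℕ)) / (1 - t ^ (k : ℕ))) ^ e k := by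
    intro e S h
    exact Finsupp.prod_of_support_subset _ h _ (by simp)
  have hk : k ∈ insert k d.support := Finset.mem_insert_self _ _
  rw [h1 (d + Finsupp.single k 1) (insert k d.support), h1 d (insert k d.support)
    (Finset.subset_insert _ _), ← Finset.mul_prod_erase _ _ hk,
    ← Finset.mul_prod_erase _ (fun k => ((d k).factorial : Fqt) * ((k : ℕ) : Fqt) ^ d k *
        ((1 - q ^ (k : ℕ)) / (1 - t ^ (k : ℕ))) ^ d k) hk]
  · rw [Finset.prod_congr rfl (g := fun k => ((d k).factorial : Fqt) * ((k : ℕ) : Fqt) ^ d k *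
        ((1 - q ^ (k : ℕ)) / (1 - t ^ (k : ℕ))) ^ d k)]
    · simp only [Finsupp.add_apply, Finsupp.single_eq_same, Nat.factorial_succ, pow_succ,
        Nat.cast_mul]
      ring
    · intro j hj
      have : k ≠ j := (Finset.ne_of_mem_erase hj).symm
      simp [this]
  · refine Finsupp.support_add.trans (Finset.union_subset (Finset.subset_insert _ _) ?_)
    exact Finsupp.support_single_subset.trans (by simp)

/-- Multiplication by `p_k` is adjoint to `k (1 - q ^ k) / (1 - t ^ k) ∂ / ∂ p_k`. -/
theorem form_X_mul (k : ℕ+) (f g : MvPolynomial ℕ+ Fqt) :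
    form (X k * f) g =
      ((k : ℕ) : Fqt) * ((1 - q ^ (k : ℕ)) / (1 - t ^ (k : ℕ))) * form f (pderiv k g) := by
  classical
  induction f using MvPolynomial.induction_on' with
  | add f f' hf hf' =>
    rw [mul_add, map_add, map_add, LinearMap.add_apply, LinearMap.add_apply, hf, hf', mul_add]
  | monomial d a =>
    induction g using MvPolynomial.induction_on' with
    | add g g' hg hg' => rw [map_add, map_add, map_add, hg, hg', mul_add]
    | monomial e b =>
      rw [pderiv_monomial, X, monomial_mul, one_mul, form_monomial, form_monomial]
      by_cases h : e k = 0
      · rw [if_neg, h]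
        · simp
        · rintro rfl
          simp at h
      · have he : e = (e - Finsupp.single k 1) + Finsupp.single k 1 := by
          rw [tsub_add_cancel_of_le]
          exact Finsupp.single_le_iff.2 (Nat.pos_of_ne_zero h)
        generalize e - Finsupp.single k 1 = e' at he ⊢
        subst he
        by_cases hd : d = e'
        · subst hd
          rw [if_pos (add_comm _ _), if_pos rfl, add_comm (Finsupp.single k 1), zqt_add_single]
          simp
          ring
        · rw [if_neg hd, if_neg, mul_zero]
          rw [add_comm]
          exact fun h => hd (add_right_cancel h)

theorem constantCoeff_hn {y : ℕ → MvPolynomial ℕ+ Fqt} (hy : ∀ j, constantCoeff (y j) = 0)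
    (m : ℕ) : constantCoeff (hn y m) = if m = 0 then 1 else 0 := by
  rw [map_hn]
  simp only [hy]
  cases m with
  | zero => simp [hn_zero]
  | succ m => simp [hn_succ]

theorem form_one (g : MvPolynomial ℕ+ Fqt) : form 1 g = constantCoeff g := by
  classical
  induction g using MvPolynomial.induction_on' with
  | add g g' hg hg' => rw [map_add, map_add, hg, hg']
  | monomial e b =>
    rw [← C_1, C_apply, form_monomial]
    by_cases h : 0 = e
    · subst h; simp [zqt]
    · rw [if_neg h, constantCoeff_eq, coeff_monomial, if_neg (Ne.symm h)]

theorem form_C_mul (a : Fqt) (f g : MvPolynomial ℕ+ Fqt) : form f (C a * g) = a * form f g := by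
  rw [← smul_eq_C_mul, map_smul, smul_eq_mul]

theorem pderiv_hn {y : ℕ → MvPolynomial ℕ+ Fqt} {c : ℕ → Fqt}
    (hy : ∀ j, y j = C (c j) * X j.succPNat) (i m : ℕ) :
    C ((i : Fqt) + 1) * pderiv i.succPNat (hn y m) =
      if i < m then C (c i) * hn y (m - (i + 1)) else 0 := by
  have h := derivation_hn (pderiv (R := Fqt) i.succPNat) y i (C (c i)) (fun j => ?_) m
  · rw [← h]
    simp
  · rw [hy, pderiv_C_mul, pderiv_X]
    by_cases hj : j = i
    · subst hj; simp
    · have : i.succPNat ≠ j.succPNat := fun h => hj (Nat.succPNat_injective h).symm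
      rw [if_neg hj, Pi.single_eq_of_ne this.symm, mul_zero]

/-- Multiplication by `h_m[(1 - t⁻¹) X]` is adjoint to `t⁻ᵐ [z ^ m] f[X + (q - 1) z]`. -/
theorem form_hDiff_mul (m : ℕ) (f g : MvPolynomial ℕ+ Fqt) :
    form (hDiff t⁻¹ m * f) g = t⁻¹ ^ m * form f ((shift q g).coeff m) := by
  classical
  induction f using MvPolynomial.induction_on generalizing g with
  | add f f' hf hf' => simp only [mul_add, map_add, LinearMap.add_apply, hf, hf']
  | mul_X f k hf =>
    rw [mul_comm f, mul_left_comm, form_X_mul, form_X_mul, hf, coeff_shift_pderiv]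
    ring
  | C a =>
    rw [mul_comm, ← smul_eq_C_mul, ← mul_one (C a), ← smul_eq_C_mul, map_smul, map_smul,
      LinearMap.smul_apply, LinearMap.smul_apply, smul_eq_mul, smul_eq_mul, mul_left_comm]
    congr 1
    rw [form_one]
    -- the case of `f = 1` is by induction on `g`
    induction g using MvPolynomial.induction_on generalizing m with
    | C b =>
      rw [form_comm, ← mul_one (C b), ← smul_eq_C_mul, map_smul, LinearMap.smul_apply, form_one,
        hDiff, constantCoeff_hn (by simp), map_smul, map_one, Polynomial.coeff_smul,
        Polynomial.coeff_one]
      by_cases hm : m = 0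
      · subst hm; simp
      · simp [hm]
    | add g g' hg hg' => simp only [map_add, hg, hg', mul_add, Polynomial.coeff_add]
    | mul_X g k hg =>
      obtain ⟨i, rfl⟩ : ∃ i : ℕ, k = i.succPNat := ⟨k.natPred, by simp⟩
      have h1 := pderiv_hn (y := fun j => C (1 - t⁻¹ ^ (j + 1)) * X j.succPNat)
        (c := fun j => (1 - t⁻¹ ^ (j + 1) : Fqt)) (fun j => rfl) i m
      have ht := one_sub_t_pow_ne_zero i.succPNat
      have ht0 := t_ne_zero
      rw [mul_comm g, form_comm, form_X_mul, mul_comm (X _), map_mul, shift_X, mul_add,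
        Polynomial.coeff_add, Polynomial.coeff_mul_C, mul_left_comm, Polynomial.coeff_C_mul,
        Polynomial.coeff_mul_X_pow', map_add, map_mul, constantCoeff_X, mul_zero, zero_add, map_mul,
        constantCoeff_C, mul_comm (((i.succPNat : ℕ) : Fqt)), mul_assoc,
        ← form_C_mul]
      by_cases him : i < m
      · rw [if_pos (show ((i.succPNat : ℕ+) : ℕ) ≤ m from him)]
        simp only [Nat.succPNat_coe, Nat.succ_eq_add_one] at ht ⊢
        rw [Nat.cast_add, Nat.cast_one, hDiff, h1, if_pos him, form_C_mul, form_comm]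
        have h2 := hg (m - (i + 1))
        rw [hDiff] at h2
        rw [h2]
        obtain ⟨n, rfl⟩ : ∃ n, m = n + (i + 1) := ⟨m - (i + 1), by omega⟩
        have hts : t ^ (i + 1) * t⁻¹ ^ (i + 1) = 1 := by
          rw [← mul_pow, mul_inv_cancel₀ ht0, one_pow]
        rw [Nat.add_sub_cancel, pow_add, div_mul_eq_mul_div, div_eq_iff ht]
        linear_combination (-(t⁻¹ ^ n * constantCoeff (((shift q) g).coeff n) *
          (1 - q ^ (i + 1)))) * hts
      · rw [if_neg (show ¬ ((i.succPNat : ℕ+) : ℕ) ≤ m from him)]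
        simp only [Nat.succPNat_coe, Nat.succ_eq_add_one]
        rw [Nat.cast_add, Nat.cast_one, hDiff, h1, if_neg him]
        simp

/-- The Macdonald operator is self-adjoint. -/
theorem form_opE (f g : MvPolynomial ℕ+ Fqt) :
    form (opE q t⁻¹ f) g = form f (opE q t⁻¹ g) := by
  set M := max (shift q f).natDegree (shift q g).natDegree + 1
  rw [opE_eq_sum q t⁻¹ f (M := M) (by omega), opE_eq_sum q t⁻¹ g (M := M) (by omega), map_sum,
    map_sum, LinearMap.sum_apply]
  refine Finset.sum_congr rfl fun m _ => ?_
  rw [form_hDiff_mul, form_comm f, form_hDiff_mul, form_comm]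

end Adjoint

/-! ### The Macdonald operator in finitely many variables -/

/-- The partial fraction expansion of `∏ (1 - s x_i u) / (1 - x_i u)`, with the denominators
cleared. -/
theorem prod_one_sub_eq_add_sum {L ι : Type*} [Field L] [Fintype ι] [DecidableEq ι] (x : ι → L)
    (hx : Function.Injective x) (hx0 : ∀ i, x i ≠ 0) (s : L) :
    ∏ i, (1 - Polynomial.C (s * x i) * Polynomial.X) =
      ∏ i, (1 - Polynomial.C (x i) * Polynomial.X) +
        Polynomial.C (1 - s) * ∑ i, Polynomial.C ((∏ j ∈ Finset.univ.erase i, (x i - s * x j)) /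
          ∏ j ∈ Finset.univ.erase i, (x i - x j)) * (Polynomial.C (x i) * Polynomial.X *
            ∏ j ∈ Finset.univ.erase i, (1 - Polynomial.C (x j) * Polynomial.X)) := by
  have hd1 : ∀ (T : Finset ι) (y : ι → L),
      (∏ i ∈ T, (1 - Polynomial.C (y i) * Polynomial.X)).natDegree ≤ T.card := by
    intro T y
    refine (Polynomial.natDegree_prod_le _ _).trans ((Finset.sum_le_card_nsmul _ _ 1 ?_).trans
      (by simp))
    intro i _
    compute_degree
  let f : Option ι → L := fun o => o.elim 0 fun i => (x i)⁻¹
  have hf : Function.Injective f := by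
    rintro (_ | i) (_ | j) h
    · rfl
    · exact absurd h.symm (inv_ne_zero (hx0 j))
    · exact absurd h (inv_ne_zero (hx0 i))
    · exact congrArg some (hx (inv_injective h))
  refine Polynomial.eq_of_natDegree_lt_card_of_eval_eq _ _ hf ?_ ?_
  · rintro (_ | i)
    · simp [f, Polynomial.eval_prod, Polynomial.eval_finsetSum]
    · have h1 : ∀ j, j ≠ i → x i - x j ≠ 0 := fun j hj => sub_ne_zero.2 fun h => hj (hx h).symm
      simp only [Polynomial.eval_add, Polynomial.eval_mul, Polynomial.eval_prod,
        Polynomial.eval_sub, Polynomial.eval_one, Polynomial.eval_C, Polynomial.eval_X,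
        Polynomial.eval_finsetSum, f, Option.elim]
      rw [Finset.prod_eq_zero (Finset.mem_univ i) (f := fun j => 1 - x j * (x i)⁻¹)
        (by rw [mul_inv_cancel₀ (hx0 i), sub_self]), zero_add,
        Finset.sum_eq_single_of_mem i (Finset.mem_univ i), ← Finset.mul_prod_erase _ _
          (Finset.mem_univ i), mul_inv_cancel₀ (hx0 i), one_mul, mul_assoc, mul_inv_cancel₀ (hx0 i),
          mul_one, ← Finset.prod_div_distrib, ← Finset.prod_mul_distrib]
      · congr 1
        refine Finset.prod_congr rfl fun j hj => ?_
        have := h1 j (Finset.ne_of_mem_erase hj)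
        have := hx0 i
        field_simp
      · intro j _ hji
        rw [Finset.prod_eq_zero (Finset.mem_erase.2 ⟨hji.symm, Finset.mem_univ i⟩)
          (f := fun j => 1 - x j * (x i)⁻¹) (by rw [mul_inv_cancel₀ (hx0 i), sub_self]), mul_zero,
          mul_zero]
  · rw [Fintype.card_option, Nat.lt_succ_iff]
    refine max_le (hd1 _ _) ((Polynomial.natDegree_add_le _ _).trans (max_le (hd1 _ _) ?_))
    refine (Polynomial.natDegree_C_mul_le _ _).trans
      (Polynomial.natDegree_sum_le_of_forall_le _ _ fun i _ => ?_)
    refine (Polynomial.natDegree_C_mul_le _ _).trans (Polynomial.natDegree_mul_le.trans ?_)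
    have h1 := hd1 (Finset.univ.erase i) x
    have h2 : (Polynomial.C (x i) * Polynomial.X).natDegree ≤ 1 := by compute_degree
    have h3 := Finset.card_erase_of_mem (Finset.mem_univ i)
    have h4 : 0 < Finset.univ.card (α := ι) := Finset.card_pos.2 ⟨i, Finset.mem_univ i⟩
    rw [← Finset.card_univ]
    omega

/-- The coefficients of `∏ (1 - s x_i u) / (1 - x_i u)` in terms of its residues. -/
theorem hn_eq_sum_residues {L ι : Type*} [Field L] [Algebra ℚ L] [Fintype ι] [DecidableEq ι]
    (x : ι → L) (hx : Function.Injective x) (hx0 : ∀ i, x i ≠ 0) (s : L) {m : ℕ} (hm : m ≠ 0) :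
    hn (fun j => (1 - s ^ (j + 1)) * ∑ i, x i ^ (j + 1)) m =
      (1 - s) * ∑ i, (∏ j ∈ Finset.univ.erase i, (x i - s * x j)) /
          (∏ j ∈ Finset.univ.erase i, (x i - x j)) * x i ^ m := by
  set b : ι → L := fun i => (∏ j ∈ Finset.univ.erase i, (x i - s * x j)) /
          (∏ j ∈ Finset.univ.erase i, (x i - x j))
  have h1 := mk_hn_mul_prod Finset.univ x s
  have h2 := congrArg (Polynomial.coeToPowerSeries.ringHom (R := L))
    (prod_one_sub_eq_add_sum x hx hx0 s)
  simp only [map_add, map_mul, map_prod, map_sum, map_sub, map_one,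
    Polynomial.coeToPowerSeries.ringHom_apply, Polynomial.coe_C, Polynomial.coe_X] at h2
  set W : PowerSeries L := 1 + PowerSeries.C (1 - s) * ∑ i, PowerSeries.C (b i) *
    (PowerSeries.C (x i) * PowerSeries.X * PowerSeries.mk fun m => x i ^ m) with hW
  have h3 : W * ∏ i, (1 - PowerSeries.C (x i) * PowerSeries.X) =
      ∏ i, (1 - PowerSeries.C (s * x i) * PowerSeries.X) := by
    simp only [map_mul]
    rw [h2, hW, add_mul, one_mul, mul_assoc, Finset.sum_mul, map_sub, map_one]
    congr 2
    refine Finset.sum_congr rfl fun i _ => ?_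
    rw [← Finset.mul_prod_erase _ _ (Finset.mem_univ i)]
    linear_combination PowerSeries.C (b i) * (PowerSeries.C (x i) * PowerSeries.X *
      ∏ j ∈ Finset.univ.erase i, (1 - PowerSeries.C (x j) * PowerSeries.X)) *
      one_sub_mul_mk_pow (x i)
  have h0 : ∏ i, (1 - PowerSeries.C (x i) * PowerSeries.X) ≠ 0 := by
    refine Finset.prod_ne_zero_iff.2 fun i _ h => ?_
    have := one_sub_mul_mk_pow (x i)
    rw [h, zero_mul] at this
    exact zero_ne_one this
  have h4 := congrArg (PowerSeries.coeff m) (mul_right_cancel₀ h0 (h1.trans h3.symm))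
  rw [PowerSeries.coeff_mk] at h4
  rw [h4, hW, map_add, PowerSeries.coeff_one, if_neg hm, zero_add, PowerSeries.coeff_C_mul, map_sum]
  congr 1
  refine Finset.sum_congr rfl fun i _ => ?_
  obtain ⟨n, rfl⟩ := Nat.exists_eq_succ_of_ne_zero hm
  rw [PowerSeries.coeff_C_mul, mul_assoc, PowerSeries.coeff_C_mul, PowerSeries.coeff_succ_X_mul,
    PowerSeries.coeff_mk, pow_succ']

section FiniteVariables

variable {K : Type*} [Field K] (N : ℕ)

/-- The restriction of a symmetric function to the `N` variables `x_0, …, x_{N-1}`. -/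
noncomputable def res : MvPolynomial ℕ+ K →ₐ[K] MvPolynomial (Fin N) K :=
  aeval fun k : ℕ+ => ∑ i, X i ^ (k : ℕ)

variable {N}

/-- The dilation `x_i ↦ q x_i` of a single variable. -/
noncomputable def dil (q : K) (i : Fin N) : MvPolynomial (Fin N) K →ₐ[K] MvPolynomial (Fin N) K :=
  aeval fun j => if j = i then C q * X j else X j

/-- The product `∏_{j ≠ k} (x_j - c_j x_k)` over all ordered pairs. For `c = 1` it is, up to sign,
the square of the Vandermonde determinant. -/
noncomputable def pairProd (c : Fin N → K) : MvPolynomial (Fin N) K :=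
  ∏ j, ∏ k ∈ Finset.univ.erase j, (X j - C (c j) * X k)

theorem X_sub_X_ne_zero {j k : Fin N} (h : k ≠ j) :
    (X j - X k : MvPolynomial (Fin N) K) ≠ 0 :=
  sub_ne_zero.2 fun e => h ((X_injective (R := K)) e).symm

theorem pairProd_one_ne_zero : pairProd (N := N) (fun _ => (1 : K)) ≠ 0 := by
  rw [pairProd]
  refine Finset.prod_ne_zero_iff.2 fun j _ => Finset.prod_ne_zero_iff.2 fun k hk => ?_
  rw [C_1, one_mul]
  exact X_sub_X_ne_zero (Finset.ne_of_mem_erase hk)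

theorem pairProd_update (s : K) (i : Fin N) : pairProd (Function.update (fun _ => 1) i s) =
    (∏ k ∈ Finset.univ.erase i, (X i - C s * X k)) *
      ∏ j ∈ Finset.univ.erase i, ∏ k ∈ Finset.univ.erase j, (X j - X k) := by
  rw [pairProd, ← Finset.mul_prod_erase _ _ (Finset.mem_univ i), Function.update_self]
  congr 1
  refine Finset.prod_congr rfl fun j hj => ?_
  rw [Function.update_of_ne (Finset.ne_of_mem_erase hj), C_1]
  simp only [one_mul]

theorem coeff_zero_shift (q : K) (f : MvPolynomial ℕ+ K) : (shift q f).coeff 0 = f := by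
  induction f using MvPolynomial.induction_on with
  | C a => simp [shift, ← algebraMap_eq]
  | add f g hf hg => simp [hf, hg]
  | mul_X f k hf =>
    rw [map_mul, Polynomial.mul_coeff_zero, hf, shift_X, Polynomial.coeff_add,
      Polynomial.coeff_C_zero, Polynomial.coeff_C_mul, Polynomial.coeff_X_pow,
      if_neg k.ne_zero.symm, mul_zero, add_zero]

/-- In finitely many variables, the shift by `(q - 1) x_i` is the dilation `x_i ↦ q x_i`. -/
theorem eval₂_shift (q : K) (i : Fin N) (f : MvPolynomial ℕ+ K) :
    (shift q f).eval₂ (res N).toRingHom (X i) = dil q i (res N f) := by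
  have h : ∀ a : K, (res N).toRingHom (C a) = C a := fun a => by
    rw [← algebraMap_eq]; exact AlgHom.commutes _ _
  have h' : ∀ k, (res N).toRingHom (X k) = ∑ j, (X j : MvPolynomial (Fin N) K) ^ (k : ℕ) :=
    fun k => aeval_X _ k
  induction f using MvPolynomial.induction_on with
  | C a =>
    rw [shift, ← algebraMap_eq, AlgHom.commutes, AlgHom.commutes, AlgHom.commutes]
    exact (Polynomial.eval₂_C _ _).trans (h a)
  | add f g hf hg => simp only [map_add, Polynomial.eval₂_add, hf, hg]
  | mul_X f k hf =>
    rw [map_mul, Polynomial.eval₂_mul, hf, map_mul, map_mul, shift_X, Polynomial.eval₂_add,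
      Polynomial.eval₂_mul, Polynomial.eval₂_C, Polynomial.eval₂_C, Polynomial.eval₂_pow,
      Polynomial.eval₂_X, h, h', show res N (X k) = _ from h' k, map_sum]
    congr 1
    simp only [map_pow]
    rw [← Finset.add_sum_erase _ _ (Finset.mem_univ i),
      ← Finset.add_sum_erase _ (fun j => dil q i (X j) ^ (k : ℕ)) (Finset.mem_univ i)]
    have h2 : ∀ j ∈ Finset.univ.erase i, dil q i (X j) ^ (k : ℕ) =
        (X j : MvPolynomial (Fin N) K) ^ (k : ℕ) := by
      intro j hj
      rw [dil, aeval_X, if_neg (Finset.ne_of_mem_erase hj)]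
    rw [Finset.sum_congr rfl h2, dil, aeval_X, if_pos rfl, mul_pow]
    simp only [map_sub, map_pow, map_one]
    ring

variable [Algebra ℚ K]

theorem pairProd_mul_res_hDiff (s : K) {m : ℕ} (hm : m ≠ 0) :
    pairProd (fun _ => 1) * res N (hDiff s m) =
      C (1 - s) * ∑ i, pairProd (Function.update (fun _ => 1) i s) * X i ^ m := by
  have h1 : res N (hDiff s m) =
      hn (fun j => (1 - C s ^ (j + 1)) * ∑ i, (X i : MvPolynomial (Fin N) K) ^ (j + 1)) m := by
    refine (map_hn (res N).toRingHom _ m).trans ?_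
    congr 1
    funext j
    change res N _ = _
    rw [map_mul, ← algebraMap_eq, AlgHom.commutes, algebraMap_eq, res, aeval_X]
    simp
  let φ := algebraMap (MvPolynomial (Fin N) K) (FractionRing (MvPolynomial (Fin N) K))
  have hφ : Function.Injective φ := IsFractionRing.injective _ _
  refine hφ ?_
  have h2 := hn_eq_sum_residues (fun i : Fin N => φ (X i))
    (fun i j h => X_injective (R := K) (hφ h))
    (fun i h => X_ne_zero i (hφ (h.trans (map_zero φ).symm))) (φ (C s)) hm
  have h3 := map_hn φ (fun j => (1 - C s ^ (j + 1)) *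
    ∑ i, (X i : MvPolynomial (Fin N) K) ^ (j + 1)) m
  simp only [map_mul, map_sub, map_one, map_sum, map_pow] at h3
  rw [h1, map_mul, h3, h2, map_mul, map_sum, mul_left_comm, Finset.mul_sum]
  congr 1
  · simp
  · refine Finset.sum_congr rfl fun i _ => ?_
    rw [pairProd_update, pairProd, ← Finset.mul_prod_erase _ _ (Finset.mem_univ i)]
    simp only [C_1, one_mul, map_mul, map_prod, map_sub, map_pow]
    have h0 : ∏ k ∈ Finset.univ.erase i, (φ (X i) - φ (X k)) ≠ 0 := by
      refine Finset.prod_ne_zero_iff.2 fun k hk => ?_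
      rw [← map_sub]
      exact fun h => X_sub_X_ne_zero (Finset.ne_of_mem_erase hk) (hφ (h.trans (map_zero φ).symm))
    field_simp

/-- The Macdonald operator in `N` variables, with denominators cleared. -/
theorem pairProd_mul_res_opE (q s : K) (f : MvPolynomial ℕ+ K) :
    pairProd (fun _ => 1) * res N (opE q s f) = pairProd (fun _ => 1) * res N f +
      C (1 - s) * ∑ i, pairProd (Function.update (fun _ => 1) i s) *
        (dil q i (res N f) - res N f) := by
  set M := (shift q f).natDegree
  have h1 : ∀ i : Fin N, dil q i (res N f) - res N f =
      ∑ m ∈ Finset.range M, X i ^ (m + 1) * res N ((shift q f).coeff (m + 1)) := by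
    intro i
    rw [← eval₂_shift, Polynomial.eval₂_eq_sum_range, Finset.sum_range_succ']
    rw [pow_zero, mul_one, coeff_zero_shift]
    change _ + res N f - _ = _
    rw [add_sub_cancel_right]
    exact Finset.sum_congr rfl fun m _ => mul_comm _ _
  rw [opE_eq_sum q s f (Nat.lt_succ_self _), map_sum, Finset.sum_range_succ', coeff_zero_shift,
    mul_add, add_comm]
  congr 1
  · rw [hDiff, hn_zero, one_mul]
  · simp only [h1, Finset.mul_sum]
    rw [Finset.sum_comm]
    refine Finset.sum_congr rfl fun m _ => ?_
    rw [map_mul, ← mul_assoc, pairProd_mul_res_hDiff s (Nat.succ_ne_zero m), Finset.mul_sum,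
      Finset.sum_mul]
    exact Finset.sum_congr rfl fun i _ => by rw [mul_assoc, mul_assoc]

theorem res_opE_eq_zero (q s : K) {f : MvPolynomial ℕ+ K} (hf : res N f = 0) :
    res N (opE q s f) = 0 := by
  have h := pairProd_mul_res_opE (N := N) q s f
  simp only [hf, map_zero, sub_zero, mul_zero, Finset.sum_const_zero, add_zero] at h
  exact (mul_eq_zero.1 h).resolve_left pairProd_one_ne_zero

end FiniteVariables

/-! ### Leading monomials -/

section LeadingMonomials

open MonomialOrder

variable {K : Type*} [Field K] {N : ℕ}

theorem coeff_dil (q : K) (i : Fin N) (g : MvPolynomial (Fin N) K) (b : Fin N →₀ ℕ) :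
    coeff b (dil q i g) = q ^ b i * coeff b g := by
  classical
  induction g using MvPolynomial.induction_on' with
  | add f g hf hg => rw [map_add, coeff_add, coeff_add, hf, hg, mul_add]
  | monomial d a =>
    have h : dil q i (monomial d a) = C (q ^ d i) * monomial d a := by
      rw [dil, aeval_monomial, monomial_eq, algebraMap_eq, mul_left_comm]
      congr 1
      have h1 : ∀ j, ((if j = i then C q * X j else X j) : MvPolynomial (Fin N) K) =
          (if j = i then C q else 1) * X j := by
        intro j; split_ifs <;> simp
      simp only [h1, mul_pow]
      rw [Finsupp.prod_mul]
      congr 1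
      rw [Finsupp.prod_fintype _ _ (by simp), Finset.prod_eq_single_of_mem i (Finset.mem_univ i)]
      · simp
      · intro j _ hj; simp [hj]
    rw [h, coeff_C_mul, coeff_monomial]
    split_ifs with hdb
    · rw [hdb]
    · simp

theorem degree_dil_le {q : K} {i : Fin N} {g : MvPolynomial (Fin N) K} {p : Fin N →₀ ℕ}
    (hg : lex.degree g ≼[lex] p) : lex.degree (dil q i g) ≼[lex] p := by
  rw [degree_le_iff] at hg ⊢
  intro b hb
  refine hg b ?_
  rw [mem_support_iff, coeff_dil] at hb
  exact mem_support_iff.2 (right_ne_zero_of_mul hb)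

theorem degree_X_sub_C_mul_X {j k : Fin N} (hk : k ≠ j) {c : K} (hc : c ≠ 0) :
    lex.degree (X j - C c * X k : MvPolynomial (Fin N) K) = Finsupp.single (min j k) 1 ∧
      lex.leadingCoeff (X j - C c * X k : MvPolynomial (Fin N) K) = if j < k then 1 else -c := by
  have key : ∀ (j k : Fin N) (a b : K), a ≠ 0 → b ≠ 0 → j < k →
      lex.degree (C a * X j + C b * X k : MvPolynomial (Fin N) K) = Finsupp.single j 1 ∧
      lex.leadingCoeff (C a * X j + C b * X k : MvPolynomial (Fin N) K) = a := by
    intro j k a b ha hb hjk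
    have hd : ∀ (j : Fin N) (a : K), a ≠ 0 →
        lex.degree (C a * X j : MvPolynomial (Fin N) K) = Finsupp.single j 1 := by
      classical
      intro j a ha
      rw [X, C_mul_monomial, mul_one, degree_monomial, if_neg ha]
    have hl : lex.degree (C b * X k : MvPolynomial (Fin N) K) ≺[lex]
        lex.degree (C a * X j : MvPolynomial (Fin N) K) := by
      rw [hd _ _ ha, hd _ _ hb, lex_lt_iff]
      exact Finsupp.Lex.single_lt_iff.2 hjk
    rw [degree_add_of_lt hl, leadingCoeff_add_of_lt hl, hd _ _ ha, leadingCoeff_mul, leadingCoeff_C,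
      leadingCoeff_X, mul_one]
    exact ⟨rfl, rfl⟩
  rcases lt_or_gt_of_ne hk with h | h
  · have := key k j (-c) 1 (neg_ne_zero.2 hc) one_ne_zero h
    rw [min_eq_right h.le, if_neg h.not_gt]
    have e : (X j - C c * X k : MvPolynomial (Fin N) K) = C (-c) * X k + C 1 * X j := by
      simp; ring
    rwa [e]
  · have := key j k 1 (-c) one_ne_zero (neg_ne_zero.2 hc) h
    rw [min_eq_left h.le, if_pos h]
    have e : (X j - C c * X k : MvPolynomial (Fin N) K) = C 1 * X j + C (-c) * X k := by
      simp; ring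
    rwa [e]

/-- The exponent of the leading monomial of `pairProd c`. -/
noncomputable def pairDeg (N : ℕ) : Fin N →₀ ℕ :=
  ∑ j, ∑ k ∈ Finset.univ.erase j, Finsupp.single (min j k) 1

theorem pairProd_degree {c : Fin N → K} (hc : ∀ j, c j ≠ 0) :
    lex.degree (pairProd c) = pairDeg N ∧
      lex.leadingCoeff (pairProd c) =
        ∏ j, ∏ k ∈ Finset.univ.erase j, if j < k then 1 else -c j := by
  have h1 : ∀ j : Fin N, lex.degree (∏ k ∈ Finset.univ.erase j, (X j - C (c j) * X k)) =
      ∑ k ∈ Finset.univ.erase j, Finsupp.single (min j k) 1 ∧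
      lex.leadingCoeff (∏ k ∈ Finset.univ.erase j, (X j - C (c j) * X k)) =
        ∏ k ∈ Finset.univ.erase j, if j < k then 1 else -c j := by
    intro j
    have h2 := fun k (hk : k ∈ Finset.univ.erase j) =>
      degree_X_sub_C_mul_X (Finset.ne_of_mem_erase hk) (hc j)
    have h3 : ∀ k ∈ Finset.univ.erase j,
        IsRegular (lex.leadingCoeff (X j - C (c j) * X k : MvPolynomial (Fin N) K)) := by
      intro k hk
      rw [(h2 k hk).2]
      refine isRegular_iff_ne_zero.2 ?_
      split_ifs
      · exact one_ne_zero
      · exact neg_ne_zero.2 (hc j)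
    rw [degree_prod_of_regular h3, leadingCoeff_prod_of_regular h3]
    exact ⟨Finset.sum_congr rfl fun k hk => (h2 k hk).1,
      Finset.prod_congr rfl fun k hk => (h2 k hk).2⟩
  have h4 : ∀ j ∈ Finset.univ, IsRegular (lex.leadingCoeff
      (∏ k ∈ Finset.univ.erase j, (X j - C (c j) * X k : MvPolynomial (Fin N) K))) := by
    intro j _
    rw [(h1 j).2]
    refine isRegular_iff_ne_zero.2 (Finset.prod_ne_zero_iff.2 fun k _ => ?_)
    split_ifs
    · exact one_ne_zero
    · exact neg_ne_zero.2 (hc j)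
  rw [pairProd, degree_prod_of_regular h4, leadingCoeff_prod_of_regular h4]
  exact ⟨Finset.sum_congr rfl fun j _ => (h1 j).1, Finset.prod_congr rfl fun j _ => (h1 j).2⟩

theorem leadingCoeff_pairProd_update {s : K} (hs : s ≠ 0) (i : Fin N) :
    lex.leadingCoeff (pairProd (Function.update (fun _ => 1) i s)) =
      lex.leadingCoeff (pairProd (fun _ : Fin N => (1 : K))) * s ^ (i : ℕ) := by
  rw [(pairProd_degree fun j => ?_).2, (pairProd_degree fun _ => one_ne_zero).2,
    ← Finset.mul_prod_erase _ _ (Finset.mem_univ i), ← Finset.mul_prod_erase _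
      (fun j => ∏ k ∈ Finset.univ.erase j, if j < k then (1 : K) else -1) (Finset.mem_univ i),
    mul_right_comm, Function.update_self]
  · congr 1
    · have h : ∀ k : Fin N, (if i < k then (1 : K) else -s) =
          (if i < k then (1 : K) else -1) * if i < k then 1 else s := by
        intro k; split_ifs <;> simp
      simp only [h]
      rw [Finset.prod_mul_distrib]
      congr 1
      rw [Finset.prod_ite, Finset.prod_const_one, one_mul, Finset.prod_const]
      congr 1
      have : (Finset.univ.erase i).filter (fun k => ¬ i < k) = Finset.Iio i := by
        ext k
        simp only [Finset.mem_filter, Finset.mem_erase, Finset.mem_univ, and_true, Finset.mem_Iio,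
          not_lt]
        exact ⟨fun h => lt_of_le_of_ne h.2 h.1, fun h => ⟨h.ne, h.le⟩⟩
      rw [this, Fin.card_Iio]
    · refine Finset.prod_congr rfl fun j hj => ?_
      rw [Function.update_of_ne (Finset.ne_of_mem_erase hj)]
  · by_cases h : j = i
    · subst h; simpa using hs
    · rw [Function.update_of_ne h]; exact one_ne_zero

/-- The eigenvalue `1 + (1 - s) ∑ s ^ i (q ^ p_i - 1)` of the Macdonald operator. -/
noncomputable def eig {K : Type*} [CommRing K] {N : ℕ} (q s : K) (p : Fin N →₀ ℕ) : K :=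
  1 + (1 - s) * ∑ i : Fin N, s ^ (i : ℕ) * (q ^ p i - 1)

/-- The Macdonald operator is triangular for the lexicographic order, with the eigenvalues on the
diagonal. -/
theorem lex_triangular {q s : K} (hs : s ≠ 0) {g G : MvPolynomial (Fin N) K} {p : Fin N →₀ ℕ}
    (hg : lex.degree g ≼[lex] p) (hgp : coeff p g = 1)
    (h : pairProd (fun _ => 1) * G = pairProd (fun _ => 1) * g +
      C (1 - s) * ∑ i, pairProd (Function.update (fun _ => 1) i s) * (dil q i g - g)) :
    lex.degree G ≼[lex] p ∧ coeff p G = eig q s p := by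
  have hu : ∀ i j : Fin N, Function.update (fun _ => (1 : K)) i s j ≠ 0 := by
    intro i j
    by_cases h : j = i
    · subst h; simpa using hs
    · rw [Function.update_of_ne h]; exact one_ne_zero
  have hA := (pairProd_degree (fun _ : Fin N => one_ne_zero (α := K))).1
  have hV := fun i => (pairProd_degree (hu i)).1
  have hA0 := pairProd_one_ne_zero (K := K) (N := N)
  have hdiff : ∀ i, lex.degree (dil q i g - g) ≼[lex] p :=
    fun i => degree_sub_le.trans (sup_le (degree_dil_le hg) hg)
  have hsum : ∀ {f f' : MvPolynomial (Fin N) K}, lex.degree f ≼[lex] pairDeg N →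
      lex.degree f' ≼[lex] p → lex.degree (f * f') ≼[lex] (pairDeg N + p) := by
    intro f f' h1 h2
    refine degree_mul_le.trans ?_
    rw [map_add, map_add]
    exact add_le_add h1 h2
  -- the right-hand side has degree at most `pairDeg N + p`
  have hR : lex.degree (pairProd (fun _ => 1) * G) ≼[lex] (pairDeg N + p) := by
    rw [h]
    refine degree_add_le.trans (sup_le (hsum (le_of_eq (congrArg _ hA)) hg) ?_)
    rw [← smul_eq_C_mul]
    refine degree_smul_le.trans (degree_sum_le.trans (Finset.sup_le fun i _ => ?_))
    exact hsum (le_of_eq (congrArg _ (hV i))) (hdiff i)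
  have hG : lex.degree G ≼[lex] p := by
    by_cases h0 : G = 0
    · rw [h0, degree_zero, map_zero]
      exact lex.zero_le _
    · rw [degree_mul hA0 h0, hA, map_add, map_add] at hR
      exact le_of_add_le_add_left hR
  refine ⟨hG, ?_⟩
  have hc := congrArg (coeff (pairDeg N + p)) h
  have hlc : ∀ {c : Fin N → K}, (∀ j, c j ≠ 0) →
      coeff (pairDeg N) (pairProd c) = lex.leadingCoeff (pairProd c) := by
    intro c h
    rw [leadingCoeff, (pairProd_degree h).1]
  rw [coeff_mul_of_add_of_degree_le (le_of_eq (congrArg _ hA)) hG, coeff_add,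
    coeff_mul_of_add_of_degree_le (le_of_eq (congrArg _ hA)) hg, coeff_C_mul, coeff_sum,
    hlc (fun _ => one_ne_zero), hgp, mul_one] at hc
  have hi : ∀ i, coeff (pairDeg N + p) (pairProd (Function.update (fun _ => 1) i s) *
      (dil q i g - g)) =
        lex.leadingCoeff (pairProd (fun _ : Fin N => (1 : K))) * (s ^ (i : ℕ) * (q ^ p i - 1)) := by
    intro i
    rw [coeff_mul_of_add_of_degree_le (le_of_eq (congrArg _ (hV i))) (hdiff i), hlc (hu i),
      leadingCoeff_pairProd_update hs, coeff_sub, coeff_dil, hgp]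
    ring
  rw [Finset.sum_congr rfl fun i _ => hi i, ← Finset.mul_sum] at hc
  refine mul_left_cancel₀ (leadingCoeff_ne_zero_iff.2 hA0) (hc.trans ?_)
  rw [eig]
  ring

end LeadingMonomials

/-! ### Partitions and exponents -/

section Partitions

variable {n : ℕ}

/-- The first `N` parts of a partition in weakly decreasing order, padded with zeros. -/
noncomputable def part (N : ℕ) (μ : n.Partition) : Fin N →₀ ℕ :=
  Finsupp.equivFunOnFinite.symm fun i => (μ.parts.sort (· ≥ ·)).getD i 0

theorem part_apply (N : ℕ) (μ : n.Partition) (i : Fin N) :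
    part N μ i = (μ.parts.sort (· ≥ ·)).getD i 0 := rfl

theorem card_parts_le (μ : n.Partition) : μ.parts.card ≤ n := by
  have := Multiset.card_nsmul_le_sum (s := μ.parts) (a := 1) (fun x hx => μ.parts_pos hx)
  rw [μ.parts_sum] at this
  simpa using this

theorem antitone_part (N : ℕ) (μ : n.Partition) : Antitone (part N μ) := by
  intro i j hij
  rw [part_apply, part_apply]
  rcases hij.eq_or_lt with rfl | hij
  · exact le_rfl
  · by_cases hj : (j : ℕ) < (μ.parts.sort (· ≥ ·)).length
    · rw [List.getD_eq_getElem _ _ hj, List.getD_eq_getElem _ _ (lt_trans hij hj)]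
      exact List.pairwise_iff_getElem.1 (Multiset.pairwise_sort μ.parts (· ≥ ·)) _ _ _ _ hij
    · rw [List.getD_eq_default _ _ (not_lt.1 hj)]
      exact Nat.zero_le _

/-- An exponent in `N` variables, as an exponent in all variables. -/
noncomputable def extend {N : ℕ} (b : Fin N →₀ ℕ) : ℕ →₀ ℕ := b.embDomain Fin.valEmbedding

theorem expType_extend {N : ℕ} (b : Fin N →₀ ℕ) : expType (extend b) = b.support.val.map b := by
  rw [expType, extend, Finsupp.support_embDomain, Finset.map_val, Multiset.map_map]
  exact Multiset.map_congr rfl fun x _ => Finsupp.embDomain_apply_self Fin.valEmbedding b x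

theorem expType_extend_part {N : ℕ} (μ : n.Partition) (h : μ.parts.card ≤ N) :
    expType (extend (part N μ)) = μ.parts := by
  rw [expType_extend]
  set L := μ.parts.sort (· ≥ ·) with hL
  have hLμ : (L : Multiset ℕ) = μ.parts := Multiset.sort_eq _ _
  have hlen : L.length ≤ N := by rw [← Multiset.coe_card, hLμ]; exact h
  have h1 : (part N μ).support = Finset.univ.filter fun i => part N μ i ≠ 0 := by
    ext; simp
  have h2 : (Finset.univ : Finset (Fin N)).val.map (part N μ) =
      ((L ++ List.replicate (N - L.length) 0 : List ℕ) : Multiset ℕ) := by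
    rw [Fin.univ_val_map]
    congr 1
    refine List.ext_getElem (by simp; omega) fun i hi hi' => ?_
    rw [List.getElem_ofFn, part_apply, ← hL]
    by_cases h : i < L.length
    · rw [List.getElem_append_left h, List.getD_eq_getElem _ _ h]
    · rw [List.getElem_append_right (not_lt.1 h), List.getElem_replicate,
        List.getD_eq_default _ _ (not_lt.1 h)]
  have h3 := Multiset.filter_map (p := fun k => k ≠ 0) (part N μ) Finset.univ.val
  rw [h1, Finset.filter_val]
  refine h3.symm.trans ?_
  have h4 : ∀ x ∈ L, x ≠ 0 := fun x hx => (μ.parts_pos ((Multiset.mem_sort _).1 hx)).ne'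
  rw [h2, ← Multiset.coe_add, Multiset.filter_add, Multiset.coe_replicate,
    Multiset.filter_eq_self.2 (by simpa using h4), Multiset.filter_eq_nil.2, add_zero, hLμ]
  intro a ha
  simp [Multiset.eq_of_mem_replicate ha]

theorem card_expType_extend_le {N : ℕ} (b : Fin N →₀ ℕ) : (expType (extend b)).card ≤ N := by
  rw [expType_extend, Multiset.card_map]
  exact (Finset.card_le_univ _).trans (by simp)

theorem card_filter_le_eq_countP {N : ℕ} (b : Fin N →₀ ℕ) {v : ℕ} (hv : 0 < v) :
    (Finset.univ.filter fun i => v ≤ b i).card = (expType (extend b)).countP (v ≤ ·) := by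
  rw [expType_extend, Multiset.countP_map, ← Finset.filter_val, ← Finset.card_def]
  congr 1
  ext i
  simp only [Finset.mem_filter, Finset.mem_univ, true_and, Finsupp.mem_support_iff]
  omega

/-- Among all rearrangements of the parts of `μ`, the weakly decreasing one is the largest for the
lexicographic order. -/
theorem toLex_le_part {N : ℕ} {μ : n.Partition} {b : Fin N →₀ ℕ}
    (hb : expType (extend b) = μ.parts) : toLex b ≤ toLex (part N μ) := by
  by_contra hlt
  rw [not_le, Finsupp.Lex.lt_iff] at hlt
  obtain ⟨i, h1, h2⟩ := hlt
  have hN : μ.parts.card ≤ N := hb ▸ card_expType_extend_le b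
  change ∀ j, j < i → part N μ j = b j at h1
  change part N μ i < b i at h2
  have h3 := card_filter_le_eq_countP b (v := b i) (by omega)
  rw [hb, ← expType_extend_part μ hN, ← card_filter_le_eq_countP _ (by omega)] at h3
  refine h3.not_gt (Finset.card_lt_card
    (Finset.ssubset_iff_subset_ne.2 ⟨fun j hj => ?_, fun h => ?_⟩))
  · simp only [Finset.mem_filter, Finset.mem_univ, true_and] at hj ⊢
    have hji : j < i := by
      by_contra h
      exact absurd (antitone_part N μ (not_lt.1 h)) (by omega)
    rwa [← h1 j hji]
  · have : i ∈ Finset.univ.filter fun j => b i ≤ b j := by simp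
    rw [← h] at this
    simp only [Finset.mem_filter, Finset.mem_univ, true_and] at this
    omega

theorem toLex_part_lt {N : ℕ} {ν μ : n.Partition} (hN : n ≤ N) (h : LexLT ν μ) :
    toLex (part N ν) < toLex (part N μ) := by
  rw [Finsupp.Lex.lt_iff]
  have hlen : (μ.parts.sort (· ≥ ·)).length ≤ N := by
    rw [Multiset.length_sort]
    exact (card_parts_le μ).trans hN
  have hpos : ∀ x ∈ μ.parts.sort (· ≥ ·), 0 < x := fun x hx =>
    μ.parts_pos ((Multiset.mem_sort _).1 hx)
  rcases List.lt_iff_exists.1 h with ⟨h1, h2⟩ | ⟨i, hi, hi', h1, h2⟩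
  · refine ⟨⟨_, h2.trans_le hlen⟩, fun j hj => ?_, ?_⟩
    · change part N ν j = part N μ j
      rw [part_apply, part_apply, List.getD_eq_getElem _ _ hj,
        List.getD_eq_getElem _ _ (lt_trans hj h2)]
      conv_lhs => rw [List.getElem_of_eq h1]
      simp
    · change part N ν _ < part N μ _
      rw [part_apply, part_apply, List.getD_eq_default _ _ le_rfl, List.getD_eq_getElem _ _ h2]
      exact hpos _ (List.getElem_mem _)
  · refine ⟨⟨i, hi'.trans_le hlen⟩, fun j hj => ?_, ?_⟩
    · change part N ν j = part N μ j
      rw [part_apply, part_apply, List.getD_eq_getElem _ _ (lt_trans hj hi),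
        List.getD_eq_getElem _ _ (lt_trans hj hi')]
      exact h1 j hj
    · change part N ν _ < part N μ _
      rw [part_apply, part_apply, List.getD_eq_getElem _ _ hi, List.getD_eq_getElem _ _ hi']
      exact h2

theorem LexLT.trichotomy (ν μ : n.Partition) : LexLT ν μ ∨ ν = μ ∨ LexLT μ ν := by
  rcases lt_trichotomy (ν.parts.sort (· ≥ ·)) (μ.parts.sort (· ≥ ·)) with h | h | h
  · exact Or.inl h
  · refine Or.inr (Or.inl (Nat.Partition.ext ?_))
    rw [← Multiset.sort_eq ν.parts (· ≥ ·), h, Multiset.sort_eq]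
  · exact Or.inr (Or.inr h)

theorem LexLT.trans {κ ν μ : n.Partition} (h : LexLT κ ν) (h' : LexLT ν μ) : LexLT κ μ :=
  lt_trans (α := List ℕ) h h'

theorem LexLT.irrefl (μ : n.Partition) : ¬ LexLT μ μ := lt_irrefl (α := List ℕ) _

theorem LexLT.wellFounded : WellFounded (LexLT (n := n)) :=
  haveI : IsTrans n.Partition LexLT := ⟨fun _ _ _ => LexLT.trans⟩
  haveI : Std.Irrefl (LexLT (n := n)) := ⟨LexLT.irrefl⟩
  Finite.wellFounded_of_trans_of_irrefl _

end Partitions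

/-! ### Coefficients of monomials and the monomial symmetric functions -/

section Coefficients

variable {K : Type*} [CommRing K]

/-- The coefficient of `x ^ a` in a symmetric function written in the power sums. -/
noncomputable def lcoeff (a : ℕ →₀ ℕ) : MvPolynomial ℕ+ K →ₗ[K] K :=
  MvPowerSeries.coeff a ∘ₗ (Lam K).val.toLinearMap ∘ₗ (aeval (psum K)).toLinearMap

theorem lcoeff_apply (a : ℕ →₀ ℕ) (f : MvPolynomial ℕ+ K) :
    lcoeff a f = MvPowerSeries.coeff a (aeval (psum K) f : Lam K).1 := rfl

theorem lcoeff_psumEquiv {F : Type*} [Field F] [CharZero F] (a : ℕ →₀ ℕ) (f : MvPolynomial ℕ+ F) :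
    MvPowerSeries.coeff a (psumEquiv F f : MvPowerSeries ℕ F) = lcoeff a f := rfl

theorem lcoeff_eq_of_expType (f : MvPolynomial ℕ+ K) {a b : ℕ →₀ ℕ} (h : expType a = expType b) :
    lcoeff a f = lcoeff b f :=
  coeff_eq_of_expType _ h

theorem lcoeff_C (a : ℕ →₀ ℕ) (c : K) : lcoeff a (C c) = if a = 0 then c else 0 := by
  classical
  rw [lcoeff_apply, ← algebraMap_eq, AlgHom.commutes]
  exact MvPowerSeries.coeff_C a c

theorem lcoeff_mul (a : ℕ →₀ ℕ) (f g : MvPolynomial ℕ+ K) :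
    lcoeff a (f * g) =
      ∑ p ∈ Finset.HasAntidiagonal.antidiagonal a, lcoeff p.1 f * lcoeff p.2 g := by
  classical
  rw [lcoeff_apply, map_mul]
  exact MvPowerSeries.coeff_mul _ _ _

theorem lcoeff_X (a : ℕ →₀ ℕ) (k : ℕ+) :
    lcoeff a (X k : MvPolynomial ℕ+ K) = if expType a = {(k : ℕ)} then 1 else 0 := by
  classical
  rw [lcoeff_apply, aeval_X, psum]
  refine (coeff_ofType _ _ _ a).trans ?_
  split_ifs <;> rfl

theorem lcoeff_map {L : Type*} [CommRing L] (φ : K →+* L) (a : ℕ →₀ ℕ) (f : MvPolynomial ℕ+ K) :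
    lcoeff a (map φ f) = φ (lcoeff a f) := by
  induction f using MvPolynomial.induction_on generalizing a with
  | C c => rw [map_C, lcoeff_C, lcoeff_C]; split_ifs <;> simp
  | add f g hf hg => simp only [map_add, hf, hg]
  | mul_X f k hf =>
    rw [map_mul, map_X, lcoeff_mul, lcoeff_mul, map_sum]
    refine Finset.sum_congr rfl fun p _ => ?_
    rw [map_mul, hf, lcoeff_X, lcoeff_X]
    split_ifs <;> simp

theorem lcoeff_scale (c : K) (a : ℕ →₀ ℕ) (f : MvPolynomial ℕ+ K) :
    lcoeff a (scale c f) = c ^ a.degree * lcoeff a f := by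
  classical
  induction f using MvPolynomial.induction_on generalizing a with
  | C b =>
    rw [← algebraMap_eq, AlgHom.commutes, algebraMap_eq, lcoeff_C]
    by_cases h : a = 0
    · subst h; simp
    · simp [h]
  | add f g hf hg => simp only [map_add, hf, hg, mul_add]
  | mul_X f k hf =>
    rw [map_mul, scale_X, mul_left_comm, ← smul_eq_C_mul, map_smul, lcoeff_mul, lcoeff_mul,
      smul_eq_mul, Finset.mul_sum, Finset.mul_sum]
    refine Finset.sum_congr rfl fun p hp => ?_
    rw [hf, lcoeff_X]
    split_ifs with h
    · have h1 : p.2.degree = (k : ℕ) := by rw [← expType_sum, h, Multiset.sum_singleton]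
      have h2 : p.1 + p.2 = a := Finset.HasAntidiagonal.mem_antidiagonal.1 hp
      rw [← h2, map_add, h1, pow_add]
      ring
    · simp

theorem eq_of_lcoeff_eq {F : Type*} [Field F] [CharZero F] {f g : MvPolynomial ℕ+ F}
    (h : ∀ a, lcoeff a f = lcoeff a g) : f = g := by
  refine (psumEquiv F).injective (Subtype.ext (MvPowerSeries.ext fun a => ?_))
  exact h a

theorem extend_eq_single {N : ℕ} {b : Fin N →₀ ℕ} {k : ℕ} (hk : k ≠ 0) :
    expType (extend b) = {k} ↔ ∃ i, b = Finsupp.single i k := by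
  rw [expType_eq_singleton hk]
  constructor
  · rintro ⟨i, hi⟩
    have h1 : i ∈ (extend b).support := by rw [hi]; simp [hk]
    rw [extend, Finsupp.support_embDomain, Finset.mem_map] at h1
    obtain ⟨j, -, rfl⟩ := h1
    refine ⟨j, Finsupp.embDomain_injective Fin.valEmbedding ?_⟩
    rw [Finsupp.embDomain_single]
    exact hi
  · rintro ⟨i, rfl⟩
    exact ⟨_, Finsupp.embDomain_single _ _ _⟩

theorem coeff_res {F : Type*} [Field F] {N : ℕ} (b : Fin N →₀ ℕ) (f : MvPolynomial ℕ+ F) :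
    coeff b (res N f) = lcoeff (extend b) f := by
  classical
  let ι : MvPolynomial (Fin N) F →ₐ[F] MvPowerSeries (Fin N) F :=
    MvPolynomial.coeToMvPowerSeries.algHom F
  have hι : ∀ g, ι g = (g : MvPowerSeries (Fin N) F) := fun g => by
    simp [ι, MvPolynomial.coeToMvPowerSeries.algHom_apply]
  let κ : Lam F →ₐ[F] MvPowerSeries (Fin N) F :=
    (MvPowerSeries.killCompl Fin.valEmbedding).comp (Lam F).val
  have hκ : ∀ (g : Lam F) (b : Fin N →₀ ℕ), MvPowerSeries.coeff b (κ g) =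
      MvPowerSeries.coeff (extend b) (g : MvPowerSeries ℕ F) := fun g b => by
    simp only [κ, AlgHom.comp_apply, Subalgebra.coe_val, MvPowerSeries.coeff_killCompl, extend]
  have h : ι.comp (res N) = κ.comp (aeval (psum F)) := by
    refine algHom_ext fun k => ?_
    rw [AlgHom.comp_apply, AlgHom.comp_apply, res, aeval_X, aeval_X]
    ext b
    have h1 : MvPowerSeries.coeff b (κ (psum F k)) =
        if expType (extend b) = {(k : ℕ)} then 1 else 0 := by
      rw [hκ, psum, coeff_ofType]
    have h2 : MvPowerSeries.coeff b (ι (∑ i, X i ^ (k : ℕ))) =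
        ∑ i, if Finsupp.single i (k : ℕ) = b then (1 : F) else 0 := by
      rw [hι, MvPolynomial.coeff_coe]
      simp [coeff_sum, coeff_X_pow]
    rw [h1, h2]
    by_cases hb : ∃ i, b = Finsupp.single i (k : ℕ)
    · rw [if_pos ((extend_eq_single k.ne_zero).2 hb)]
      obtain ⟨i, rfl⟩ := hb
      rw [Finset.sum_eq_single_of_mem i (Finset.mem_univ i), if_pos rfl]
      intro j _ hj
      rw [if_neg]
      exact fun h => hj (Finsupp.single_left_injective k.ne_zero h)
    · rw [if_neg (mt (extend_eq_single k.ne_zero).1 hb)]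
      exact Finset.sum_eq_zero fun i _ => if_neg fun h => hb ⟨i, h.symm⟩
  have h3 := congrArg (MvPowerSeries.coeff b) (AlgHom.congr_fun h f)
  rw [AlgHom.comp_apply, hι, MvPolynomial.coeff_coe] at h3
  exact h3.trans (hκ _ b)

variable (K) in
/-- The monomial symmetric function `m_μ`, written in the power sums. -/
noncomputable def mono [Algebra ℚ K] {n : ℕ} (μ : n.Partition) : MvPolynomial ℕ+ K :=
  map (algebraMap ℚ K) ((psumEquiv ℚ).symm (msymm ℚ μ))

theorem map_mono [Algebra ℚ K] {L : Type*} [CommRing L] [Algebra ℚ L] (φ : K →+* L) {n : ℕ}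
    (μ : n.Partition) : map φ (mono K μ) = mono L μ := by
  rw [mono, map_map, mono]
  congr 1
  exact congrArg map (Subsingleton.elim _ _)

open Classical in
theorem lcoeff_mono [Algebra ℚ K] {n : ℕ} (μ : n.Partition) (a : ℕ →₀ ℕ) :
    lcoeff a (mono K μ) = if expType a = μ.parts then 1 else 0 := by
  rw [mono, lcoeff_map, ← lcoeff_psumEquiv, AlgEquiv.apply_symm_apply, msymm, coeff_ofType]
  split_ifs <;> simp

theorem psumEquiv_mono {F : Type*} [Field F] [CharZero F] [Algebra ℚ F] {n : ℕ}
    (μ : n.Partition) : psumEquiv F (mono F μ) = msymm F μ := by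
  classical
  refine Subtype.ext (MvPowerSeries.ext fun a => ?_)
  rw [lcoeff_psumEquiv, lcoeff_mono, msymm, coeff_ofType]

/-- An exponent whose nonzero entries are the parts of `μ`. -/
noncomputable def expo {n : ℕ} (μ : n.Partition) : ℕ →₀ ℕ := extend (part n μ)

theorem expType_expo {n : ℕ} (μ : n.Partition) : expType (expo μ) = μ.parts :=
  expType_extend_part μ (card_parts_le μ)

theorem exists_partition {n : ℕ} {a : ℕ →₀ ℕ} (ha : a.degree = n) :
    ∃ μ : n.Partition, expType a = μ.parts := by
  refine ⟨⟨expType a, fun {k} hk => ?_, by rw [expType_sum, ha]⟩, rfl⟩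
  obtain ⟨i, hi, rfl⟩ := Multiset.mem_map.1 hk
  exact Nat.pos_of_ne_zero (Finsupp.mem_support_iff.1 hi)

/-- A homogeneous symmetric function as a combination of the `m_μ`. -/
theorem eq_sum_mono {F : Type*} [Field F] [CharZero F] [Algebra ℚ F] {n : ℕ}
    {f : MvPolynomial ℕ+ F} (hf : scale 2 f = C (2 ^ n) * f) :
    f = ∑ μ : n.Partition, C (lcoeff (expo μ) f) * mono F μ := by
  classical
  refine eq_of_lcoeff_eq fun a => ?_
  rw [map_sum]
  simp only [← smul_eq_C_mul, map_smul, smul_eq_mul, lcoeff_mono]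
  by_cases ha : a.degree = n
  · obtain ⟨μ, hμ⟩ := exists_partition ha
    rw [Finset.sum_eq_single_of_mem μ (Finset.mem_univ μ), if_pos hμ, mul_one]
    · exact lcoeff_eq_of_expType f (hμ.trans (expType_expo μ).symm)
    · intro ν _ hν
      rw [if_neg, mul_zero]
      exact fun h => hν (Nat.Partition.ext (h.symm.trans hμ))
  · have h1 := congrArg (lcoeff a) hf
    rw [lcoeff_scale, ← smul_eq_C_mul, map_smul, smul_eq_mul] at h1
    have h2 : (2 : F) ^ a.degree ≠ 2 ^ n := by
      intro h
      refine ha (Nat.pow_right_injective le_rfl (?_ : 2 ^ a.degree = 2 ^ n))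
      exact_mod_cast h
    rw [(mul_eq_mul_right_iff.1 h1).resolve_left h2]
    refine (Finset.sum_eq_zero fun μ _ => ?_).symm
    rw [if_neg, mul_zero]
    intro h
    exact ha (by rw [← expType_sum, h, μ.parts_sum])

theorem scale_mono {F : Type*} [Field F] [CharZero F] [Algebra ℚ F] {n : ℕ} (c : F)
    (μ : n.Partition) : scale c (mono F μ) = C (c ^ n) * mono F μ := by
  classical
  refine eq_of_lcoeff_eq fun a => ?_
  rw [lcoeff_scale, ← smul_eq_C_mul, map_smul, smul_eq_mul, lcoeff_mono]
  split_ifs with h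
  · rw [← expType_sum, h, μ.parts_sum]
  · simp

end Coefficients

/-! ### The matrix of the Macdonald operator in the monomial basis -/

section Triangular

/-- The coefficient of `m_ν` in the image of `m_μ` under the Macdonald operator. -/
noncomputable def opCoeff {K : Type*} [CommRing K] [Algebra ℚ K] (q s : K) {n : ℕ}
    (μ ν : n.Partition) : K :=
  lcoeff (expo ν) (opE q s (mono K μ))

theorem map_opCoeff {K L : Type*} [CommRing K] [Algebra ℚ K] [CommRing L] [Algebra ℚ L]
    (φ : K →+* L) (q s : K) {n : ℕ} (μ ν : n.Partition) :
    φ (opCoeff q s μ ν) = opCoeff (φ q) (φ s) μ ν := by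
  rw [opCoeff, ← lcoeff_map, map_opE, map_mono, opCoeff]

variable {F : Type*} [Field F] [Algebra ℚ F]

theorem opE_mono [CharZero F] (q s : F) {n : ℕ} (μ : n.Partition) :
    opE q s (mono F μ) = ∑ ν : n.Partition, C (opCoeff q s μ ν) * mono F ν := by
  refine eq_sum_mono ?_
  rw [scale_opE, scale_mono, ← smul_eq_C_mul, map_smul, smul_eq_C_mul]

theorem res_mono_eq_zero {n N : ℕ} {μ : n.Partition} (h : N < μ.parts.card) :
    res N (mono F μ) = 0 := by
  classical
  ext b
  rw [coeff_res, lcoeff_mono, if_neg, coeff_zero]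
  intro hb
  have := card_expType_extend_le b
  rw [hb] at this
  omega

/-- The Macdonald operator preserves the kernel of the restriction to `N` variables, so it maps
`m_μ` to a combination of the `m_ν` for which `ν` is at least as long as `μ`. -/
theorem card_le_of_opCoeff_ne_zero {q s : F} {n : ℕ} {μ ν : n.Partition}
    (h : opCoeff q s μ ν ≠ 0) : μ.parts.card ≤ ν.parts.card := by
  by_contra hlt
  refine h ?_
  have h1 := res_opE_eq_zero q s (res_mono_eq_zero (F := F) (not_le.1 hlt))
  have h2 := congrArg (coeff (part ν.parts.card ν)) h1
  rw [coeff_res, coeff_zero] at h2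
  rw [opCoeff, ← h2]
  exact lcoeff_eq_of_expType _ ((expType_expo ν).trans (expType_extend_part ν le_rfl).symm)

theorem opCoeff_triangular {q s : F} (hs : s ≠ 0) {n : ℕ} (μ : n.Partition) :
    (∀ ν, LexLT μ ν → opCoeff q s μ ν = 0) ∧ opCoeff q s μ μ = eig q s (part n μ) := by
  classical
  have h1 : MonomialOrder.lex.toSyn (MonomialOrder.lex.degree (res n (mono F μ))) ≤
      MonomialOrder.lex.toSyn (part n μ) := by
    rw [MonomialOrder.degree_le_iff]
    intro b hb
    rw [mem_support_iff, coeff_res, lcoeff_mono] at hb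
    refine toLex_le_part ?_
    by_contra h
    exact hb (if_neg h)
  have h2 := lex_triangular hs h1
    (by rw [coeff_res, lcoeff_mono, if_pos (expType_extend_part μ (card_parts_le μ))])
    (pairProd_mul_res_opE q s (mono F μ))
  refine ⟨fun ν hν => ?_, ?_⟩
  · rw [opCoeff, expo, ← coeff_res]
    exact MonomialOrder.coeff_eq_zero_of_lt (h2.1.trans_lt (toLex_part_lt le_rfl hν))
  · rw [← h2.2, coeff_res, opCoeff, expo]

end Triangular

/-! ### Positivity of the scalar product -/

section Positivity

theorem form_eq_sum (f g : MvPolynomial ℕ+ Fqt) :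
    form f g = ∑ d ∈ f.support, coeff d f * coeff d g * zqt d := by
  classical
  have h : ∀ d a, form (monomial d a) g = a * coeff d g * zqt d := by
    intro d a
    induction g using MvPolynomial.induction_on' with
    | add g g' hg hg' => rw [map_add, hg, hg', coeff_add]; ring
    | monomial e b =>
      rw [form_monomial, coeff_monomial]
      by_cases hde : d = e
      · subst hde; simp
      · rw [if_neg hde, if_neg (Ne.symm hde)]; simp
  conv_lhs => rw [f.as_sum]
  rw [map_sum, LinearMap.sum_apply]
  exact Finset.sum_congr rfl fun d _ => h d _

/-- A weighted sum of squares in `ℚ(q, t)` vanishes only trivially, if the weights are polynomials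
which are positive for `0 < q, t < 1`. -/
theorem eq_zero_of_sum_sq_eq_zero {ι : Type*} (T : Finset ι) (a : ι → Fqt)
    (w : ι → MvPolynomial (Fin 2) ℚ)
    (hw : ∀ i ∈ T, ∀ x : Fin 2 → ℚ, (∀ j, x j ∈ Set.Ioo (0 : ℚ) 1) → 0 < eval x (w i))
    (h : ∑ i ∈ T, a i ^ 2 * algebraMap _ Fqt (w i) = 0) : ∀ i ∈ T, a i = 0 := by
  classical
  obtain ⟨b, hb⟩ := IsLocalization.exist_integer_multiples
    (nonZeroDivisors (MvPolynomial (Fin 2) ℚ)) T a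
  choose! α hα using hb
  have hinj := IsFractionRing.injective (MvPolynomial (Fin 2) ℚ) Fqt
  have hb0 : algebraMap (MvPolynomial (Fin 2) ℚ) Fqt b ≠ 0 := fun h =>
    nonZeroDivisors.ne_zero b.2 (hinj (h.trans (map_zero _).symm))
  have h1 : ∑ i ∈ T, α i ^ 2 * w i = 0 := by
    refine hinj ?_
    rw [map_sum, map_zero]
    have h2 := congrArg (fun y => (algebraMap (MvPolynomial (Fin 2) ℚ) Fqt b) ^ 2 * y) h
    simp only [mul_zero, Finset.mul_sum] at h2
    rw [← h2]
    refine Finset.sum_congr rfl fun i hi => ?_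
    rw [map_mul, map_pow, hα i hi]
    rw [Algebra.smul_def]
    ring
  intro i hi
  have h3 : α i = 0 := by
    refine funext_set (fun _ => Set.Ioo (0 : ℚ) 1)
      (fun _ => Set.Ioo_infinite one_pos) fun x hx => ?_
    have h4 := congrArg (eval x) h1
    rw [map_sum, map_zero] at h4
    have hx' : ∀ j, x j ∈ Set.Ioo (0 : ℚ) 1 := fun j => hx j (Set.mem_univ j)
    have h5 := (Finset.sum_eq_zero_iff_of_nonneg fun j hj => ?_).1 h4 i hi
    · rw [map_mul, map_pow] at h5
      rw [map_zero]
      exact pow_eq_zero_iff two_ne_zero |>.1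
        ((mul_eq_zero.1 h5).resolve_right (hw i hi x hx').ne')
    · rw [map_mul, map_pow]
      exact mul_nonneg (sq_nonneg _) (hw j hj x hx').le
  have h6 := hα i hi
  rw [h3, map_zero, Algebra.smul_def] at h6
  exact (mul_eq_zero.1 h6.symm).resolve_left hb0

/-- The scalar product is anisotropic. -/
theorem eq_zero_of_form_self {f : MvPolynomial ℕ+ Fqt} (h : form f f = 0) : f = 0 := by
  classical
  let num : (ℕ+ →₀ ℕ) → MvPolynomial (Fin 2) ℚ := fun d =>
    d.prod fun k m => C ((m.factorial : ℚ) * (k : ℕ) ^ m) * (1 - X 0 ^ (k : ℕ)) ^ m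
  let den : (ℕ+ →₀ ℕ) → MvPolynomial (Fin 2) ℚ := fun d =>
    d.prod fun k m => (1 - X 1 ^ (k : ℕ)) ^ m
  let φ := algebraMap (MvPolynomial (Fin 2) ℚ) Fqt
  have hden : ∀ d, φ (den d) ≠ 0 := by
    intro d
    rw [map_finsuppProd]
    refine Finset.prod_ne_zero_iff.2 fun k _ => ?_
    simp only [map_pow, map_sub, map_one]
    exact pow_ne_zero _ (one_sub_t_pow_ne_zero k)
  have hz : ∀ d, zqt d = φ (num d) / φ (den d) := by
    intro d
    rw [map_finsuppProd, map_finsuppProd, Finsupp.prod, Finsupp.prod, ← Finset.prod_div_distrib,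
      zqt, Finsupp.prod]
    refine Finset.prod_congr rfl fun k _ => ?_
    have h1 : φ (C ((d k).factorial * ((k : ℕ) : ℚ) ^ d k)) =
        (d k).factorial * ((k : ℕ) : Fqt) ^ d k := by simp
    rw [map_mul, h1, map_pow, map_pow, map_sub, map_sub, map_one, map_pow, map_pow, div_pow,
      mul_div_assoc]
    rfl
  have h1 := eq_zero_of_sum_sq_eq_zero f.support (fun d => coeff d f / φ (den d))
    (fun d => num d * den d) ?_ ?_
  · ext d
    by_contra hd
    have h2 := h1 d (mem_support_iff.2 hd)
    rcases div_eq_zero_iff.1 h2 with h3 | h3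
    · exact hd h3
    · exact hden d h3
  · intro d _ x hx
    have hpos : ∀ (j : Fin 2) (k : ℕ+), 0 < 1 - x j ^ (k : ℕ) := fun j k =>
      sub_pos.2 (pow_lt_one₀ (hx j).1.le (hx j).2 k.ne_zero)
    rw [map_mul]
    refine mul_pos ?_ ?_
    · rw [map_finsuppProd]
      refine Finset.prod_pos fun k _ => ?_
      have := hpos 0 k
      have := k.pos
      have := Nat.factorial_pos (d k)
      simp only [map_mul, map_pow, map_sub, map_one, eval_C, eval_X]
      positivity
    · rw [map_finsuppProd]
      refine Finset.prod_pos fun k _ => ?_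
      simp only [map_pow, map_sub, map_one, eval_X]
      exact pow_pos (hpos 1 k) _
  · rw [← h, form_eq_sum]
    refine Finset.sum_congr rfl fun d _ => ?_
    have := hden d
    rw [hz, map_mul]
    change (coeff d f / φ (den d)) ^ 2 * (φ (num d) * φ (den d)) = _
    field_simp

end Positivity

/-! ### The Macdonald functions as eigenfunctions -/

section Eigenfunctions

variable {n : ℕ}

/-- The Macdonald function `P_μ`, written in the power sums. -/
noncomputable def macP (μ : n.Partition) : MvPolynomial ℕ+ Fqt :=
  (psumEquiv Fqt).symm (macdonaldP μ)

open Classical in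
theorem macP_eq (μ : n.Partition) : macP μ = mono Fqt μ -
    ∑ ν : {ν : n.Partition // LexLT ν μ},
      (form (mono Fqt μ) (macP ν.1) / form (macP ν.1) (macP ν.1)) • macP ν.1 := by
  refine (psumEquiv Fqt).injective ?_
  simp only [macP, map_sub, map_sum, map_smul, form_apply, AlgEquiv.apply_symm_apply,
    psumEquiv_mono]
  rw [macdonaldP]

/-- The span of the `m_ν` for which `ν` is smaller than `μ`. -/
noncomputable def lower (μ : n.Partition) : Submodule Fqt (MvPolynomial ℕ+ Fqt) :=
  Submodule.span Fqt (mono Fqt '' {ν | LexLT ν μ})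

theorem mono_mem_lower {ν μ : n.Partition} (h : LexLT ν μ) : mono Fqt ν ∈ lower μ :=
  Submodule.subset_span ⟨ν, h, rfl⟩

theorem lower_mono {ν μ : n.Partition} (h : LexLT ν μ) : lower ν ≤ lower μ := by
  refine Submodule.span_mono (Set.image_mono fun κ hκ => ?_)
  exact LexLT.trans hκ h

theorem macP_sub_mem_lower (μ : n.Partition) : macP μ - mono Fqt μ ∈ lower μ := by
  classical
  induction μ using LexLT.wellFounded.induction with
  | _ μ ih =>
    rw [macP_eq, sub_sub_cancel_left]
    refine Submodule.neg_mem _ (Submodule.sum_mem _ fun ν _ => Submodule.smul_mem _ _ ?_)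
    have h1 := Submodule.add_mem _ (lower_mono ν.2 (ih ν.1 ν.2)) (mono_mem_lower ν.2)
    rwa [sub_add_cancel] at h1

theorem lcoeff_lower {μ : n.Partition} {f : MvPolynomial ℕ+ Fqt} (hf : f ∈ lower μ) :
    lcoeff (expo μ) f = 0 := by
  classical
  induction hf using Submodule.span_induction with
  | mem f hf =>
    obtain ⟨ν, hν, rfl⟩ := hf
    rw [lcoeff_mono, if_neg]
    rw [expType_expo]
    intro h
    rw [Nat.Partition.ext h] at hν
    exact LexLT.irrefl _ hν
  | zero => rw [map_zero]
  | add f g _ _ hf hg => rw [map_add, hf, hg, add_zero]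
  | smul c f _ hf => rw [map_smul, hf, smul_zero]

theorem macP_ne_zero (μ : n.Partition) : macP μ ≠ 0 := by
  classical
  intro h
  have h1 := lcoeff_lower (macP_sub_mem_lower μ)
  rw [h, map_sub, map_zero, lcoeff_mono, if_pos (expType_expo μ)] at h1
  simp at h1

theorem form_macP_self_ne_zero (μ : n.Partition) : form (macP μ) (macP μ) ≠ 0 :=
  fun h => macP_ne_zero μ (eq_zero_of_form_self h)

theorem form_macP_of_lexLT {μ ν : n.Partition} (h : LexLT ν μ) : form (macP μ) (macP ν) = 0 := by
  classical
  induction μ using LexLT.wellFounded.induction generalizing ν with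
  | _ μ ih =>
    rw [macP_eq μ, map_sub, LinearMap.sub_apply, map_sum, LinearMap.sum_apply,
      Finset.sum_eq_single_of_mem ⟨ν, h⟩ (Finset.mem_univ _), map_smul, LinearMap.smul_apply,
      smul_eq_mul, div_mul_cancel₀ _ (form_macP_self_ne_zero ν), sub_self]
    intro κ _ hκ
    rw [map_smul, LinearMap.smul_apply]
    rcases LexLT.trichotomy κ.1 ν with h1 | h1 | h1
    · rw [form_comm (macP κ.1) (macP ν), ih ν h h1, smul_zero]
    · exact absurd (Subtype.ext h1) hκ
    · rw [ih κ.1 κ.2 h1, smul_zero]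

theorem form_macP_lower {μ : n.Partition} {f : MvPolynomial ℕ+ Fqt} (hf : f ∈ lower μ) :
    form (macP μ) f = 0 := by
  classical
  induction hf using Submodule.span_induction with
  | mem f hf =>
    obtain ⟨ν, hν, rfl⟩ := hf
    have h1 := macP_eq ν
    rw [eq_sub_iff_add_eq] at h1
    rw [← h1, map_add, form_macP_of_lexLT hν, map_sum, zero_add]
    refine Finset.sum_eq_zero fun κ _ => ?_
    rw [map_smul, form_macP_of_lexLT (LexLT.trans κ.2 hν), smul_zero]
  | zero => rw [map_zero]
  | add f g _ _ hf hg => rw [map_add, hf, hg, add_zero]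
  | smul c f _ hf => rw [map_smul, hf, smul_zero]

theorem opE_mono_sub_mem_lower (μ : n.Partition) :
    opE q t⁻¹ (mono Fqt μ) - eig q t⁻¹ (part n μ) • mono Fqt μ ∈ lower μ := by
  classical
  have ht := opCoeff_triangular (F := Fqt) (q := q) (inv_ne_zero t_ne_zero) μ
  rw [opE_mono, ← Finset.add_sum_erase _ _ (Finset.mem_univ μ), ht.2, smul_eq_C_mul,
    add_sub_cancel_left]
  refine Submodule.sum_mem _ fun ν hν => ?_
  rw [← smul_eq_C_mul]
  rcases LexLT.trichotomy ν μ with h | h | h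
  · exact Submodule.smul_mem _ _ (mono_mem_lower h)
  · exact absurd h (Finset.ne_of_mem_erase hν)
  · rw [ht.1 ν h, zero_smul]
    exact Submodule.zero_mem _

theorem opE_mem_lower {μ : n.Partition} {f : MvPolynomial ℕ+ Fqt} (hf : f ∈ lower μ) :
    opE q t⁻¹ f ∈ lower μ := by
  induction hf using Submodule.span_induction with
  | mem f hf =>
    obtain ⟨ν, hν, rfl⟩ := hf
    have h1 := Submodule.add_mem _ (lower_mono hν (opE_mono_sub_mem_lower ν))
      (Submodule.smul_mem _ (eig q t⁻¹ (part n ν)) (mono_mem_lower hν))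
    rwa [sub_add_cancel] at h1
  | zero => rw [map_zero]; exact Submodule.zero_mem _
  | add f g _ _ hf hg => rw [map_add]; exact Submodule.add_mem _ hf hg
  | smul c f _ hf => rw [map_smul]; exact Submodule.smul_mem _ _ hf

/-- The Macdonald functions are eigenfunctions of the Macdonald operator. -/
theorem opE_macP (μ : n.Partition) :
    opE q t⁻¹ (macP μ) = eig q t⁻¹ (part n μ) • macP μ := by
  rw [← sub_eq_zero]
  have hmem : opE q t⁻¹ (macP μ) - eig q t⁻¹ (part n μ) • macP μ ∈ lower μ := by
    have h1 := macP_sub_mem_lower μ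
    have h2 := Submodule.sub_mem _ (opE_mem_lower h1)
      (Submodule.smul_mem _ (eig q t⁻¹ (part n μ)) h1)
    have h3 := Submodule.add_mem _ h2 (opE_mono_sub_mem_lower μ)
    rw [map_sub, smul_sub] at h3
    convert h3 using 1
    abel
  have h4 : ∀ f, form (opE q t⁻¹ (macP μ) - eig q t⁻¹ (part n μ) • macP μ) f =
      form (opE q t⁻¹ (macP μ)) f - eig q t⁻¹ (part n μ) • form (macP μ) f := fun f => by
    rw [map_sub, LinearMap.sub_apply, map_smul, LinearMap.smul_apply]
  refine eq_zero_of_form_self ?_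
  rw [h4, form_opE, form_macP_lower (opE_mem_lower hmem), form_macP_lower hmem, smul_zero, sub_zero]

end Eigenfunctions

/-! ### Duality between monomials and products of complete symmetric functions -/

section Duality

/-- The product `∏ h_{a_i}` of complete symmetric functions, written in the power sums. -/
noncomputable def hProd (K : Type*) [CommRing K] [Algebra ℚ K] (a : ℕ →₀ ℕ) : MvPolynomial ℕ+ K :=
  a.prod fun _ m => hn (fun j => X j.succPNat) m

theorem hProd_eq_prod {K : Type*} [CommRing K] [Algebra ℚ K] {a : ℕ →₀ ℕ} {S : Finset ℕ}
    (h : a.support ⊆ S) : hProd K a = ∏ i ∈ S, hn (fun j => X j.succPNat) (a i) :=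
  Finsupp.prod_of_support_subset _ h _ fun _ _ => hn_zero _

theorem map_hProd {K L : Type*} [CommRing K] [Algebra ℚ K] [CommRing L] [Algebra ℚ L]
    (φ : K →+* L) (a : ℕ →₀ ℕ) : map φ (hProd K a) = hProd L a := by
  rw [hProd, hProd, map_finsuppProd]
  refine Finsupp.prod_congr fun i _ => ?_
  rw [map_hn]
  simp

theorem scale_hProd {K : Type*} [CommRing K] [Algebra ℚ K] (c : K) (a : ℕ →₀ ℕ) :
    scale c (hProd K a) = C (c ^ a.degree) * hProd K a := by
  have h : ∀ m, scale c (hn (fun j => X j.succPNat) m) =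
      C (c ^ m) * hn (fun j => X j.succPNat) m := by
    intro m
    refine (map_hn (scale c).toRingHom _ m).trans ?_
    rw [C_pow, ← hn_geom_mul]
    congr 1
    funext j
    refine (scale_X c _).trans ?_
    simp
  rw [hProd, map_finsuppProd, Finsupp.prod, Finset.prod_congr rfl fun i _ => h (a i),
    Finset.prod_mul_distrib, ← map_prod, Finset.prod_pow_eq_pow_sum]
  rfl

theorem lcoeff_X_mul {K : Type*} [CommRing K] (k : ℕ+) (a : ℕ →₀ ℕ) (f : MvPolynomial ℕ+ K) :
    lcoeff a (X k * f) = ∑ i ∈ a.support,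
      if (k : ℕ) ≤ a i then lcoeff (a - Finsupp.single i (k : ℕ)) f else 0 := by
  classical
  rw [lcoeff_mul, ← Finset.sum_filter]
  simp only [lcoeff_X, ite_mul, one_mul, zero_mul]
  rw [← Finset.sum_filter]
  refine (Finset.sum_bij (fun i _ => (Finsupp.single i (k : ℕ), a - Finsupp.single i (k : ℕ)))
    ?_ ?_ ?_ ?_).symm
  · intro i hi
    have hi := (Finset.mem_filter.1 hi).2
    rw [Finset.mem_filter, Finset.HasAntidiagonal.mem_antidiagonal]
    exact ⟨add_tsub_cancel_of_le (Finsupp.single_le_iff.2 hi),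
      (expType_eq_singleton k.ne_zero).2 ⟨i, rfl⟩⟩
  · intro i _ j _ h
    exact Finsupp.single_left_injective k.ne_zero (Prod.ext_iff.1 h).1
  · rintro ⟨u, v⟩ h
    rw [Finset.mem_filter, Finset.HasAntidiagonal.mem_antidiagonal] at h
    obtain ⟨rfl, h⟩ := h
    obtain ⟨i, rfl⟩ := (expType_eq_singleton k.ne_zero).1 h
    refine ⟨i, ?_, ?_⟩
    · have := k.pos
      rw [Finset.mem_filter, Finsupp.mem_support_iff, Finsupp.add_apply, Finsupp.single_eq_same]
      omega
    · simp
  · intro i _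
    rfl

theorem derivation_prod {R A ι : Type*} [CommSemiring R] [CommRing A] [Algebra R A]
    [DecidableEq ι] (D : Derivation R A A) (T : Finset ι) (f : ι → A) :
    D (∏ i ∈ T, f i) = ∑ i ∈ T, (∏ j ∈ T.erase i, f j) * D (f i) := by
  induction T using Finset.induction_on with
  | empty => simp
  | insert i T hi ih =>
    rw [Finset.prod_insert hi, Derivation.leibniz, ih, Finset.sum_insert hi,
      Finset.erase_insert hi, smul_eq_mul, smul_eq_mul, add_comm, Finset.mul_sum]
    congr 1
    refine Finset.sum_congr rfl fun j hj => ?_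
    have hij : i ≠ j := by rintro rfl; exact hi hj
    rw [Finset.erase_insert_of_ne hij, Finset.prod_insert, mul_assoc]
    exact fun h => hi (Finset.mem_of_mem_erase h)

theorem pderiv_hProd (k : ℕ+) (a : ℕ →₀ ℕ) :
    C ((k : ℕ) : Fqt) * pderiv k (hProd Fqt a) = ∑ i ∈ a.support,
      if (k : ℕ) ≤ a i then hProd Fqt (a - Finsupp.single i (k : ℕ)) else 0 := by
  classical
  obtain ⟨m, rfl⟩ : ∃ m : ℕ, k = m.succPNat := ⟨k.natPred, by simp⟩
  rw [hProd, Finsupp.prod, derivation_prod, Finset.mul_sum]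
  refine Finset.sum_congr rfl fun i hi => ?_
  have h1 := pderiv_hn (y := fun j => X j.succPNat) (c := fun _ => 1) (by simp) m (a i)
  have h2 : (((m.succPNat : ℕ+) : ℕ) : Fqt) = (m : Fqt) + 1 := by simp
  rw [h2, mul_left_comm, h1]
  by_cases h : m < a i
  · rw [if_pos h, if_pos (show ((m.succPNat : ℕ+) : ℕ) ≤ a i from h), C_1, one_mul,
      hProd_eq_prod (S := a.support) Finsupp.support_tsub, ← Finset.mul_prod_erase _ _ hi, mul_comm]
    congr 1
    · simp
    · refine Finset.prod_congr rfl fun j hj => ?_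
      have : i ≠ j := (Finset.ne_of_mem_erase hj).symm
      simp [this]
  · rw [if_neg h, if_neg (show ¬ ((m.succPNat : ℕ+) : ℕ) ≤ a i from h), mul_zero]

/-- The endomorphism `p_k ↦ (1 - q ^ k) / (1 - t ^ k) p_k` in the power sums. -/
noncomputable def primeP : MvPolynomial ℕ+ Fqt →ₐ[Fqt] MvPolynomial ℕ+ Fqt :=
  (psumEquiv Fqt).symm.toAlgHom.comp (prime.comp (psumEquiv Fqt).toAlgHom)

theorem psumEquiv_primeP (f : MvPolynomial ℕ+ Fqt) :
    psumEquiv Fqt (primeP f) = prime (psumEquiv Fqt f) :=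
  (psumEquiv Fqt).apply_symm_apply _

theorem primeP_X (k : ℕ+) :
    primeP (X k) = C ((1 - q ^ (k : ℕ)) / (1 - t ^ (k : ℕ))) * X k := by
  refine (psumEquiv Fqt).injective ?_
  rw [psumEquiv_primeP, psumEquiv_X, prime_psum, ← smul_eq_C_mul, map_smul, psumEquiv_X]

/-- After `p_k ↦ (1 - q ^ k) / (1 - t ^ k) p_k`, the scalar product `⟨ , ⟩_{q,t}` becomes the one
for which the monomials are dual to the products of complete symmetric functions. -/
theorem lcoeff_primeP (f : MvPolynomial ℕ+ Fqt) (a : ℕ →₀ ℕ) :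
    lcoeff a (primeP f) = form f (hProd Fqt a) := by
  classical
  induction f using MvPolynomial.induction_on generalizing a with
  | C c =>
    rw [← algebraMap_eq, AlgHom.commutes, algebraMap_eq, lcoeff_C, ← mul_one (C c),
      ← smul_eq_C_mul, map_smul, LinearMap.smul_apply, form_one, hProd, map_finsuppProd,
      smul_eq_mul, Finsupp.prod]
    simp only [constantCoeff_hn (y := fun j => X j.succPNat)
      (fun j => constantCoeff_X (R := Fqt) j.succPNat)]
    by_cases h : a = 0
    · subst h; simp
    · obtain ⟨i, hi⟩ := Finsupp.support_nonempty_iff.2 h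
      rw [if_neg h, Finset.prod_eq_zero hi, mul_zero]
      rw [if_neg (Finsupp.mem_support_iff.1 hi)]
  | add f g hf hg => rw [map_add, map_add, map_add, LinearMap.add_apply, hf, hg]
  | mul_X f k hf =>
    rw [map_mul, primeP_X, mul_comm f, form_X_mul, mul_left_comm, mul_comm (primeP f),
      ← smul_eq_C_mul, map_smul, lcoeff_X_mul, smul_eq_mul, mul_comm (((k : ℕ) : Fqt)), mul_assoc,
      ← form_C_mul, pderiv_hProd, map_sum]
    congr 1
    refine Finset.sum_congr rfl fun i _ => ?_
    split_ifs
    · exact hf _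
    · rw [map_zero]

theorem scale_primeP (c : Fqt) (f : MvPolynomial ℕ+ Fqt) :
    scale c (primeP f) = primeP (scale c f) := by
  have h : (scale c).comp primeP = primeP.comp (scale c) := by
    refine algHom_ext fun k => ?_
    rw [AlgHom.comp_apply, AlgHom.comp_apply, primeP_X, scale_X, map_mul, map_mul, primeP_X,
      scale_X, ← algebraMap_eq, AlgHom.commutes, AlgHom.commutes, mul_left_comm]
  exact AlgHom.congr_fun h f

theorem scale_macP {n : ℕ} (c : Fqt) (μ : n.Partition) :
    scale c (macP μ) = C (c ^ n) * macP μ := by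
  have h1 : ∀ f ∈ lower μ, scale c f = C (c ^ n) * f := by
    intro f hf
    induction hf using Submodule.span_induction with
    | mem f hf =>
      obtain ⟨ν, -, rfl⟩ := hf
      exact scale_mono c ν
    | zero => simp
    | add f g _ _ hf hg => rw [map_add, hf, hg, mul_add]
    | smul d f _ hf => rw [map_smul, hf, mul_smul_comm]
  have h2 := h1 _ (macP_sub_mem_lower μ)
  rw [map_sub, scale_mono, mul_sub] at h2
  exact sub_left_injective h2

theorem form_macP_hProd_of_degree_ne {n : ℕ} (μ : n.Partition) {a : ℕ →₀ ℕ} (ha : a.degree ≠ n) :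
    form (macP μ) (hProd Fqt a) = 0 := by
  have h1 := lcoeff_scale 2 a (primeP (macP μ))
  rw [scale_primeP, scale_macP, ← smul_eq_C_mul, map_smul, map_smul, smul_eq_mul,
    lcoeff_primeP] at h1
  refine (mul_eq_mul_right_iff.1 h1).resolve_left fun h => ha ?_
  refine (Nat.pow_right_injective le_rfl (?_ : 2 ^ n = 2 ^ a.degree)).symm
  exact_mod_cast h

end Duality

/-! ### Evaluation at the roots of unity -/

section RootsOfUnity

variable {L : Type*} [Field L]

/-- The evaluation of a symmetric function at the `l` points `1, z, …, z ^ (l - 1)`. -/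
noncomputable def evalRoots (z : L) (l : ℕ) : MvPolynomial ℕ+ L →ₐ[L] L :=
  (aeval fun i : Fin l => z ^ (i : ℕ)).comp (res l)

theorem evalRoots_X (z : L) (l : ℕ) (k : ℕ+) :
    evalRoots z l (X k) = ∑ i : Fin l, (z ^ (k : ℕ)) ^ (i : ℕ) := by
  rw [evalRoots, AlgHom.comp_apply, res, aeval_X, map_sum]
  refine Finset.sum_congr rfl fun i _ => ?_
  rw [map_pow, aeval_X, ← pow_mul, ← pow_mul, mul_comm]

theorem evalRoots_X_mul_eq_zero {z : L} {l : ℕ} (hz : z ^ l = 1) (k : ℕ+) :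
    (z ^ (k : ℕ) - 1) * evalRoots z l (X k) = 0 := by
  rw [evalRoots_X, Fin.sum_univ_eq_sum_range (fun i => (z ^ (k : ℕ)) ^ i), mul_comm, geom_sum_mul,
    ← pow_mul, mul_comm, pow_mul, hz, one_pow, sub_self]

theorem evalRoots_X_eq_ite {z : L} {l : ℕ} (hz : IsPrimitiveRoot z l) (k : ℕ+) :
    evalRoots z l (X k) = if l ∣ (k : ℕ) then (l : L) else 0 := by
  split_ifs with h
  · rw [evalRoots_X, (hz.pow_eq_one_iff_dvd _).2 h]
    simp
  · refine (mul_eq_zero.1 (evalRoots_X_mul_eq_zero hz.pow_eq_one k)).resolve_left fun h1 => h ?_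
    exact (hz.pow_eq_one_iff_dvd _).1 (sub_eq_zero.1 h1)

section

variable [Algebra ℚ L]

theorem evalRoots_hDiff {z : L} {l : ℕ} (hz : z ^ l = 1) (hz0 : z ≠ 0) {m : ℕ} (hm : m ≠ 0) :
    evalRoots z l (hDiff z⁻¹ m) = 0 := by
  refine (map_hn (evalRoots z l).toRingHom _ m).trans ?_
  have h : (fun j : ℕ => (evalRoots z l).toRingHom (C (1 - z⁻¹ ^ (j + 1)) * X j.succPNat)) =
      fun _ => (0 : L) := by
    funext j
    change evalRoots z l _ = 0
    rw [map_mul, ← algebraMap_eq, AlgHom.commutes]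
    have h1 := evalRoots_X_mul_eq_zero hz j.succPNat
    have h2 : z ^ (j + 1) * z⁻¹ ^ (j + 1) = 1 := by
      rw [← mul_pow, mul_inv_cancel₀ hz0, one_pow]
    rw [Nat.succPNat_coe, Nat.succ_eq_add_one] at h1
    change (1 - z⁻¹ ^ (j + 1)) * _ = 0
    linear_combination z⁻¹ ^ (j + 1) * h1 - (evalRoots z l (X j.succPNat)) * h2
  rw [h]
  obtain ⟨m, rfl⟩ := Nat.exists_eq_succ_of_ne_zero hm
  simp [hn_succ]

/-- At `t = z`, the evaluation at the powers of `z` is invariant under the Macdonald operator. -/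
theorem evalRoots_opE {z : L} {l : ℕ} (hz : z ^ l = 1) (hz0 : z ≠ 0) (Q : L)
    (f : MvPolynomial ℕ+ L) : evalRoots z l (opE Q z⁻¹ f) = evalRoots z l f := by
  rw [opE_eq_sum Q z⁻¹ f (Nat.lt_succ_self _), map_sum,
    Finset.sum_eq_single_of_mem 0 (Finset.mem_range.2 (Nat.succ_pos _)), coeff_zero_shift, hDiff,
    hn_zero, one_mul]
  intro m _ hm
  rw [map_mul, evalRoots_hDiff hz hz0 hm, zero_mul]

theorem evalRoots_hn {z : L} {l : ℕ} (hz : IsPrimitiveRoot z l) (m : ℕ) :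
    evalRoots z l (hn (fun j => X j.succPNat) m) = if l ∣ m then 1 else 0 := by
  refine (map_hn (evalRoots z l).toRingHom _ m).trans ?_
  refine (congrFun (hn_unique (b := fun m => if l ∣ m then (1 : L) else 0) (by simp) ?_) m).symm
  intro m
  have h1 : ∀ j : ℕ, (evalRoots z l).toRingHom (X j.succPNat) =
      if l ∣ j + 1 then (l : L) else 0 := fun j => evalRoots_X_eq_ite hz j.succPNat
  simp only [h1]
  by_cases h : l ∣ m + 1
  · have h2 : ∀ j ∈ Finset.range (m + 1), ((if l ∣ j + 1 then (l : L) else 0) *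
        if l ∣ m - j then 1 else 0) = if l ∣ j + 1 then (l : L) else 0 := by
      intro j hj
      have hj := Finset.mem_range.1 hj
      by_cases h3 : l ∣ j + 1
      · rw [if_pos h3, if_pos, mul_one]
        have : m - j = m + 1 - (j + 1) := by omega
        rw [this]
        exact Nat.dvd_sub h h3
      · rw [if_neg h3, zero_mul]
    rw [Finset.sum_congr rfl h2, if_pos h, mul_one, ← Finset.sum_filter, Finset.sum_const,
      nsmul_eq_mul]
    have h4 : ((Finset.range (m + 1)).filter fun j => l ∣ j + 1).card = (m + 1) / l :=
      (Nat.card_multiples (m + 1) l)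
    rw [h4, ← Nat.cast_mul, Nat.div_mul_cancel h]
    push_cast
    rfl
  · rw [if_neg h, mul_zero]
    refine (Finset.sum_eq_zero fun j hj => ?_).symm
    have hj := Finset.mem_range.1 hj
    by_cases h3 : l ∣ j + 1
    · rw [if_neg (c := l ∣ m - j), mul_zero]
      intro h4
      refine h ?_
      have : m + 1 = (j + 1) + (m - j) := by omega
      rw [this]
      exact dvd_add h3 h4
    · rw [if_neg h3, zero_mul]

open Classical in
theorem evalRoots_hProd {z : L} {l : ℕ} (hz : IsPrimitiveRoot z l) (a : ℕ →₀ ℕ) :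
    evalRoots z l (hProd L a) = if ∀ i, l ∣ a i then 1 else 0 := by
  rw [hProd, map_finsuppProd, Finsupp.prod, Finset.prod_congr rfl fun i _ => evalRoots_hn hz _]
  split_ifs with h
  · exact Finset.prod_eq_one fun i _ => if_pos (h i)
  · push Not at h
    obtain ⟨i, hi⟩ := h
    refine Finset.prod_eq_zero (i := i) ?_ (if_neg hi)
    rw [Finsupp.mem_support_iff]
    rintro h0
    rw [h0] at hi
    exact hi (dvd_zero l)

theorem evalRoots_mono_eq_zero (z : L) {n l : ℕ} {μ : n.Partition} (h : l < μ.parts.card) :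
    evalRoots z l (mono L μ) = 0 := by
  rw [evalRoots, AlgHom.comp_apply, res_mono_eq_zero h, map_zero]

end

theorem prod_pow_of_isPrimitiveRoot {z : L} {l : ℕ} (hl : l ≠ 0) (hz : IsPrimitiveRoot z l) :
    ∏ i : Fin l, z ^ (i : ℕ) = (-1) ^ (l - 1) := by
  rw [Fin.prod_univ_eq_prod_range (fun i => z ^ i), Finset.prod_pow_eq_pow_sum,
    Finset.sum_range_id]
  rcases Nat.even_or_odd l with ⟨m, rfl⟩ | ⟨m, rfl⟩
  · have h1 : (m + m) * (m + m - 1) / 2 = m * (m + m - 1) := by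
      rw [← two_mul, mul_assoc, Nat.mul_div_cancel_left _ two_pos]
    have h2 : z ^ m = -1 := by
      have h3 : (z ^ m - 1) * (z ^ m + 1) = 0 := by
        have := hz.pow_eq_one
        rw [pow_add] at this
        linear_combination this
      refine eq_neg_of_add_eq_zero_left ((mul_eq_zero.1 h3).resolve_left fun h => ?_)
      have := Nat.le_of_dvd (by omega) ((hz.pow_eq_one_iff_dvd _).1 (sub_eq_zero.1 h))
      omega
    rw [h1, pow_mul, h2]
  · have h1 : (2 * m + 1) * (2 * m + 1 - 1) / 2 = (2 * m + 1) * m := by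
      rw [Nat.add_sub_cancel, mul_left_comm, Nat.mul_div_cancel_left _ two_pos]
    rw [h1, pow_mul, hz.pow_eq_one, one_pow, Nat.add_sub_cancel, pow_mul]
    simp

theorem part_rect (r l : ℕ+) (i : Fin l) : part l (rect r l) i = r := by
  have h : (rect r l).parts.sort (· ≥ ·) = List.replicate l (r : ℕ) := by
    refine List.eq_replicate_iff.2 ⟨?_, fun b hb => ?_⟩
    · rw [Multiset.length_sort]
      simp [rect]
    · exact Multiset.eq_of_mem_replicate ((Multiset.mem_sort _).1 hb)
  rw [part_apply, h, List.getD_eq_getElem _ _ (by simp)]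
  simp

theorem card_rect (r l : ℕ+) : (rect r l).parts.card = l := by simp [rect]

theorem degree_extend {N : ℕ} (b : Fin N →₀ ℕ) : (extend b).degree = ∑ i, b i := by
  rw [← expType_sum, expType_extend]
  exact Finset.sum_subset (Finset.subset_univ _) (by simp)

theorem eq_rect_of_part_eq {r l : ℕ+} {μ : ((l : ℕ) * (r : ℕ)).Partition} (hμ : μ.parts.card ≤ l)
    {M : ℕ} (h : ∀ i : Fin l, part l μ i = M) : μ = rect r l := by
  have h1 := expType_extend_part μ hμ
  have h2 := degree_extend (part l μ)
  rw [← expType_sum, h1, μ.parts_sum, Finset.sum_congr rfl fun i _ => h i] at h2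
  have hM : M = r := by
    simp only [Finset.sum_const, Finset.card_univ, Fintype.card_fin, smul_eq_mul] at h2
    exact (Nat.eq_of_mul_eq_mul_left l.pos h2).symm
  have h3 : part l μ = part l (rect r l) := by
    ext i
    rw [h, part_rect, hM]
  refine Nat.Partition.ext ?_
  rw [← h1, h3, expType_extend_part _ (card_rect r l).le]

theorem evalRoots_mono_rect [Algebra ℚ L] {z : L} {r l : ℕ+} (hz : IsPrimitiveRoot z (l : ℕ)) :
    evalRoots z l (mono L (rect r l)) = (-1) ^ (((l : ℕ) - 1) * (r : ℕ)) := by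
  classical
  have h : res l (mono L (rect r l)) = monomial (part l (rect r l)) 1 := by
    ext b
    rw [coeff_res, lcoeff_mono, coeff_monomial]
    by_cases hb : expType (extend b) = (rect r l).parts
    · rw [if_pos hb, if_pos]
      have h1 : b.support = Finset.univ := by
        refine Finset.eq_univ_of_card _ ?_
        have h2 := card_rect r l
        rw [← hb, expType_extend, Multiset.card_map] at h2
        rw [Fintype.card_fin]
        exact h2
      ext i
      rw [part_rect]
      have h2 : b i ∈ expType (extend b) := by
        rw [expType_extend, h1]
        exact Multiset.mem_map_of_mem b (Finset.mem_univ i)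
      rw [hb] at h2
      exact (Multiset.eq_of_mem_replicate h2).symm
    · rw [if_neg hb, if_neg]
      rintro rfl
      exact hb (expType_extend_part _ (card_rect r l).le)
  rw [evalRoots, AlgHom.comp_apply, h, aeval_monomial, map_one, one_mul,
    Finsupp.prod_fintype _ _ (by simp)]
  simp only [part_rect]
  rw [Finset.prod_pow, prod_pow_of_isPrimitiveRoot l.ne_zero hz, pow_mul]

/-! ### The eigenvalues -/

theorem map_eig {K L : Type*} [CommRing K] [CommRing L] (φ : K →+* L) (q s : K) {N : ℕ}
    (p : Fin N →₀ ℕ) : φ (eig q s p) = eig (φ q) (φ s) p := by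
  simp [eig]

theorem sum_part_eq {K : Type*} [CommRing K] {n : ℕ} (Q s : K) (μ : n.Partition) {N : ℕ}
    (h : μ.parts.card ≤ N) (hN : N ≤ n) :
    ∑ i : Fin n, s ^ (i : ℕ) * (Q ^ part n μ i - 1) =
      ∑ i : Fin N, s ^ (i : ℕ) * (Q ^ part N μ i - 1) := by
  simp only [part_apply]
  rw [Fin.sum_univ_eq_sum_range
      (fun i => s ^ i * (Q ^ (μ.parts.sort (· ≥ ·)).getD i 0 - 1)),
    Fin.sum_univ_eq_sum_range (fun i => s ^ i * (Q ^ (μ.parts.sort (· ≥ ·)).getD i 0 - 1))]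
  refine (Finset.sum_subset (Finset.range_mono hN) fun i _ hi => ?_).symm
  rw [List.getD_eq_default, pow_zero, sub_self, mul_zero]
  rw [Multiset.length_sort]
  rw [Finset.mem_range] at hi
  omega

theorem part_pos {n : ℕ} {μ : n.Partition} {N : ℕ} (h : N ≤ μ.parts.card) (i : Fin N) :
    0 < part N μ i := by
  have hi : (i : ℕ) < (μ.parts.sort (· ≥ ·)).length := by
    rw [Multiset.length_sort]
    omega
  rw [part_apply, List.getD_eq_getElem _ _ hi]
  exact μ.parts_pos ((Multiset.mem_sort _).1 (List.getElem_mem hi))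

theorem one_sub_mul_geom {K : Type*} [CommRing K] (s : K) (N : ℕ) :
    (1 - s) * ∑ i : Fin N, s ^ (i : ℕ) = 1 - s ^ N := by
  rw [Fin.sum_univ_eq_sum_range (fun i => s ^ i), mul_neg_geom_sum]

/-- At `q = 0` the eigenvalue only depends on the length of the partition. -/
theorem eig_zero {K : Type*} [CommRing K] {n : ℕ} (s : K) (μ : n.Partition) :
    eig 0 s (part n μ) = s ^ μ.parts.card := by
  rw [eig, sum_part_eq 0 s μ le_rfl (card_parts_le μ)]
  simp only [zero_pow (part_pos le_rfl _).ne']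
  rw [Finset.sum_congr rfl fun i _ => mul_sub_one _ _]
  simp only [mul_zero, zero_sub, Finset.sum_neg_distrib, mul_neg]
  rw [one_sub_mul_geom]
  ring

/-- The eigenvalue for `t = x`, multiplied by `x ^ N` to make it a polynomial in `x`. -/
theorem pow_mul_eig {K : Type*} [Field K] {N : ℕ} {x : K} (hx : x ≠ 0) (Q : K) (p : Fin N →₀ ℕ) :
    x ^ N * eig Q x⁻¹ p =
      x ^ N + (x - 1) * ∑ i : Fin N, x ^ (N - 1 - (i : ℕ)) * (Q ^ p i - 1) := by
  rw [eig, mul_add, mul_one, ← mul_assoc, Finset.mul_sum, Finset.mul_sum]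
  congr 1
  refine Finset.sum_congr rfl fun i _ => ?_
  rw [← mul_assoc, ← mul_assoc]
  congr 1
  obtain ⟨m, hm⟩ : ∃ m, N = m + 1 + i := ⟨N - 1 - i, by omega⟩
  have h1 : N - 1 - (i : ℕ) = m := by omega
  have h2 : x ^ N = x ^ m * x * x ^ (i : ℕ) := by
    conv_lhs => rw [hm]
    ring
  rw [h1, h2, inv_pow]
  field_simp

/-- The eigenvalues of the Macdonald operator determine the lengths of the partitions. -/
theorem card_eq_of_eig_eq {n : ℕ} {μ ν : n.Partition}
    (h : eig q t⁻¹ (part n μ) = eig q t⁻¹ (part n ν)) : μ.parts.card = ν.parts.card := by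
  let u : n.Partition → MvPolynomial (Fin 2) ℚ := fun μ =>
    X 1 ^ n + (X 1 - 1) * ∑ i : Fin n, X 1 ^ (n - 1 - (i : ℕ)) * (X 0 ^ part n μ i - 1)
  have h1 : ∀ μ, algebraMap (MvPolynomial (Fin 2) ℚ) Fqt (u μ) =
      t ^ n * eig q t⁻¹ (part n μ) := by
    intro μ
    rw [pow_mul_eig t_ne_zero]
    simp only [u, map_add, map_mul, map_sub, map_pow, map_one, map_sum]
    rfl
  have h2 : ∀ μ, eval ![0, 2] (u μ) = 2 ^ n * (2⁻¹ : ℚ) ^ μ.parts.card := by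
    intro μ
    rw [← eig_zero, pow_mul_eig two_ne_zero]
    simp [u]
  -- the eigenvalues, multiplied by `t ^ n`, are compared at `q = 0` and `t = 2`
  have h3 : u μ = u ν := by
    refine IsFractionRing.injective (MvPolynomial (Fin 2) ℚ) Fqt ?_
    rw [h1, h1, h]
  have h4 := h2 μ
  rw [h3, h2] at h4
  have h5 := mul_left_cancel₀ (pow_ne_zero n two_ne_zero) h4
  exact (pow_right_injective₀ (by norm_num) (by norm_num) h5).symm

theorem eig_rect {z : L} {r l : ℕ+} (hz : z ^ (l : ℕ) = 1) (Q : L) :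
    eig Q z⁻¹ (part (l * r) (rect r l)) = 1 := by
  rw [eig, sum_part_eq Q z⁻¹ (rect r l) (card_rect r l).le (Nat.le_mul_of_pos_right _ r.pos)]
  simp only [part_rect]
  rw [← Finset.sum_mul, ← mul_assoc, one_sub_mul_geom, inv_pow, hz, inv_one, sub_self, zero_mul,
    add_zero]

/-- At `t = ζ`, no partition with at most `l` parts other than `(r ^ l)` has the same eigenvalue
as `(r ^ l)`. -/
theorem eig_ne_one {ζ : ℂ} {r l : ℕ+} (hζ : IsPrimitiveRoot ζ (l : ℕ))
    {μ : ((l : ℕ) * (r : ℕ)).Partition} (hμ : μ.parts.card ≤ l) (hne : μ ≠ rect r l) :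
    eig RatFunc.X (RatFunc.C ζ)⁻¹ (part (l * r) μ) ≠ 1 := by
  intro h
  set s := ζ⁻¹ with hs
  have hs' : IsPrimitiveRoot s (l : ℕ) := hζ.inv
  rw [eig, sum_part_eq _ _ μ hμ (Nat.le_mul_of_pos_right _ r.pos), add_eq_left] at h
  simp only [mul_sub, mul_one, Finset.sum_sub_distrib] at h
  rw [one_sub_mul_geom, ← map_inv₀, ← hs, ← map_pow, hs'.pow_eq_one, map_one, sub_self,
    sub_zero] at h
  -- the coefficients of the corresponding polynomial in `q`
  have h1 : (Polynomial.C (1 - s)) * ∑ i : Fin l, Polynomial.C (s ^ (i : ℕ)) *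
      (Polynomial.X : Polynomial ℂ) ^ part l μ i = 0 := by
    refine RatFunc.algebraMap_injective ℂ ?_
    rw [map_zero, ← h]
    simp [RatFunc.algebraMap_C, RatFunc.algebraMap_X]
  have h0 : 0 < (l : ℕ) := l.pos
  -- the equal parts `μ_0 = ⋯ = μ_{k-1}` contribute `1 + s + ⋯ + s ^ (k - 1) ≠ 0`
  have hex : ∃ k : ℕ, ∃ hk : k < l, part l μ ⟨k, hk⟩ ≠ part l μ ⟨0, h0⟩ := by
    by_contra hall
    push Not at hall
    exact hne (eq_rect_of_part_eq hμ (M := part l μ ⟨0, h0⟩) fun i => hall i i.2)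
  classical
  obtain ⟨k, ⟨hkl, hk1⟩, hk2⟩ : ∃ k : ℕ, (∃ hk : k < l, part l μ ⟨k, hk⟩ ≠ part l μ ⟨0, h0⟩) ∧
      ∀ m < k, ¬ ∃ hm : m < l, part l μ ⟨m, hm⟩ ≠ part l μ ⟨0, h0⟩ :=
    ⟨Nat.find hex, Nat.find_spec hex, fun _ hm => Nat.find_min hex hm⟩
  have hmin : ∀ i : Fin l, part l μ i = part l μ ⟨0, h0⟩ ↔ (i : ℕ) < k := by
    intro i
    constructor
    · intro hi
      by_contra hik
      have h2 : part l μ i ≤ part l μ ⟨k, hkl⟩ := antitone_part l μ (not_lt.1 hik)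
      have h3 : part l μ ⟨k, hkl⟩ ≤ part l μ ⟨0, h0⟩ := antitone_part l μ (Nat.zero_le k)
      exact hk1 (le_antisymm h3 (hi ▸ h2))
    · intro hik
      have := hk2 i hik
      push Not at this
      exact this i.2
  have h2 := congrArg (Polynomial.coeff · (part l μ ⟨0, h0⟩)) h1
  simp only [Polynomial.coeff_C_mul, Polynomial.finsetSum_coeff, Polynomial.coeff_X_pow,
    Polynomial.coeff_zero, mul_ite, mul_one, mul_zero] at h2
  have h3 : ∀ i : Fin l, (if part l μ ⟨0, h0⟩ = part l μ i then s ^ (i : ℕ) else 0) =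
      if (i : ℕ) < k then s ^ (i : ℕ) else 0 := by
    intro i
    have := hmin i
    by_cases h4 : (i : ℕ) < k
    · rw [if_pos h4, if_pos (this.2 h4).symm]
    · rw [if_neg h4, if_neg fun h => h4 (this.1 h.symm)]
  simp only [h3] at h2
  rw [Fin.sum_univ_eq_sum_range (fun i => if i < k then s ^ i else 0), ← Finset.sum_filter] at h2
  have h4 : (Finset.range l).filter (· < k) = Finset.range k := by
    ext i
    simp only [Finset.mem_filter, Finset.mem_range]
    omega
  rw [h4, mul_neg_geom_sum] at h2
  have h5 := Nat.le_of_dvd ?_ ((hs'.pow_eq_one_iff_dvd k).1 (sub_eq_zero.1 h2).symm)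
  · omega
  · refine Nat.pos_of_ne_zero fun h6 => ?_
    exact hk1 (by congr 2)

end RootsOfUnity

/-! ### The ring of rational functions without pole along `t = ζ` -/

section Values

variable {ζ : ℂ}

theorem algebraMap_ne_zero_of_evalT {v : MvPolynomial (Fin 2) ℚ} (hv : evalT ζ v ≠ 0) :
    algebraMap (MvPolynomial (Fin 2) ℚ) Fqt v ≠ 0 := by
  intro h
  rw [IsFractionRing.injective (MvPolynomial (Fin 2) ℚ) Fqt (h.trans (map_zero _).symm),
    map_zero] at hv
  exact hv rfl

theorem isValueAt_algebraMap (u : MvPolynomial (Fin 2) ℚ) :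
    IsValueAt ζ (algebraMap (MvPolynomial (Fin 2) ℚ) Fqt u) (evalT ζ u) :=
  ⟨u, 1, by simp, by simp, by simp⟩

namespace IsValueAt

variable {a a' : Fqt} {b b' : RatFunc ℂ}

theorem add (h : IsValueAt ζ a b) (h' : IsValueAt ζ a' b') : IsValueAt ζ (a + a') (b + b') := by
  obtain ⟨u, v, hv, rfl, rfl⟩ := h
  obtain ⟨u', v', hv', rfl, rfl⟩ := h'
  refine ⟨u * v' + v * u', v * v', ?_, ?_, ?_⟩
  · rw [map_mul]
    exact mul_ne_zero hv hv'
  · rw [div_add_div _ _ (algebraMap_ne_zero_of_evalT hv) (algebraMap_ne_zero_of_evalT hv')]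
    simp only [map_add, map_mul]
  · rw [div_add_div _ _ hv hv']
    simp only [map_add, map_mul]

theorem mul (h : IsValueAt ζ a b) (h' : IsValueAt ζ a' b') : IsValueAt ζ (a * a') (b * b') := by
  obtain ⟨u, v, hv, rfl, rfl⟩ := h
  obtain ⟨u', v', hv', rfl, rfl⟩ := h'
  refine ⟨u * u', v * v', ?_, ?_, ?_⟩
  · rw [map_mul]
    exact mul_ne_zero hv hv'
  · rw [div_mul_div_comm, map_mul, map_mul]
  · rw [div_mul_div_comm, map_mul, map_mul]

theorem inv (h : IsValueAt ζ a b) (hb : b ≠ 0) : IsValueAt ζ a⁻¹ b⁻¹ := by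
  obtain ⟨u, v, hv, rfl, rfl⟩ := h
  exact ⟨v, u, (div_ne_zero_iff.1 hb).1, inv_div _ _, inv_div _ _⟩

end IsValueAt

theorem isValueAt_algebraMap_rat (x : ℚ) :
    IsValueAt ζ (algebraMap ℚ Fqt x) (algebraMap ℚ (RatFunc ℂ) x) := by
  have h := isValueAt_algebraMap (ζ := ζ) (C x)
  rw [← algebraMap_eq, AlgHom.commutes] at h
  convert h using 1
  exact DFunLike.congr_fun (Subsingleton.elim (algebraMap ℚ Fqt)
    ((algebraMap (MvPolynomial (Fin 2) ℚ) Fqt).comp (algebraMap ℚ _))) x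

variable (ζ) in
/-- The pairs of a rational function without pole along `t = ζ` and its value there. -/
noncomputable def valueRing : Subalgebra ℚ (Fqt × RatFunc ℂ) where
  carrier := {p | IsValueAt ζ p.1 p.2}
  mul_mem' := IsValueAt.mul
  add_mem' := IsValueAt.add
  algebraMap_mem' := isValueAt_algebraMap_rat

theorem isValueAt_zero : IsValueAt ζ 0 0 := (valueRing ζ).zero_mem

theorem isValueAt_one : IsValueAt ζ 1 1 := (valueRing ζ).one_mem

theorem IsValueAt.sub {a a' : Fqt} {b b' : RatFunc ℂ} (h : IsValueAt ζ a b)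
    (h' : IsValueAt ζ a' b') : IsValueAt ζ (a - a') (b - b') :=
  (valueRing ζ).sub_mem (x := (a, b)) (y := (a', b')) h h'

theorem IsValueAt.sum {ι : Type*} {T : Finset ι} {a : ι → Fqt} {b : ι → RatFunc ℂ}
    (h : ∀ i ∈ T, IsValueAt ζ (a i) (b i)) : IsValueAt ζ (∑ i ∈ T, a i) (∑ i ∈ T, b i) := by
  have h1 : ∑ i ∈ T, (a i, b i) ∈ valueRing ζ := (valueRing ζ).sum_mem h
  have h2 : IsValueAt ζ (∑ i ∈ T, (a i, b i)).1 (∑ i ∈ T, (a i, b i)).2 := h1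
  rwa [Prod.fst_sum, Prod.snd_sum] at h2

theorem isValueAt_q : IsValueAt ζ q RatFunc.X := by
  have h := isValueAt_algebraMap (ζ := ζ) (X 0)
  have h1 : evalT ζ (X 0) = RatFunc.X := by simp [evalT]
  rwa [h1] at h

theorem isValueAt_t_inv (hζ : ζ ≠ 0) : IsValueAt ζ t⁻¹ (RatFunc.C ζ)⁻¹ := by
  have h := isValueAt_algebraMap (ζ := ζ) (X 1)
  have h1 : evalT ζ (X 1) = RatFunc.C ζ := by simp [evalT]
  rw [h1] at h
  exact h.inv ((map_ne_zero _).2 hζ)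

/-- The matrix of the Macdonald operator may be formed over the ring of pairs `(a, b)` with
`a(q, ζ) = b`, which shows that it can be specialized entrywise. -/
theorem isValueAt_opCoeff (hζ : ζ ≠ 0) {n : ℕ} (μ ν : n.Partition) :
    IsValueAt ζ (opCoeff q t⁻¹ μ ν) (opCoeff RatFunc.X (RatFunc.C ζ)⁻¹ μ ν) := by
  let x : valueRing ζ := ⟨(q, RatFunc.X), isValueAt_q⟩
  let y : valueRing ζ := ⟨(t⁻¹, (RatFunc.C ζ)⁻¹), isValueAt_t_inv hζ⟩
  have h := (opCoeff x y μ ν).2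
  have h1 := map_opCoeff ((RingHom.fst _ _).comp (valueRing ζ).val.toRingHom) x y μ ν
  have h2 := map_opCoeff ((RingHom.snd _ _).comp (valueRing ζ).val.toRingHom) x y μ ν
  exact h1 ▸ h2 ▸ h

theorem isValueAt_eig (hζ : ζ ≠ 0) {N : ℕ} (p : Fin N →₀ ℕ) :
    IsValueAt ζ (eig q t⁻¹ p) (eig RatFunc.X (RatFunc.C ζ)⁻¹ p) := by
  let x : valueRing ζ := ⟨(q, RatFunc.X), isValueAt_q⟩
  let y : valueRing ζ := ⟨(t⁻¹, (RatFunc.C ζ)⁻¹), isValueAt_t_inv hζ⟩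
  have h := (eig x y p).2
  have h1 := map_eig ((RingHom.fst _ _).comp (valueRing ζ).val.toRingHom) x y p
  have h2 := map_eig ((RingHom.snd _ _).comp (valueRing ζ).val.toRingHom) x y p
  exact h1 ▸ h2 ▸ h

end Values

/-! ### The functional `⟨Q_κ, ·⟩` -/

section Functional

variable {n : ℕ}

/-- The linear functional `f ↦ ⟨Q_κ, f⟩`. -/
noncomputable def pairQ (κ : n.Partition) : MvPolynomial ℕ+ Fqt →ₗ[Fqt] Fqt :=
  (form (macP κ) (macP κ))⁻¹ • form (macP κ)

theorem pairQ_apply (κ : n.Partition) (f : MvPolynomial ℕ+ Fqt) :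
    pairQ κ f = (form (macP κ) (macP κ))⁻¹ * form (macP κ) f := rfl

theorem pairQ_opE (κ : n.Partition) (f : MvPolynomial ℕ+ Fqt) :
    pairQ κ (opE q t⁻¹ f) = eig q t⁻¹ (part n κ) * pairQ κ f := by
  rw [pairQ_apply, pairQ_apply, ← form_opE, opE_macP, map_smul, LinearMap.smul_apply, smul_eq_mul,
    mul_left_comm]

theorem pairQ_mono_self (κ : n.Partition) : pairQ κ (mono Fqt κ) = 1 := by
  have h := form_macP_lower (macP_sub_mem_lower κ)
  rw [map_sub, sub_eq_zero] at h
  rw [pairQ_apply, ← h, inv_mul_cancel₀ (form_macP_self_ne_zero κ)]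

/-- An eigenfunctional of the Macdonald operator is determined by a linear recursion on the monomial
symmetric functions. -/
theorem eigenfunctional_recursion {F : Type*} [Field F] [CharZero F] [Algebra ℚ F] {Q s e : F}
    (hs : s ≠ 0) {φ : MvPolynomial ℕ+ F →ₗ[F] F} (hφ : ∀ f, φ (opE Q s f) = e * φ f)
    (μ : n.Partition) [DecidableEq n.Partition] :
    (e - eig Q s (part n μ)) * φ (mono F μ) =
      ∑ ν ∈ Finset.univ.erase μ, opCoeff Q s μ ν * φ (mono F ν) := by
  have h := hφ (mono F μ)
  rw [opE_mono, map_sum] at h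
  simp only [← smul_eq_C_mul, map_smul, smul_eq_mul] at h
  rw [← Finset.add_sum_erase _ _ (Finset.mem_univ μ), (opCoeff_triangular hs μ).2] at h
  rw [sub_mul, ← h, add_sub_cancel_left]

/-- The function `Q_κ` is orthogonal to the `m_μ` for which `μ` is longer than `κ`. -/
theorem pairQ_mono_eq_zero {κ μ : n.Partition} (h : κ.parts.card < μ.parts.card) :
    pairQ κ (mono Fqt μ) = 0 := by
  classical
  induction μ using LexLT.wellFounded.induction with
  | _ μ ih =>
    have hs := inv_ne_zero t_ne_zero
    have h1 := eigenfunctional_recursion hs (pairQ_opE κ) μ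
    rw [Finset.sum_eq_zero] at h1
    · refine (mul_eq_zero.1 h1).resolve_left fun h2 => h.ne ?_
      exact card_eq_of_eig_eq (sub_eq_zero.1 h2)
    · intro ν hν
      rcases LexLT.trichotomy ν μ with h2 | h2 | h2
      · by_cases h3 : opCoeff q t⁻¹ μ ν = 0
        · rw [h3, zero_mul]
        · rw [ih ν h2 (h.trans_le (card_le_of_opCoeff_ne_zero h3)), mul_zero]
      · exact absurd h2 (Finset.ne_of_mem_erase hν)
      · rw [(opCoeff_triangular hs μ).1 ν h2, zero_mul]

/-- The coefficients of `Q'_κ` are the values of `⟨Q_κ, ·⟩` at products of complete symmetric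
functions. -/
theorem coeff_macdonaldQ' (κ : n.Partition) (a : ℕ →₀ ℕ) :
    MvPowerSeries.coeff a (macdonaldQ' κ : MvPowerSeries ℕ Fqt) = pairQ κ (hProd Fqt a) := by
  have h : macdonaldQ' κ = psumEquiv Fqt
      ((form (macP κ) (macP κ))⁻¹ • primeP (macP κ)) := by
    rw [map_smul, psumEquiv_primeP, macdonaldQ', macdonaldQ, map_smul]
    simp only [form_apply, macP, AlgEquiv.apply_symm_apply]
  rw [h, lcoeff_psumEquiv, map_smul, lcoeff_primeP]
  rfl

end Functional

/-! ### Specialization at `t = ζ` -/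

section Rectangle

variable {ζ : ℂ} {r l : ℕ+}

/-- At `t = ζ` the functional `⟨Q_(r^l), ·⟩` becomes a multiple of the evaluation at the `l`-th
roots of unity: both satisfy the same recursion on the `m_μ`. -/
theorem isValueAt_pairQ_mono (hζ : IsPrimitiveRoot ζ (l : ℕ))
    (μ : ((l : ℕ) * (r : ℕ)).Partition) :
    IsValueAt ζ (pairQ (rect r l) (mono Fqt μ))
      ((-1) ^ (((l : ℕ) - 1) * (r : ℕ)) *
        evalRoots (RatFunc.C ζ) l (mono (RatFunc ℂ) μ)) := by
  classical
  have hζ0 : ζ ≠ 0 := hζ.ne_zero l.ne_zero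
  have hz : IsPrimitiveRoot (RatFunc.C ζ) (l : ℕ) := hζ.map_of_injective RatFunc.C_injective
  have hz0 : RatFunc.C ζ ≠ 0 := hz.ne_zero l.ne_zero
  induction μ using LexLT.wellFounded.induction with
  | _ μ ih =>
    by_cases hμ : μ = rect r l
    · rw [hμ, pairQ_mono_self, evalRoots_mono_rect hz, ← mul_pow]
      simpa using isValueAt_one
    -- the eigenvalue of such a `μ` may be `1` at `t = ζ`, so that the recursion is of no use
    by_cases hcard : (l : ℕ) < μ.parts.card
    · rw [evalRoots_mono_eq_zero _ hcard, mul_zero,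
        pairQ_mono_eq_zero (by rwa [card_rect])]
      exact isValueAt_zero
    have hs := inv_ne_zero t_ne_zero
    have hs' := inv_ne_zero hz0
    have h1 := eigenfunctional_recursion hs (pairQ_opE (rect r l)) μ
    have h2 := eigenfunctional_recursion (Q := RatFunc.X) (e := 1) hs'
      (φ := ((-1 : RatFunc ℂ) ^ (((l : ℕ) - 1) * (r : ℕ))) •
        (evalRoots (RatFunc.C ζ) (l : ℕ)).toLinearMap)
      (fun f => by
        rw [one_mul]
        exact congrArg (_ * ·) (evalRoots_opE hz.pow_eq_one hz0 _ f)) μ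
    have he : IsValueAt ζ (eig q t⁻¹ (part (l * r) (rect r l))) 1 := by
      rw [← eig_rect hz.pow_eq_one RatFunc.X]
      exact isValueAt_eig hζ0 _
    have hd := he.sub (isValueAt_eig hζ0 (part (l * r) μ))
    have hne : 1 - eig RatFunc.X (RatFunc.C ζ)⁻¹ (part (l * r) μ) ≠ 0 :=
      sub_ne_zero.2 (eig_ne_one hζ (not_lt.1 hcard) hμ).symm
    have hne' : eig q t⁻¹ (part (l * r) (rect r l)) - eig q t⁻¹ (part (l * r) μ) ≠ 0 := by
      intro h0
      rw [h0] at hd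
      exact hne (hd.unique isValueAt_zero)
    change _ * ((-1 : RatFunc ℂ) ^ (((l : ℕ) - 1) * (r : ℕ)) *
      evalRoots (RatFunc.C ζ) l (mono (RatFunc ℂ) μ)) = _ at h2
    rw [(eq_inv_mul_iff_mul_eq₀ hne').2 h1, (eq_inv_mul_iff_mul_eq₀ hne).2 h2]
    refine (hd.inv hne).mul (IsValueAt.sum fun ν hν => ?_)
    rcases LexLT.trichotomy ν μ with h3 | h3 | h3
    · exact (isValueAt_opCoeff hζ0 μ ν).mul (ih ν h3)
    · exact absurd h3 (Finset.ne_of_mem_erase hν)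
    · rw [(opCoeff_triangular hs μ).1 ν h3, (opCoeff_triangular hs' μ).1 ν h3, zero_mul, zero_mul]
      exact isValueAt_zero

open Classical in
theorem isValueAt_pairQ_hProd (hζ : IsPrimitiveRoot ζ (l : ℕ)) {a : ℕ →₀ ℕ}
    (ha : a.degree = (l : ℕ) * (r : ℕ)) :
    IsValueAt ζ (pairQ (rect r l) (hProd Fqt a))
      ((-1) ^ (((l : ℕ) - 1) * (r : ℕ)) * if ∀ i, (l : ℕ) ∣ a i then 1 else 0) := by
  have hz : IsPrimitiveRoot (RatFunc.C ζ) (l : ℕ) := hζ.map_of_injective RatFunc.C_injective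
  -- `∏ h_{a_i}` is a combination of the `m_μ` with rational coefficients
  have h : ∀ (F : Type) [Field F] [CharZero F] [Algebra ℚ F], hProd F a =
      ∑ μ : ((l : ℕ) * (r : ℕ)).Partition,
        C (algebraMap ℚ F (lcoeff (expo μ) (hProd ℚ a))) * mono F μ := by
    intro F _ _ _
    refine (eq_sum_mono (n := (l : ℕ) * (r : ℕ)) (by rw [scale_hProd, ha])).trans ?_
    refine Finset.sum_congr rfl fun μ _ => ?_
    rw [← lcoeff_map (algebraMap ℚ F), map_hProd]
  rw [← evalRoots_hProd hz, h Fqt, h (RatFunc ℂ), map_sum, map_sum, Finset.mul_sum]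
  refine IsValueAt.sum fun μ _ => ?_
  rw [← smul_eq_C_mul, ← smul_eq_C_mul, map_smul, map_smul, smul_eq_mul, smul_eq_mul,
    mul_left_comm]
  exact (isValueAt_algebraMap_rat _).mul (isValueAt_pairQ_mono hζ μ)

open Classical in
theorem coeff_powVars_hsymm (l r : ℕ+) (a : ℕ →₀ ℕ) :
    MvPowerSeries.coeff a (powVars l (hsymm ℚ (r : ℕ)) : MvPowerSeries ℕ ℚ) =
      if a.degree = (l : ℕ) * (r : ℕ) ∧ ∀ i, (l : ℕ) ∣ a i then 1 else 0 := by
  rcases coeff_expand l l.ne_zero (hsymm ℚ (r : ℕ) : MvPowerSeries ℕ ℚ) a with ⟨h, ha⟩ | ⟨b, rfl, h⟩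
  · refine h.trans (if_neg fun h1 => ha ⟨a.mapRange (· / (l : ℕ)) (by simp), ?_⟩).symm
    ext i
    simp [Nat.mul_div_cancel' (h1.2 i)]
  · refine h.trans ?_
    rw [hsymm, coeff_ofType, expType_sum, map_nsmul, smul_eq_mul]
    refine if_congr ?_ rfl rfl
    rw [Nat.mul_right_inj l.ne_zero]
    simp

end Rectangle

end SymmFun

theorem mainTheorem2 (l r : ℕ+) (ζ : ℂ) (hζ : IsPrimitiveRoot ζ (l : ℕ)) :
    SymmFun.IsSpecializationAt ζ
      (SymmFun.macdonaldQ' (SymmFun.rect r l))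
      ((-1 : RatFunc ℂ) ^ (((l : ℕ) - 1) * (r : ℕ)) •
        SymmFun.Lam.map (algebraMap ℚ (RatFunc ℂ))
          (SymmFun.plethysm (SymmFun.psum ℚ l) (SymmFun.hsymm ℚ (r : ℕ)))) := by
  classical
  intro a
  have h : MvPowerSeries.coeff a ((((-1 : RatFunc ℂ) ^ (((l : ℕ) - 1) * (r : ℕ)) •
      SymmFun.Lam.map (algebraMap ℚ (RatFunc ℂ))
        (SymmFun.plethysm (SymmFun.psum ℚ l) (SymmFun.hsymm ℚ (r : ℕ))) :
          SymmFun.Lam (RatFunc ℂ)) : MvPowerSeries ℕ (RatFunc ℂ))) =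
      (-1) ^ (((l : ℕ) - 1) * (r : ℕ)) *
        if a.degree = (l : ℕ) * (r : ℕ) ∧ ∀ i, (l : ℕ) ∣ a i then 1 else 0 := by
    rw [SymmFun.plethysm_psum, Subalgebra.coe_smul, map_smul, smul_eq_mul, SymmFun.Lam.map,
      MvPowerSeries.coeff_map, SymmFun.coeff_powVars_hsymm, apply_ite (algebraMap ℚ (RatFunc ℂ)),
      map_one, map_zero]
  rw [h, SymmFun.coeff_macdonaldQ']
  by_cases ha : a.degree = (l : ℕ) * (r : ℕ)
  · simpa only [ha, true_and] using SymmFun.isValueAt_pairQ_hProd hζ ha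
  · rw [if_neg fun h => ha h.1, mul_zero, SymmFun.pairQ_apply,
      SymmFun.form_macP_hProd_of_degree_ne _ ha, mul_zero]
    exact SymmFun.isValueAt_zero
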